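/- \textbf{Theorem.} Consider randomized random access machines (RAMs) with logarithmic cost: registers and memory cells hold natural numbers, the instructions are addition, truncated subtraction, multiplication, integer division, remainder, bitwise exclusive or, indirect reading and writing of memory cells, tests for zero, and fair coin flips, and each operation is charged by the bit lengths of the numbers and addresses that occur in it. A graph on the $n$ vertices $0,\dots,n-1$ is given to the machine by $n$ and its adjacency matrix. \begin{enumerate} \item (\textsc{Undirected Hamiltonicity}) There are a randomized RAM program and a polynomial $p$ such that for every $n$ and every simple undirected graph $G$ on $n$ vertices the program, given $G$, halts after at most $p(n)\cdot 3^{n/2}$ time units for all outcomes of its coin flips; if $G$ has a Hamiltonian cycle, it answers \emph{true} with probability at least $1/2$, and if $G$ has no Hamiltonian cycle, it never answers \emph{true}. \item (\textsc{Directed Hamiltonicity} in bipartite graphs) There are a randomized RAM program and a polynomial $p$ such that the same holds for every $n$ and every bipartite directed graph $G$ on $n$ vertices (that is, the vertex set has a partition into two parts such that every arc goes from one of them to the other, in either direction; the partition is not part of the input) and directed Hamiltonian cycles. \end{enumerate} In other words, both problems can be solved by randomized algorithms with one-sided error in $O^*(3^{n/2})$ time. Here a Hamiltonian cycle is a cycle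 through all vertices; an undirected cycle has at least three vertices and a directed cycle at least two. -/

import Mathlib

open MeasureTheory

/-! ## Randomized random access machines with logarithmic cost -/

namespace RAM

/-- The arithmetic instructions, on natural numbers.  Subtraction is truncated, `div` and `mod` are
integer division and remainder, `xor` is the bitwise exclusive or. -/
inductive Op
  | add | sub | mul | div | mod | xor

/-- The value computed by an arithmetic instruction. -/
def Op.eval : Op → ℕ → ℕ → ℕ
  | .add, a, b => a + b
  | .sub, a, b => a - b
  | .mul, a, b => a * b
  | .div, a, b => a / b
  | .mod, a, b => a % b
  | .xor, a, b => a ^^^ b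

/-- A state of the machine: the contents of the registers and of the memory cells, and the number of
coins flipped so far. -/
structure State where
  reg : ℕ → ℕ
  mem : ℕ → ℕ
  coins : ℕ

/-- Expressions: constants, registers, indirect access to the memory, and arithmetic. -/
inductive Expr
  | const (k : ℕ)
  | reg (x : ℕ)
  | load (addr : Expr)
  | op (o : Op) (e₁ e₂ : Expr)

/-- The value of an expression in a state. -/
def Expr.eval (s : State) : Expr → ℕ
  | .const k => k
  | .reg x => s.reg x
  | .load a => s.mem (a.eval s)
  | .op o e₁ e₂ => o.eval (e₁.eval s) (e₂.eval s)

/-- The logarithmic cost of an expression: each node costs one plus the bit length of its value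
(so that operands, results and memory addresses are all charged for by their length). -/
def Expr.cost (s : State) : Expr → ℕ
  | .const k => 1 + k.size
  | .reg x => 1 + (s.reg x).size
  | .load a => 1 + (s.mem (a.eval s)).size + a.cost s
  | .op o e₁ e₂ => 1 + (o.eval (e₁.eval s) (e₂.eval s)).size + e₁.cost s + e₂.cost s

/-- Structured programs. -/
inductive Cmd
  | nop
  | assign (x : ℕ) (e : Expr)
  | store (addr e : Expr)
  | flip (x : ℕ)
  | seq (c₁ c₂ : Cmd)
  | ite (e : Expr) (c₁ c₂ : Cmd)
  | loop (e : Expr) (c : Cmd)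

/-- `Exec r c s t s'`: started in state `s`, with `r 0, r 1, …` as the outcomes of the coin flips,
the program `c` halts in state `s'` and its running time is `t`.  A test succeeds if its value is
nonzero; `loop e c` is "while `e` do `c`". -/
inductive Exec (r : ℕ → Bool) : Cmd → State → ℕ → State → Prop
  | nop (s : State) : Exec r .nop s 1 s
  | assign (x : ℕ) (e : Expr) (s : State) :
      Exec r (.assign x e) s (1 + e.cost s)
        { s with reg := Function.update s.reg x (e.eval s) }
  | store (a e : Expr) (s : State) :
      Exec r (.store a e) s (1 + a.cost s + e.cost s)
        { s with mem := Function.update s.mem (a.eval s) (e.eval s) }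
  | flip (x : ℕ) (s : State) :
      Exec r (.flip x) s 1
        { s with reg := Function.update s.reg x (r s.coins).toNat, coins := s.coins + 1 }
  | seq {c₁ c₂ : Cmd} {s s' s'' : State} {t t' : ℕ} :
      Exec r c₁ s t s' → Exec r c₂ s' t' s'' → Exec r (.seq c₁ c₂) s (t + t') s''
  | iteTrue {e : Expr} {c₁ c₂ : Cmd} {s s' : State} {t : ℕ} :
      e.eval s ≠ 0 → Exec r c₁ s t s' → Exec r (.ite e c₁ c₂) s (1 + e.cost s + t) s'
  | iteFalse {e : Expr} {c₁ c₂ : Cmd} {s s' : State} {t : ℕ} :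
      e.eval s = 0 → Exec r c₂ s t s' → Exec r (.ite e c₁ c₂) s (1 + e.cost s + t) s'
  | loopEnd {e : Expr} {c : Cmd} {s : State} :
      e.eval s = 0 → Exec r (.loop e c) s (1 + e.cost s) s
  | loopStep {e : Expr} {c : Cmd} {s s' s'' : State} {t t' : ℕ} :
      e.eval s ≠ 0 → Exec r c s t s' → Exec r (.loop e c) s' t' s'' →
      Exec r (.loop e c) s (1 + e.cost s + t + t') s''

/-- For fixed coin flips the run of a program is unique. -/
theorem Exec.deterministic {r : ℕ → Bool} {c : Cmd} {s : State} {t₁ : ℕ} {s₁ : State}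
    (h₁ : Exec r c s t₁ s₁) : ∀ {t₂ : ℕ} {s₂ : State}, Exec r c s t₂ s₂ → t₁ = t₂ ∧ s₁ = s₂ := by
  induction h₁ with
  | nop | assign | store | flip => intro t₂ s₂ h₂; cases h₂; exact ⟨rfl, rfl⟩
  | seq _ _ ih ih' =>
    intro t₂ s₂ h₂
    cases h₂ with
    | seq a b =>
      obtain ⟨rfl, rfl⟩ := ih a
      obtain ⟨rfl, rfl⟩ := ih' b
      exact ⟨rfl, rfl⟩
  | iteTrue h _ ih =>
    intro t₂ s₂ h₂
    cases h₂ with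
    | iteTrue _ a => obtain ⟨rfl, rfl⟩ := ih a; exact ⟨rfl, rfl⟩
    | iteFalse h' _ => exact absurd h' h
  | iteFalse h _ ih =>
    intro t₂ s₂ h₂
    cases h₂ with
    | iteTrue h' _ => exact absurd h h'
    | iteFalse _ a => obtain ⟨rfl, rfl⟩ := ih a; exact ⟨rfl, rfl⟩
  | loopEnd h =>
    intro t₂ s₂ h₂
    cases h₂ with
    | loopEnd _ => exact ⟨rfl, rfl⟩
    | loopStep h' _ _ => exact absurd h h'
  | loopStep h _ _ ih ih' =>
    intro t₂ s₂ h₂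
    cases h₂ with
    | loopEnd h' => exact absurd h' h
    | loopStep _ a b =>
      obtain ⟨rfl, rfl⟩ := ih a
      obtain ⟨rfl, rfl⟩ := ih' b
      exact ⟨rfl, rfl⟩

/-- The initial state for an input: the input is in the memory, all registers are zero. -/
def initState (input : ℕ → ℕ) : State := ⟨fun _ => 0, input, 0⟩

/-- With coin flips `r`, the program halts on the input after at most `T` time units. -/
def HaltsWithin (c : Cmd) (input : ℕ → ℕ) (r : ℕ → Bool) (T : ℝ) : Prop :=
  ∃ t s, Exec r c (initState input) t s ∧ (t : ℝ) ≤ T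

/-- With coin flips `r`, the program halts on the input and answers "true", that is, register `0`
is nonzero at the end. -/
def Accepts (c : Cmd) (input : ℕ → ℕ) (r : ℕ → Bool) : Prop :=
  ∃ t s, Exec r c (initState input) t s ∧ s.reg 0 ≠ 0

/-- The law of an infinite sequence of independent fair coin flips. -/
noncomputable def coinMeasure : Measure (ℕ → Bool) :=
  Measure.infinitePi fun _ => (PMF.uniformOfFintype Bool).toMeasure

/-- The program answers the question whether `Yes` holds on the given input in time at most `T`
(whatever the outcomes of the coin flips), with one-sided error: if the answer is yes, it answers
"true" with probability at least one half; otherwise it never answers "true". -/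
def Decides (c : Cmd) (input : ℕ → ℕ) (T : ℝ) (Yes : Prop) : Prop :=
  (∀ r, HaltsWithin c input r T) ∧
  (Yes → 1 / 2 ≤ coinMeasure {r | Accepts c input r}) ∧
  (¬ Yes → ∀ r, ¬ Accepts c input r)

end RAM

/-! ## Graphs -/

open Classical in
/-- The encoding of a graph on `{0, …, n - 1}` in the memory: cell `0` holds `n`, and the following
`n ^ 2` cells hold the adjacency matrix, row by row; all other cells are zero. -/
noncomputable def adjInput {n : ℕ} (adj : Fin n → Fin n → Prop) : ℕ → ℕ := fun a =>
  if a = 0 then n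
  else if ∃ u v : Fin n, a = 1 + (u : ℕ) * n + (v : ℕ) ∧ adj u v then 1
  else 0

/-- An undirected graph has a Hamiltonian cycle. -/
def SimpleGraph.HasHamiltonianCycle {V : Type*} [DecidableEq V] (G : SimpleGraph V) : Prop :=
  ∃ (v : V) (p : G.Walk v v), p.IsHamiltonianCycle

/-- A directed graph has a Hamiltonian cycle, given here by the map that sends each vertex to the
next one: a cyclic permutation moving all vertices, along arcs of the graph. -/
def Digraph.HasHamiltonianCycle {V : Type*} (G : Digraph V) : Prop :=
  ∃ σ : Equiv.Perm V, σ.IsCycle ∧ (∀ v, σ v ≠ v) ∧ ∀ v, G.Adj v (σ v)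

/-- A directed graph is bipartite: the vertices have a partition into two sets such that each arc
goes from one of them to the other (in either direction). -/
def Digraph.IsBipartite {V : Type*} (G : Digraph V) : Prop :=
  ∃ S : Set V, ∀ u v, G.Adj u v → (u ∈ S ↔ v ∉ S)

/-! On `2m + 2` vertices a Hamiltonian cycle is a pair of perfect matchings with connected union.
Matchings are fixed-point-free involutions `σ` and `τ`; the union is connected when only the zero
labelling by `ZMod 2` is invariant under both and vanishes at vertex `0` (`ConnectedPair`). For odd
`n`, vertex `0` is doubled. In a bipartite directed graph the matchings consist of the arcs leaving
the side of `0` and of the arcs entering it.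

All counting is done in characteristic two. There, the determinant of a symmetric matrix with zero
diagonal is a sum over fixed-point-free involutions (`Matrix.det_eq_sum_fpfInvolutions`), and
deleting the entries across a cut keeps exactly the involutions that preserve the cut. With `c`
components, `2 ^ (c - 1)` cuts with `0` on a fixed side are preserved by both `σ` and `τ`, an odd
number exactly if the pair is connected. But there are too many cuts to sum over.

The saving comes from using only `3 ^ m` cuts. A cut is read two vertices at a time, keeping the
parity `s` of the labels so far; of the four possible pairs of new labels, the one with both labels
different from `s` gets no code. Summed over all pairs of codes in which every digit differs, the
products of the indicators "`σ` preserves the first cut" and "`τ` preserves the second" add up to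
the indicator of connectedness (`digitForm_indicator`). The proof, `digitForm_cutCount`, is an
induction on `m` for arbitrary isotropic spaces of at least half the dimension; the labellings
invariant under an involution form such a space. The 3 by 3 matrix of "digits differ" has rank two
modulo two, so splitting off a digit leaves two smaller instances. Their total differs from the
desired count by the sum of a quadratic function that isotropy makes affine, over a space of
dimension at least two; this sum is zero.

With independent weights for the entries of the two matrices, the form becomes a polynomial in the
weights that is nonzero exactly when a connected pair exists. It is evaluated at random polynomials
over the field with two elements, coded by the bits of natural numbers; Schwartz–Zippel
(`RAM.half_le_coinMeasure_weightForm`) bounds the error, which is one-sided because a nonzero value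
exhibits a pair. Determinants are computed without division through closed ordered walks
(`sum_clow_eq_det`), and the sum over differing digits takes `m` rounds on a table of `3 ^ m`
entries. So the time is polynomial times `3 ^ m`, with `m ≤ n / 2`. The machine code is obtained
from a small language of bounded loops, whose correctness and cost are proved once
(`RAM.Prog.exec`). -/

/-! ## Base-three cuts and the transform by "all digits differ" -/

/-- Replace the `i`-th base-three digit `d` of `t` by `d + c` modulo three. -/
def rotDigit (i c t : ℕ) : ℕ := t - t / 3 ^ i % 3 * 3 ^ i + (t / 3 ^ i % 3 + c) % 3 * 3 ^ i

/-- After `i` rounds, each entry is the sum of the entries whose digits below `i` all differ and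
whose other digits agree. -/
def digitTransform {α : Type*} (op : α → α → α) (T : ℕ → α) : ℕ → ℕ → α
  | 0, t => T t
  | i + 1, t => op (digitTransform op T i (rotDigit i 1 t)) (digitTransform op T i (rotDigit i 2 t))

/-- The side on which the active vertex lies after `i` pairs of the cut coded by `t`. -/
def cutSide (t : ℕ) : ℕ → ℕ
  | 0 => 0
  | i + 1 => (cutSide t i + (1 - (t / 3 ^ i % 3 - 1))) % 2

/-- The side of the first vertex of the `i`-th pair. -/
def cutFst (t i : ℕ) : ℕ := (cutSide t i + t / 3 ^ i % 3 % 2) % 2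

/-- The side of the second vertex of the `i`-th pair. -/
def cutSnd (t i : ℕ) : ℕ := (cutSide t i + (1 - t / 3 ^ i % 3)) % 2

theorem digit_add_top {m t d i : ℕ} (hi : i < m) :
    (t + d * 3 ^ m) / 3 ^ i % 3 = t / 3 ^ i % 3 := by
  obtain ⟨k, rfl⟩ := Nat.exists_eq_add_of_lt hi
  have : d * 3 ^ (i + k + 1) = 3 ^ i * (3 * (d * 3 ^ k)) := by ring
  rw [this, Nat.add_mul_div_left _ _ (by positivity), Nat.add_mul_mod_self_left]

theorem digit_top {m t d : ℕ} (ht : t < 3 ^ m) (hd : d < 3) : (t + d * 3 ^ m) / 3 ^ m % 3 = d := by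
  rw [Nat.add_mul_div_right _ _ (by positivity), Nat.div_eq_of_lt ht, zero_add,
    Nat.mod_eq_of_lt hd]

theorem digit_mul_le (t i : ℕ) : t / 3 ^ i % 3 * 3 ^ i ≤ t :=
  (Nat.mul_le_mul_right _ (Nat.mod_le _ _)).trans (Nat.div_mul_le_self _ _)

theorem rotDigit_add_top {m t d i c : ℕ} (hi : i < m) :
    rotDigit i c (t + d * 3 ^ m) = rotDigit i c t + d * 3 ^ m := by
  have := digit_mul_le t i
  unfold rotDigit
  rw [digit_add_top hi]
  omega

theorem rotDigit_top {m t d c : ℕ} (ht : t < 3 ^ m) (hd : d < 3) :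
    rotDigit m c (t + d * 3 ^ m) = t + (d + c) % 3 * 3 ^ m := by
  unfold rotDigit
  rw [digit_top ht hd]
  omega

theorem rotDigit_lt {m t i c : ℕ} (hi : i < m) (ht : t < 3 ^ m) : rotDigit i c t < 3 ^ m := by
  obtain ⟨k, rfl⟩ := Nat.exists_eq_add_of_lt hi
  unfold rotDigit
  have h3 : 0 < 3 ^ i := by positivity
  set a := t / 3 ^ i with ha
  set b := t % 3 ^ i with hb
  have hab : t = 3 ^ i * a + b := (Nat.div_add_mod _ _).symm
  have hbl : b < 3 ^ i := Nat.mod_lt _ h3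
  have hak : a < 3 ^ k * 3 := by
    rw [ha, Nat.div_lt_iff_lt_mul h3]
    calc t < _ := ht
      _ = _ := by ring
  have hc : (a % 3 + c) % 3 < 3 := Nat.mod_lt _ (by norm_num)
  generalize (a % 3 + c) % 3 = e at hc
  have ha3 : a = 3 * (a / 3) + a % 3 := (Nat.div_add_mod _ _).symm
  have hk : a / 3 < 3 ^ k := Nat.div_lt_of_lt_mul (by linarith)
  have h1 : t - a % 3 * 3 ^ i = 3 ^ i * (3 * (a / 3)) + b := by
    have : t = 3 ^ i * (3 * (a / 3)) + b + a % 3 * 3 ^ i := by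
      conv_lhs => rw [hab, ha3]
      ring
    omega
  rw [h1]
  calc 3 ^ i * (3 * (a / 3)) + b + e * 3 ^ i < 3 ^ i * (3 * (a / 3)) + 3 ^ i + e * 3 ^ i := by omega
    _ = 3 ^ i * (3 * (a / 3) + 1 + e) := by ring
    _ ≤ 3 ^ i * (3 ^ k * 3) := Nat.mul_le_mul_left _ (by omega)
    _ = _ := by ring

theorem digitTransform_add_top {α : Type*} (op : α → α → α) (T : ℕ → α) {m d : ℕ} :
    ∀ {i : ℕ}, i ≤ m → ∀ t, digitTransform op T i (t + d * 3 ^ m)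
      = digitTransform op (fun t => T (t + d * 3 ^ m)) i t
  | 0, _, _ => rfl
  | i + 1, hi, t => by
    simp only [digitTransform, rotDigit_add_top (show i < m from hi)]
    rw [digitTransform_add_top op T (by omega), digitTransform_add_top op T (by omega)]

/-- The bilinear form of the functions on codes in which all digits of the arguments differ. -/
def digitForm {K : Type*} [CommRing K] (m : ℕ) (F G : ℕ → K) : K :=
  ∑ t ∈ Finset.range (3 ^ m), F t * digitTransform (· + ·) G m t

section digitForm
variable {K : Type*} [CommRing K]

theorem digitTransform_map {α β : Type*} (op : α → α → α) (op' : β → β → β) (f : α → β)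
    (hf : ∀ a b, f (op a b) = op' (f a) (f b)) (T : ℕ → α) :
    ∀ i t, f (digitTransform op T i t) = digitTransform op' (fun t => f (T t)) i t
  | 0, _ => rfl
  | i + 1, t => by
    simp only [digitTransform, hf, digitTransform_map op op' f hf T i]

theorem digitTransform_sum {ι : Type*} (s : Finset ι) (c : ι → K) (T : ι → ℕ → K) :
    ∀ i t, digitTransform (· + ·) (fun t => ∑ a ∈ s, c a * T a t) i t
      = ∑ a ∈ s, c a * digitTransform (· + ·) (T a) i t
  | 0, _ => rfl
  | i + 1, t => by
    simp only [digitTransform, digitTransform_sum s c T i, ← Finset.sum_add_distrib, mul_add]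

theorem digitTransform_add (T U : ℕ → K) :
    ∀ i t, digitTransform (· + ·) (fun t => T t + U t) i t
      = digitTransform (· + ·) T i t + digitTransform (· + ·) U i t
  | 0, _ => rfl
  | i + 1, t => by
    simp only [digitTransform, digitTransform_add T U i]
    ring

theorem digitTransform_congr {α : Type*} (op : α → α → α) {T U : ℕ → α} {m : ℕ}
    (h : ∀ t < 3 ^ m, T t = U t) : ∀ {i : ℕ}, i ≤ m → ∀ t < 3 ^ m,
      digitTransform op T i t = digitTransform op U i t
  | 0, _, t, ht => h t ht
  | i + 1, hi, t, ht => by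
    simp only [digitTransform]
    rw [digitTransform_congr op h (by omega) _ (rotDigit_lt hi ht),
      digitTransform_congr op h (by omega) _ (rotDigit_lt hi ht)]

theorem digitForm_congr {m : ℕ} {F F' G G' : ℕ → K} (hF : ∀ t < 3 ^ m, F t = F' t)
    (hG : ∀ t < 3 ^ m, G t = G' t) : digitForm m F G = digitForm m F' G' := by
  refine Finset.sum_congr rfl fun t ht => ?_
  rw [hF t (Finset.mem_range.1 ht), digitTransform_congr _ hG le_rfl t (Finset.mem_range.1 ht)]

theorem digitForm_add_left (m : ℕ) (F F' G : ℕ → K) :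
    digitForm m (fun t => F t + F' t) G = digitForm m F G + digitForm m F' G := by
  simp only [digitForm, add_mul, Finset.sum_add_distrib]

theorem digitForm_add_right (m : ℕ) (F G G' : ℕ → K) :
    digitForm m F (fun t => G t + G' t) = digitForm m F G + digitForm m F G' := by
  simp only [digitForm, digitTransform_add, mul_add, Finset.sum_add_distrib]

theorem digitForm_sum {ι κ : Type*} (s : Finset ι) (s' : Finset κ) (c : ι → K) (c' : κ → K)
    (F : ι → ℕ → K) (G : κ → ℕ → K) (m : ℕ) :
    digitForm m (fun t => ∑ a ∈ s, c a * F a t) (fun t => ∑ b ∈ s', c' b * G b t)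
      = ∑ a ∈ s, ∑ b ∈ s', c a * c' b * digitForm m (F a) (G b) := by
  simp only [digitForm, digitTransform_sum, Finset.sum_mul_sum]
  rw [Finset.sum_comm]
  refine Finset.sum_congr rfl fun a _ => ?_
  rw [Finset.sum_comm]
  refine Finset.sum_congr rfl fun b _ => ?_
  rw [Finset.mul_sum]
  exact Finset.sum_congr rfl fun t _ => by ring

theorem map_digitForm {L : Type*} [CommRing L] (f : K →+* L) (m : ℕ) (F G : ℕ → K) :
    f (digitForm m F G) = digitForm m (fun t => f (F t)) (fun t => f (G t)) := by
  simp only [digitForm, map_sum, map_mul,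
    digitTransform_map (· + ·) (· + ·) f (fun a b => map_add f a b)]

theorem sum_range_three_pow_succ (m : ℕ) (f : ℕ → K) :
    ∑ t ∈ Finset.range (3 ^ (m + 1)), f t = ∑ t ∈ Finset.range (3 ^ m),
      (f (t + 0 * 3 ^ m) + f (t + 1 * 3 ^ m) + f (t + 2 * 3 ^ m)) := by
  have : 3 ^ (m + 1) = 3 ^ m + 3 ^ m + 3 ^ m := by ring
  rw [this, Finset.sum_range_add, Finset.sum_range_add, ← Finset.sum_add_distrib,
    ← Finset.sum_add_distrib]
  refine Finset.sum_congr rfl fun t _ => ?_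
  rw [zero_mul, one_mul, add_zero, add_comm (3 ^ m) t, two_mul, add_comm t (3 ^ m + 3 ^ m)]

/-- Rounds below `m` leave the top digit alone, and the last round replaces it by its two other
values. So the top digit is paired by the 3 by 3 matrix with zeros on the diagonal and ones
elsewhere. -/
theorem digitForm_succ (m : ℕ) (F G : ℕ → K) :
    let F' := fun d t => F (t + d * 3 ^ m)
    let G' := fun d t => G (t + d * 3 ^ m)
    digitForm (m + 1) F G = digitForm m (F' 0) (fun t => G' 1 t + G' 2 t)
      + digitForm m (F' 1) (fun t => G' 2 t + G' 0 t)
      + digitForm m (F' 2) (fun t => G' 0 t + G' 1 t) := by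
  intro F' G'
  rw [digitForm, sum_range_three_pow_succ]
  simp only [digitForm, ← Finset.sum_add_distrib]
  refine Finset.sum_congr rfl fun t ht => ?_
  have ht := Finset.mem_range.1 ht
  simp only [digitTransform, rotDigit_top ht (show 0 < 3 by norm_num),
    rotDigit_top ht (show 1 < 3 by norm_num), rotDigit_top ht (show 2 < 3 by norm_num),
    digitTransform_add_top _ G le_rfl, digitTransform_add]
  rfl

end digitForm

/-! ## Counting pairs in two isotropic spaces modulo two -/

theorem ZMod.mul_self_two (a : ZMod 2) : a * a = a := by revert a; decide

section Isotropic
open Module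

theorem Submodule.finrank_le_finrank_inf_ker {k V W : Type*} [Field k] [AddCommGroup V] [Module k V]
    [FiniteDimensional k V] [AddCommGroup W] [Module k W] [FiniteDimensional k W]
    (D : Submodule k V) (g : V →ₗ[k] W) :
    finrank k D ≤ finrank k ↥(D ⊓ LinearMap.ker g) + finrank k W := by
  have h1 := Submodule.finrank_sup_add_finrank_inf_eq D (LinearMap.ker g)
  have h2 := LinearMap.finrank_range_add_finrank_ker g
  have h3 := Submodule.finrank_le (LinearMap.range g)
  have h4 := Submodule.finrank_le (D ⊔ LinearMap.ker g)
  omega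

theorem Submodule.le_finrank_inf_ker {k V : Type*} [Field k] [AddCommGroup V] [Module k V]
    [FiniteDimensional k V] {D : Submodule k V} {f : V →ₗ[k] k} {d : ℕ}
    (h : d + 1 ≤ finrank k D) : d ≤ finrank k ↥(D ⊓ LinearMap.ker f) := by
  have := Submodule.finrank_le_finrank_inf_ker D f
  rw [finrank_self] at this
  omega

open Classical in
/-- An additive function on a space of dimension at least two over the field with two elements
has sum zero, even after adding a constant. -/
theorem Submodule.sum_eq_zero_of_additive {E : Type*} [AddCommGroup E] [Module (ZMod 2) E]
    [Fintype E] (D : Submodule (ZMod 2) E) (hD : 2 ≤ finrank (ZMod 2) D) (f : E → ZMod 2)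
    (hf : ∀ w ∈ D, ∀ w' ∈ D, f (w + w') = f w + f w') (c : ZMod 2) :
    ∑ w, (if w ∈ D then c + f w else 0) = 0 := by
  let g : D →+ ZMod 2 := AddMonoidHom.mk' (fun w => f w) fun a b => hf a a.2 b b.2
  let g' : D →ₗ[ZMod 2] ZMod 2 := g.toZModLinearMap 2
  -- The image lies in a line, so on a space of dimension two the map kills some nonzero `w₀`.
  -- Translation by `w₀` then pairs off terms of equal value.
  have hk : 0 < finrank (ZMod 2) (LinearMap.ker g') := by
    have h2 := LinearMap.finrank_range_add_finrank_ker g'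
    have h3 := Submodule.finrank_le (LinearMap.range g')
    rw [finrank_self] at h3
    omega
  have : Nontrivial (LinearMap.ker g') := Module.nontrivial_of_finrank_pos hk
  obtain ⟨⟨⟨w₀, hw₀⟩, hg⟩, hne⟩ := exists_ne (0 : LinearMap.ker g')
  have hfw : f w₀ = 0 := hg
  have hw0 : w₀ ≠ 0 := by
    rintro rfl
    exact hne rfl
  have h2 : w₀ + w₀ = 0 := by
    rw [← two_smul (ZMod 2) w₀]
    exact zero_smul _ _
  refine Finset.sum_involution (fun w _ => w + w₀) ?_ ?_ ?_ ?_
  · intro w _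
    by_cases hw : w ∈ D
    · rw [if_pos hw, if_pos (D.add_mem hw hw₀), hf w hw w₀ hw₀, hfw, add_zero]
      exact CharTwo.add_self_eq_zero _
    · rw [if_neg hw, if_neg, add_zero]
      rwa [D.add_mem_iff_left hw₀]
  · intro w _ _ h
    exact hw0 (by simpa using h)
  · simp
  · intro w _
    rw [add_assoc, h2, add_zero]

variable {M₁ M₂ : Type*} [AddCommGroup M₁] [Module (ZMod 2) M₁] [Fintype M₁]
  [AddCommGroup M₂] [Module (ZMod 2) M₂] [Fintype M₂]

open Classical in
/-- The number, modulo two, of elements of `D` whose coordinates are those of the cut coded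
by `t`. -/
noncomputable def cutCount {M : Type*} [AddCommGroup M] [Module (ZMod 2) M] [Fintype M]
    (D : Submodule (ZMod 2) M) (z l : M →ₗ[ZMod 2] ZMod 2) (p q : ℕ → M →ₗ[ZMod 2] ZMod 2)
    (m t : ℕ) : ZMod 2 :=
  ∑ w, if w ∈ D ∧ z w = 0 ∧ (∀ i < m, p i w = cutFst t i ∧ q i w = cutSnd t i)
    ∧ l w = cutSide t m then 1 else 0

/-- The bilinear form vanishes on `D`. -/
def IsotropicOn {M : Type*} [AddCommGroup M] [Module (ZMod 2) M]
    (D : Submodule (ZMod 2) M) (z l : M →ₗ[ZMod 2] ZMod 2) (p q : ℕ → M →ₗ[ZMod 2] ZMod 2)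
    (m : ℕ) : Prop :=
  ∀ w ∈ D, ∀ w' ∈ D,
    z w * z w' + ∑ i ∈ Finset.range m, (p i w * p i w' + q i w * q i w') + l w * l w' = 0

theorem cutSide_add_top {m t d : ℕ} : ∀ {i : ℕ}, i ≤ m → cutSide (t + d * 3 ^ m) i = cutSide t i
  | 0, _ => rfl
  | i + 1, hi => by
    simp only [cutSide, cutSide_add_top (show i ≤ m by omega), digit_add_top (show i < m from hi)]

theorem cutFst_add_top {m t d i : ℕ} (hi : i < m) : cutFst (t + d * 3 ^ m) i = cutFst t i := by
  simp only [cutFst, cutSide_add_top hi.le, digit_add_top hi]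

theorem cutSnd_add_top {m t d i : ℕ} (hi : i < m) : cutSnd (t + d * 3 ^ m) i = cutSnd t i := by
  simp only [cutSnd, cutSide_add_top hi.le, digit_add_top hi]

-- With `s` the side reached after `m` pairs, the digits `0`, `1`, `2` prescribe the triples `(s, s
-- + 1, s + 1)`, `(s + 1, s, s + 1)` and `(s, s, s)` for the new pair and the last coordinate. The
-- remaining triple of parity `s`, namely `(s + 1, s + 1, s)`, has no code.
open Classical in
theorem cutCount_succ {M : Type*} [AddCommGroup M] [Module (ZMod 2) M] [Fintype M]
    (D : Submodule (ZMod 2) M) (z l : M →ₗ[ZMod 2] ZMod 2) (p q : ℕ → M →ₗ[ZMod 2] ZMod 2)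
    (m t d : ℕ) (ht : t < 3 ^ m) (hd : d < 3) :
    cutCount D z l p q (m + 1) (t + d * 3 ^ m) =
      ∑ w, if w ∈ D ∧ z w = 0 ∧ (∀ i < m, p i w = cutFst t i ∧ q i w = cutSnd t i)
        ∧ (p m w = cutSide t m + (d : ℕ) ∧ q m w = cutSide t m + ((1 - d : ℕ) : ℕ)
          ∧ l w = cutSide t m + ((1 - (d - 1) : ℕ) : ℕ)) then 1 else 0 := by
  refine Finset.sum_congr rfl fun w _ => if_congr ?_ rfl rfl
  simp only [Nat.lt_succ_iff_lt_or_eq, or_imp, forall_and, forall_eq, cutSide,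
    cutSide_add_top le_rfl, cutFst, cutSnd, digit_top ht hd, ZMod.natCast_mod, Nat.cast_add]
  have h2 : (∀ i < m, p i w = cutFst (t + d * 3 ^ m) i) ↔ (∀ i < m, p i w = cutFst t i) :=
    forall₂_congr fun i hi => by rw [cutFst_add_top hi]
  have h3 : (∀ i < m, q i w = cutSnd (t + d * 3 ^ m) i) ↔ (∀ i < m, q i w = cutSnd t i) :=
    forall₂_congr fun i hi => by rw [cutSnd_add_top hi]
  simp only [cutFst, cutSnd, ZMod.natCast_mod, Nat.cast_add] at h2 h3
  rw [h2, h3]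
  tauto

theorem indicator_add_indicator {X Y Z : Prop} [Decidable X] [Decidable Y] [Decidable Z]
    (h : ¬ (X ∧ Y)) (hZ : Z ↔ X ∨ Y) :
    (if X then (1 : ZMod 2) else 0) + (if Y then 1 else 0) = if Z then 1 else 0 := by
  by_cases hX : X <;> by_cases hY : Y <;> simp_all

/-- The digits `0` and `2` are those whose triple has first entry `s` and equal second and third
entries. So the second coordinate is absorbed by the condition `q m = l`, and `p m` takes over the
role of the last coordinate. -/
theorem cutCount_snd_eq {M : Type*} [AddCommGroup M] [Module (ZMod 2) M] [Fintype M]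
    (D : Submodule (ZMod 2) M) (z l : M →ₗ[ZMod 2] ZMod 2) (p q : ℕ → M →ₗ[ZMod 2] ZMod 2)
    (m t : ℕ) (ht : t < 3 ^ m) :
    cutCount D z l p q (m + 1) (t + 0 * 3 ^ m) + cutCount D z l p q (m + 1) (t + 2 * 3 ^ m)
      = cutCount (D ⊓ LinearMap.ker (q m - l)) z (p m) p q m t := by
  classical
  rw [cutCount_succ _ _ _ _ _ _ _ _ ht (by norm_num), cutCount_succ _ _ _ _ _ _ _ _ ht (by norm_num),
    cutCount, ← Finset.sum_add_distrib]
  refine Finset.sum_congr rfl fun w _ => ?_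
  simp only [Submodule.mem_inf, LinearMap.mem_ker, LinearMap.sub_apply, sub_eq_zero]
  have key : ∀ s a b c : ZMod 2, (a = s ∧ b = c ↔ a = s + (0 : ℕ) ∧ b = s + (1 - 0 : ℕ) ∧ c = s + (1 - (0 - 1) : ℕ)
      ∨ a = s + (2 : ℕ) ∧ b = s + (1 - 2 : ℕ) ∧ c = s + (1 - (2 - 1) : ℕ)) := by decide
  have key' := key (cutSide t m) (p m w) (q m w) (l w)
  refine indicator_add_indicator ?_ (by tauto)
  rintro ⟨⟨-, -, -, ha, hb, hc⟩, -, -, -, ha', hb', hc'⟩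
  revert hb hb'
  generalize (cutSide t m : ZMod 2) = s
  generalize q m w = b
  revert s b
  decide

/-- The same for the digits `1` and `2`, whose second entry is `s` and whose first and third entries
are equal. -/
theorem cutCount_fst_eq {M : Type*} [AddCommGroup M] [Module (ZMod 2) M] [Fintype M]
    (D : Submodule (ZMod 2) M) (z l : M →ₗ[ZMod 2] ZMod 2) (p q : ℕ → M →ₗ[ZMod 2] ZMod 2)
    (m t : ℕ) (ht : t < 3 ^ m) :
    cutCount D z l p q (m + 1) (t + 1 * 3 ^ m) + cutCount D z l p q (m + 1) (t + 2 * 3 ^ m)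
      = cutCount (D ⊓ LinearMap.ker (p m - l)) z (q m) p q m t := by
  classical
  rw [cutCount_succ _ _ _ _ _ _ _ _ ht (by norm_num), cutCount_succ _ _ _ _ _ _ _ _ ht (by norm_num),
    cutCount, ← Finset.sum_add_distrib]
  refine Finset.sum_congr rfl fun w _ => ?_
  simp only [Submodule.mem_inf, LinearMap.mem_ker, LinearMap.sub_apply, sub_eq_zero]
  have key : ∀ s a b c : ZMod 2, (b = s ∧ a = c ↔ a = s + (1 : ℕ) ∧ b = s + (1 - 1 : ℕ) ∧ c = s + (1 - (1 - 1) : ℕ)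
      ∨ a = s + (2 : ℕ) ∧ b = s + (1 - 2 : ℕ) ∧ c = s + (1 - (2 - 1) : ℕ)) := by decide
  have key' := key (cutSide t m) (p m w) (q m w) (l w)
  refine indicator_add_indicator ?_ (by tauto)
  rintro ⟨⟨-, -, -, ha, hb, hc⟩, -, -, -, ha', hb', hc'⟩
  revert ha ha'
  generalize (cutSide t m : ZMod 2) = s
  generalize p m w = b
  revert s b
  decide

/-- The quadratic form that singles out the triples with `a = b ≠ c`. -/
def tripleForm (a b c : ZMod 2) : ZMod 2 := (1 + a + b) * (a + c)

/-- Squaring is the identity modulo two, so isotropy of `w` with itself speaks of the parity of its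
coordinates. -/
theorem IsotropicOn.parity {M : Type*} [AddCommGroup M] [Module (ZMod 2) M]
    {D : Submodule (ZMod 2) M} {z l : M →ₗ[ZMod 2] ZMod 2} {p q : ℕ → M →ₗ[ZMod 2] ZMod 2}
    {m : ℕ} (h : IsotropicOn D z l p q m) {w : M} (hw : w ∈ D) :
    z w + ∑ i ∈ Finset.range m, (p i w + q i w) + l w = 0 := by
  simpa only [ZMod.mul_self_two] using h w hw w hw

/-- Where `q m = l`, the products of these two coordinates cancel modulo two. What remains is the
form with one pair less and `p m` as last coordinate. -/
theorem IsotropicOn.inf_snd {M : Type*} [AddCommGroup M] [Module (ZMod 2) M]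
    {D : Submodule (ZMod 2) M} {z l : M →ₗ[ZMod 2] ZMod 2} {p q : ℕ → M →ₗ[ZMod 2] ZMod 2}
    {m : ℕ} (h : IsotropicOn D z l p q (m + 1)) :
    IsotropicOn (D ⊓ LinearMap.ker (q m - l)) z (p m) p q m := by
  intro w hw w' hw'
  simp only [Submodule.mem_inf, LinearMap.mem_ker, LinearMap.sub_apply, sub_eq_zero] at hw hw'
  have := h w hw.1 w' hw'.1
  rw [Finset.sum_range_succ, hw.2, hw'.2] at this
  rw [← this]
  linear_combination -CharTwo.add_self_eq_zero (l w * l w')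

theorem IsotropicOn.inf_fst {M : Type*} [AddCommGroup M] [Module (ZMod 2) M]
    {D : Submodule (ZMod 2) M} {z l : M →ₗ[ZMod 2] ZMod 2} {p q : ℕ → M →ₗ[ZMod 2] ZMod 2}
    {m : ℕ} (h : IsotropicOn D z l p q (m + 1)) :
    IsotropicOn (D ⊓ LinearMap.ker (p m - l)) z (q m) p q m := by
  intro w hw w' hw'
  simp only [Submodule.mem_inf, LinearMap.mem_ker, LinearMap.sub_apply, sub_eq_zero] at hw hw'
  have := h w hw.1 w' hw'.1
  rw [Finset.sum_range_succ, hw.2, hw'.2] at this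
  rw [← this]
  linear_combination -CharTwo.add_self_eq_zero (l w * l w')

/-- The space of pairs that agree in the first `2 m + 1` coordinates, the first being zero. -/
def agreeSpace (D₁ : Submodule (ZMod 2) M₁) (D₂ : Submodule (ZMod 2) M₂)
    (z₁ : M₁ →ₗ[ZMod 2] ZMod 2) (p₁ q₁ : ℕ → M₁ →ₗ[ZMod 2] ZMod 2)
    (z₂ : M₂ →ₗ[ZMod 2] ZMod 2) (p₂ q₂ : ℕ → M₂ →ₗ[ZMod 2] ZMod 2) (m : ℕ) :
    Submodule (ZMod 2) (M₁ × M₂) :=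
  D₁.prod D₂ ⊓ LinearMap.ker (((z₁ ∘ₗ LinearMap.fst _ _ _).prod (z₂ ∘ₗ LinearMap.snd _ _ _)).prod
    ((LinearMap.pi fun i : Fin m => p₁ i ∘ₗ LinearMap.fst _ _ _ - p₂ i ∘ₗ LinearMap.snd _ _ _).prod
    (LinearMap.pi fun i : Fin m => q₁ i ∘ₗ LinearMap.fst _ _ _ - q₂ i ∘ₗ LinearMap.snd _ _ _)))

omit [Fintype M₁] [Fintype M₂] in
theorem mem_agreeSpace {D₁ : Submodule (ZMod 2) M₁} {D₂ : Submodule (ZMod 2) M₂}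
    {z₁ : M₁ →ₗ[ZMod 2] ZMod 2} {p₁ q₁ : ℕ → M₁ →ₗ[ZMod 2] ZMod 2}
    {z₂ : M₂ →ₗ[ZMod 2] ZMod 2} {p₂ q₂ : ℕ → M₂ →ₗ[ZMod 2] ZMod 2} {m : ℕ} {w : M₁ × M₂} :
    w ∈ agreeSpace D₁ D₂ z₁ p₁ q₁ z₂ p₂ q₂ m ↔ w.1 ∈ D₁ ∧ w.2 ∈ D₂ ∧ z₁ w.1 = 0 ∧ z₂ w.2 = 0 ∧
      ∀ i < m, p₁ i w.1 = p₂ i w.2 ∧ q₁ i w.1 = q₂ i w.2 := by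
  simp only [agreeSpace, Submodule.mem_inf, Submodule.mem_prod, LinearMap.mem_ker,
    LinearMap.prod_apply, Function.prod_apply, Prod.mk_eq_zero, LinearMap.coe_comp, Function.comp,
    LinearMap.fst_apply, LinearMap.snd_apply, funext_iff, LinearMap.pi_apply, LinearMap.sub_apply,
    sub_eq_zero, Pi.zero_apply, forall_and, Fin.forall_iff]
  tauto

/-- Agreement imposes `2 * m + 2` linear conditions: the two first coordinates vanish, and each of
the `m` pairs contributes two equations. -/
theorem finrank_le_agreeSpace {D₁ : Submodule (ZMod 2) M₁} {D₂ : Submodule (ZMod 2) M₂}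
    {z₁ : M₁ →ₗ[ZMod 2] ZMod 2} {p₁ q₁ : ℕ → M₁ →ₗ[ZMod 2] ZMod 2}
    {z₂ : M₂ →ₗ[ZMod 2] ZMod 2} {p₂ q₂ : ℕ → M₂ →ₗ[ZMod 2] ZMod 2} {m : ℕ} :
    finrank (ZMod 2) D₁ + finrank (ZMod 2) D₂
      ≤ finrank (ZMod 2) (agreeSpace D₁ D₂ z₁ p₁ q₁ z₂ p₂ q₂ m) + (2 * m + 2) := by
  have h := Submodule.finrank_le_finrank_inf_ker (D₁.prod D₂)
    (((z₁ ∘ₗ LinearMap.fst _ _ _).prod (z₂ ∘ₗ LinearMap.snd _ _ _)).prod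
    ((LinearMap.pi fun i : Fin m => p₁ i ∘ₗ LinearMap.fst _ _ _ - p₂ i ∘ₗ LinearMap.snd _ _ _).prod
    (LinearMap.pi fun i : Fin m => q₁ i ∘ₗ LinearMap.fst _ _ _ - q₂ i ∘ₗ LinearMap.snd _ _ _)))
  have hp : finrank (ZMod 2) (D₁.prod D₂) = finrank (ZMod 2) D₁ + finrank (ZMod 2) D₂ := by
    rw [← Module.finrank_prod]
    exact LinearEquiv.finrank_eq
      { toFun := fun w => (⟨w.1.1, w.2.1⟩, ⟨w.1.2, w.2.2⟩)
        invFun := fun w => ⟨(w.1, w.2), w.1.2, w.2.2⟩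
        map_add' := fun _ _ => rfl
        map_smul' := fun _ _ => rfl
        left_inv := fun _ => rfl
        right_inv := fun _ => rfl }
  have hc : finrank (ZMod 2) ((ZMod 2 × ZMod 2) × (Fin m → ZMod 2) × (Fin m → ZMod 2))
      = 2 * m + 2 := by
    simp only [finrank_prod, finrank_self, finrank_pi, Fintype.card_fin]
    omega
  rw [hp, hc] at h
  exact h

omit [AddCommGroup M₁] [Module (ZMod 2) M₁] [AddCommGroup M₂] [Module (ZMod 2) M₂] in
theorem sum_sum_ite_eq_sum_prod (c : M₁ → M₂ → Prop) [∀ a b, Decidable (c a b)] :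
    ∑ a, ∑ b, (if c a b then (1 : ZMod 2) else 0)
      = ∑ w : M₁ × M₂, if c w.1 w.2 then 1 else 0 :=
  (Fintype.sum_prod_type' fun a b => if c a b then (1 : ZMod 2) else 0).symm

open Classical in
/-- For two isotropic spaces of at least half the dimension, the bilinear form of the counts of
codes counts the agreeing pairs modulo two. -/
theorem digitForm_cutCount (m : ℕ) : ∀ (D₁ : Submodule (ZMod 2) M₁) (D₂ : Submodule (ZMod 2) M₂)
    (z₁ l₁ : M₁ →ₗ[ZMod 2] ZMod 2) (p₁ q₁ : ℕ → M₁ →ₗ[ZMod 2] ZMod 2)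
    (z₂ l₂ : M₂ →ₗ[ZMod 2] ZMod 2) (p₂ q₂ : ℕ → M₂ →ₗ[ZMod 2] ZMod 2),
    IsotropicOn D₁ z₁ l₁ p₁ q₁ m → IsotropicOn D₂ z₂ l₂ p₂ q₂ m →
    m + 1 ≤ finrank (ZMod 2) D₁ → m + 1 ≤ finrank (ZMod 2) D₂ →
    digitForm m (cutCount D₁ z₁ l₁ p₁ q₁ m) (cutCount D₂ z₂ l₂ p₂ q₂ m)
      = ∑ w : M₁ × M₂, if w ∈ agreeSpace D₁ D₂ z₁ p₁ q₁ z₂ p₂ q₂ m ∧ l₁ w.1 = l₂ w.2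
          then 1 else 0 := by
  induction m with
  | zero =>
    intro D₁ D₂ z₁ l₁ p₁ q₁ z₂ l₂ p₂ q₂ h₁ h₂ _ _
    simp only [digitForm, pow_zero, Finset.sum_range_one, digitTransform, cutCount,
      Finset.sum_mul_sum, ← ite_and, ite_mul, one_mul, zero_mul]
    rw [sum_sum_ite_eq_sum_prod]
    refine Finset.sum_congr rfl fun w _ => if_congr ?_ rfl rfl
    rw [mem_agreeSpace]
    -- With no pairs left, parity makes the first and last coordinates equal on both spaces, so the
    -- vanishing of one is the vanishing of the other.
    have e₁ : w.1 ∈ D₁ → z₁ w.1 = l₁ w.1 := fun h => by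
      have := h₁.parity h
      rw [Finset.sum_range_zero, add_zero] at this
      exact CharTwo.add_eq_zero.1 this
    have e₂ : w.2 ∈ D₂ → z₂ w.2 = l₂ w.2 := fun h => by
      have := h₂.parity h
      rw [Finset.sum_range_zero, add_zero] at this
      exact CharTwo.add_eq_zero.1 this
    simp only [not_lt_zero, false_imp_iff, implies_true, cutSide, Nat.cast_zero]
    constructor
    · rintro ⟨⟨a, b, -, c⟩, d, e, -, f⟩
      exact ⟨⟨a, d, b, e, trivial⟩, c.trans f.symm⟩
    · rintro ⟨⟨a, b, c, d, -⟩, -⟩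
      exact ⟨⟨a, c, trivial, (e₁ a).symm.trans c⟩, b, d, trivial, (e₂ b).symm.trans d⟩
  | succ m ih =>
    intro D₁ D₂ z₁ l₁ p₁ q₁ z₂ l₂ p₂ q₂ h₁ h₂ d₁ d₂
    -- Modulo two, the sum over distinct digits is `(F 0 + F 2) (G 1 + G 2) + (F 1 + F 2) (G 0 + G
    -- 2)`, since the term `F 2 G 2` occurs twice. Each factor is a count for a smaller space.
    have hform : digitForm (m + 1) (cutCount D₁ z₁ l₁ p₁ q₁ (m + 1))
        (cutCount D₂ z₂ l₂ p₂ q₂ (m + 1))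
        = digitForm m (cutCount (D₁ ⊓ LinearMap.ker (q₁ m - l₁)) z₁ (p₁ m) p₁ q₁ m)
            (cutCount (D₂ ⊓ LinearMap.ker (p₂ m - l₂)) z₂ (q₂ m) p₂ q₂ m)
          + digitForm m (cutCount (D₁ ⊓ LinearMap.ker (p₁ m - l₁)) z₁ (q₁ m) p₁ q₁ m)
            (cutCount (D₂ ⊓ LinearMap.ker (q₂ m - l₂)) z₂ (p₂ m) p₂ q₂ m) := by
      rw [digitForm_congr (fun t ht => (cutCount_snd_eq D₁ z₁ l₁ p₁ q₁ m t ht).symm)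
          (fun t ht => (cutCount_fst_eq D₂ z₂ l₂ p₂ q₂ m t ht).symm),
        digitForm_congr (fun t ht => (cutCount_fst_eq D₁ z₁ l₁ p₁ q₁ m t ht).symm)
          (fun t ht => (cutCount_snd_eq D₂ z₂ l₂ p₂ q₂ m t ht).symm), digitForm_succ]
      simp only [digitForm_add_left, digitForm_add_right]
      generalize digitForm m (fun t => cutCount D₁ z₁ l₁ p₁ q₁ (m + 1) (t + 2 * 3 ^ m))
        (fun t => cutCount D₂ z₂ l₂ p₂ q₂ (m + 1) (t + 2 * 3 ^ m)) = a
      linear_combination -CharTwo.add_self_eq_zero a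
    -- Two spaces of dimension at least `m + 2`, cut down by `2 * m + 2` conditions.
    have hdim : 2 ≤ finrank (ZMod 2) (agreeSpace D₁ D₂ z₁ p₁ q₁ z₂ p₂ q₂ m) := by
      have := finrank_le_agreeSpace (D₁ := D₁) (D₂ := D₂) (z₁ := z₁) (p₁ := p₁) (q₁ := q₁)
        (z₂ := z₂) (p₂ := p₂) (q₂ := q₂) (m := m)
      omega
    rw [hform, ih _ _ _ _ _ _ _ _ _ _ h₁.inf_snd h₂.inf_fst 
      (Submodule.le_finrank_inf_ker d₁) (Submodule.le_finrank_inf_ker d₂),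
      ih _ _ _ _ _ _ _ _ _ _ h₁.inf_fst h₂.inf_snd 
      (Submodule.le_finrank_inf_ker d₁) (Submodule.le_finrank_inf_ker d₂)]
    -- For pairs that agree so far, the two smaller counts differ from the wanted one by one plus
    -- the two values of `tripleForm`; as both triples have the same parity, this is a finite check.
    -- The correction is affine on a space of dimension at least two, so it sums to zero.
    have hzero := Submodule.sum_eq_zero_of_additive _ hdim
      (fun w => tripleForm (p₁ m w.1) (q₁ m w.1) (l₁ w.1)
        + tripleForm (p₂ m w.2) (q₂ m w.2) (l₂ w.2)) ?_ 1
    · refine sub_eq_zero.1 (Eq.trans ?_ hzero)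
      rw [← Finset.sum_add_distrib, ← Finset.sum_sub_distrib]
      refine Finset.sum_congr rfl fun w _ => ?_
      have hmem : ∀ (D₁' : Submodule (ZMod 2) M₁) (D₂' : Submodule (ZMod 2) M₂),
          w ∈ agreeSpace (D₁ ⊓ D₁') (D₂ ⊓ D₂') z₁ p₁ q₁ z₂ p₂ q₂ m ↔
            w ∈ agreeSpace D₁ D₂ z₁ p₁ q₁ z₂ p₂ q₂ m ∧ w.1 ∈ D₁' ∧ w.2 ∈ D₂' := by
        intro D₁' D₂'
        simp only [mem_agreeSpace, Submodule.mem_inf]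
        tauto
      have hsucc : w ∈ agreeSpace D₁ D₂ z₁ p₁ q₁ z₂ p₂ q₂ (m + 1) ↔
          w ∈ agreeSpace D₁ D₂ z₁ p₁ q₁ z₂ p₂ q₂ m ∧ p₁ m w.1 = p₂ m w.2
            ∧ q₁ m w.1 = q₂ m w.2 := by
        simp only [mem_agreeSpace, Nat.lt_succ_iff_lt_or_eq, or_imp, forall_and, forall_eq]
        tauto
      simp only [hmem, hsucc, LinearMap.mem_ker, LinearMap.sub_apply, sub_eq_zero]
      by_cases hw : w ∈ agreeSpace D₁ D₂ z₁ p₁ q₁ z₂ p₂ q₂ m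
      · have hw' := mem_agreeSpace.1 hw
        have hpar : p₁ m w.1 + q₁ m w.1 + l₁ w.1 = p₂ m w.2 + q₂ m w.2 + l₂ w.2 := by
          have e₁ := h₁.parity hw'.1
          have e₂ := h₂.parity hw'.2.1
          rw [Finset.sum_range_succ, hw'.2.2.1] at e₁
          rw [Finset.sum_range_succ, hw'.2.2.2.1] at e₂
          have : ∑ i ∈ Finset.range m, (p₁ i w.1 + q₁ i w.1)
              = ∑ i ∈ Finset.range m, (p₂ i w.2 + q₂ i w.2) :=
            Finset.sum_congr rfl fun i hi => by
              rw [(hw'.2.2.2.2 i (Finset.mem_range.1 hi)).1,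
                (hw'.2.2.2.2 i (Finset.mem_range.1 hi)).2]
          rw [this] at e₁
          linear_combination e₁ - e₂
        simp only [hw, true_and, if_true]
        revert hpar
        generalize p₁ m w.1 = a
        generalize q₁ m w.1 = b
        generalize l₁ w.1 = c
        generalize p₂ m w.2 = a'
        generalize q₂ m w.2 = b'
        generalize l₂ w.2 = c'
        revert a b c a' b' c'
        unfold tripleForm
        decide
      · simp [hw]
    -- The polar form of `tripleForm` is the product of the parities plus the dot product. Isotropy
    -- and the agreement on earlier coordinates make both terms equal for the two triples, so they
    -- cancel in the sum.
    · intro w hw v hv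
      rw [mem_agreeSpace] at hw hv
      have e₁ := h₁ w.1 hw.1 v.1 hv.1
      have e₂ := h₂ w.2 hw.2.1 v.2 hv.2.1
      have f₁ := h₁.parity hw.1
      have f₂ := h₂.parity hw.2.1
      have g₁ := h₁.parity hv.1
      have g₂ := h₂.parity hv.2.1
      rw [Finset.sum_range_succ, hw.2.2.1] at e₁ f₁
      rw [Finset.sum_range_succ, hw.2.2.2.1] at e₂ f₂
      rw [Finset.sum_range_succ, hv.2.2.1] at g₁
      rw [Finset.sum_range_succ, hv.2.2.2.1] at g₂
      have s₁ : ∑ i ∈ Finset.range m, (p₁ i w.1 * p₁ i v.1 + q₁ i w.1 * q₁ i v.1)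
          = ∑ i ∈ Finset.range m, (p₂ i w.2 * p₂ i v.2 + q₂ i w.2 * q₂ i v.2) :=
        Finset.sum_congr rfl fun i hi => by
          have hi := Finset.mem_range.1 hi
          rw [(hw.2.2.2.2 i hi).1, (hw.2.2.2.2 i hi).2, (hv.2.2.2.2 i hi).1, (hv.2.2.2.2 i hi).2]
      have s₂ : ∑ i ∈ Finset.range m, (p₁ i w.1 + q₁ i w.1)
          = ∑ i ∈ Finset.range m, (p₂ i w.2 + q₂ i w.2) :=
        Finset.sum_congr rfl fun i hi => by
          have hi := Finset.mem_range.1 hi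
          rw [(hw.2.2.2.2 i hi).1, (hw.2.2.2.2 i hi).2]
      have s₃ : ∑ i ∈ Finset.range m, (p₁ i v.1 + q₁ i v.1)
          = ∑ i ∈ Finset.range m, (p₂ i v.2 + q₂ i v.2) :=
        Finset.sum_congr rfl fun i hi => by
          have hi := Finset.mem_range.1 hi
          rw [(hv.2.2.2.2 i hi).1, (hv.2.2.2.2 i hi).2]
      rw [s₁] at e₁
      rw [s₂] at f₁
      rw [s₃] at g₁
      have key : ∀ a b c x y u : ZMod 2, tripleForm (a + x) (b + y) (c + u)
          = tripleForm a b c + tripleForm x y u + (a + b + c) * (x + y + u)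
            + (a * x + b * y + c * u) := by
        unfold tripleForm
        decide
      simp only [Prod.fst_add, Prod.snd_add, map_add, key]
      have e : p₁ m w.1 * p₁ m v.1 + q₁ m w.1 * q₁ m v.1 + l₁ w.1 * l₁ v.1
          = p₂ m w.2 * p₂ m v.2 + q₂ m w.2 * q₂ m v.2 + l₂ w.2 * l₂ v.2 := by
        linear_combination e₁ - e₂
      have f : p₁ m w.1 + q₁ m w.1 + l₁ w.1 = p₂ m w.2 + q₂ m w.2 + l₂ w.2 := by
        linear_combination f₁ - f₂
      have g : p₁ m v.1 + q₁ m v.1 + l₁ v.1 = p₂ m v.2 + q₂ m v.2 + l₂ v.2 := by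
        linear_combination g₁ - g₂
      rw [e, f, g]
      generalize (p₂ m w.2 + q₂ m w.2 + l₂ w.2) * (p₂ m v.2 + q₂ m v.2 + l₂ v.2) = X
      generalize p₂ m w.2 * p₂ m v.2 + q₂ m w.2 * q₂ m v.2 + l₂ w.2 * l₂ v.2 = Y
      linear_combination CharTwo.add_self_eq_zero X + CharTwo.add_self_eq_zero Y

end Isotropic

/-! ## Determinants and fixed-point-free involutions in characteristic two -/

/-- The fixed-point-free involutions. -/
def fpfInvolutions (V : Type*) [Fintype V] [DecidableEq V] : Finset (Equiv.Perm V) :=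
  Finset.univ.filter fun σ => ∀ v, σ (σ v) = v ∧ σ v ≠ v

theorem mem_fpfInvolutions {V : Type*} [Fintype V] [DecidableEq V] {σ : Equiv.Perm V} :
    σ ∈ fpfInvolutions V ↔ ∀ v, σ (σ v) = v ∧ σ v ≠ v := by
  simp [fpfInvolutions]

/-- Signs disappear in characteristic two. By symmetry a permutation and its inverse contribute the
same product, so they cancel unless the permutation is an involution; a fixed point brings in a zero
of the diagonal. -/
theorem Matrix.det_eq_sum_fpfInvolutions {V K : Type*} [Fintype V] [DecidableEq V] [CommRing K]
    [CharP K 2] (B : Matrix V V K) (hs : ∀ u v, B u v = B v u) (hd : ∀ v, B v v = 0) :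
    B.det = ∑ σ ∈ fpfInvolutions V, ∏ v, B v (σ v) := by
  have h1 : B.det = ∑ σ : Equiv.Perm V, ∏ v, B v (σ v) := by
    rw [Matrix.det_apply]
    refine Finset.sum_congr rfl fun σ _ => ?_
    have : ∏ v, B (σ v) v = ∏ v, B v (σ v) := Finset.prod_congr rfl fun v _ => hs _ _
    rw [this]
    rcases Int.units_eq_one_or (Equiv.Perm.sign σ) with h | h <;> rw [h]
    · exact one_smul _ _
    · rw [Units.neg_smul, one_smul, CharTwo.neg_eq]
  rw [h1, ← Finset.sum_filter_add_sum_filter_not _ fun σ : Equiv.Perm V => ∀ v, σ (σ v) = v]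
  have h2 : ∑ σ : Equiv.Perm V with ¬ ∀ v, σ (σ v) = v, ∏ v, B v (σ v) = 0 := by
    refine Finset.sum_involution (fun σ _ => σ.symm) ?_ ?_ ?_ ?_
    · intro σ _
      have : ∏ v, B v (σ.symm v) = ∏ v, B v (σ v) := by
        rw [← Equiv.prod_comp σ]
        exact Finset.prod_congr rfl fun v _ => by rw [Equiv.symm_apply_apply, hs]
      rw [this]
      exact CharTwo.add_self_eq_zero _
    · intro σ hσ _ h
      refine (Finset.mem_filter.1 hσ).2 fun v => ?_
      have hv := σ.symm_apply_apply v
      rwa [show σ.symm = σ from h] at hv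
    · intro σ hσ
      refine Finset.mem_filter.2 ⟨Finset.mem_univ _, fun h => (Finset.mem_filter.1 hσ).2 fun v => ?_⟩
      rw [← Equiv.eq_symm_apply, ← h (σ v), Equiv.symm_apply_apply]
    · intro σ _
      exact σ.symm_symm
  rw [h2, add_zero]
  symm
  refine Finset.sum_subset (fun σ hσ => ?_) fun σ hσ h => ?_
  · exact Finset.mem_filter.2 ⟨Finset.mem_univ _, fun v => (mem_fpfInvolutions.1 hσ v).1⟩
  · rw [mem_fpfInvolutions] at h
    push Not at h
    obtain ⟨v, hv⟩ := h
    refine Finset.prod_eq_zero (Finset.mem_univ v) ?_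
    rw [hv ((Finset.mem_filter.1 hσ).2 v), hd]

/-! ### Cuts preserved by involutions, and the form of two families of determinants -/

section Cuts

/-- The side of the vertex `v` in the cut of `2 m + 2` vertices coded by `t`. -/
def cutVertex (m t v : ℕ) : ℕ :=
  if v = 0 then 0 else if v = 2 * m + 1 then cutSide t m
  else if v % 2 = 1 then cutFst t ((v - 1) / 2) else cutSnd t ((v - 1) / 2)

theorem cutSide_lt_two (t i : ℕ) : cutSide t i < 2 := by
  cases i with
  | zero => exact Nat.zero_lt_two
  | succ i => exact Nat.mod_lt _ Nat.zero_lt_two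

theorem cutVertex_lt_two (m t v : ℕ) : cutVertex m t v < 2 := by
  unfold cutVertex cutFst cutSnd
  have := cutSide_lt_two t m
  split_ifs <;> omega

theorem cutVertex_cast_inj {m t u v : ℕ} :
    (cutVertex m t u : ZMod 2) = cutVertex m t v ↔ cutVertex m t u = cutVertex m t v := by
  rw [ZMod.natCast_eq_natCast_iff, Nat.ModEq, Nat.mod_eq_of_lt (cutVertex_lt_two m t u),
    Nat.mod_eq_of_lt (cutVertex_lt_two m t v)]

/-- The labellings invariant under a permutation. -/
def invariantSpace {V : Type*} (σ : Equiv.Perm V) : Submodule (ZMod 2) (V → ZMod 2) where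
  carrier := {x | ∀ v, x (σ v) = x v}
  add_mem' := fun hx hy v => by simp only [Pi.add_apply, hx v, hy v]
  zero_mem' := fun _ => rfl
  smul_mem' := fun c x hx v => by simp only [Pi.smul_apply, hx v]

/-- For the map `x ↦ x ∘ σ + x`, both the kernel and, because `σ` is an involution, the range
consist of invariant labellings. Rank and nullity add up to the number of vertices. -/
theorem card_le_two_mul_finrank_invariantSpace {V : Type*} [Fintype V] [DecidableEq V]
    {σ : Equiv.Perm V} (hσ : σ ∈ fpfInvolutions V) :
    Fintype.card V ≤ 2 * Module.finrank (ZMod 2) (invariantSpace σ) := by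
  rw [mem_fpfInvolutions] at hσ
  let g : (V → ZMod 2) →ₗ[ZMod 2] (V → ZMod 2) := LinearMap.funLeft (ZMod 2) (ZMod 2) σ + LinearMap.id
  have hg : ∀ x v, g x v = x (σ v) + x v := fun x v => rfl
  have h1 : LinearMap.ker g ≤ invariantSpace σ := fun x hx v => by
    have := congrFun (LinearMap.mem_ker.1 hx) v
    rw [hg] at this
    exact CharTwo.add_eq_zero.1 this
  have h2 : LinearMap.range g ≤ invariantSpace σ := by
    rintro _ ⟨x, rfl⟩ v
    rw [hg, hg, (hσ v).1, add_comm]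
  have h3 := LinearMap.finrank_range_add_finrank_ker g
  have h4 := Submodule.finrank_mono h1
  have h5 := Submodule.finrank_mono h2
  rw [Module.finrank_fintype_fun_eq_card] at h3
  omega

/-- The vertices `v` and `σ v` are distinct and contribute equal terms, which cancel. -/
theorem sum_mul_eq_zero_of_invariant {V : Type*} [Fintype V] [DecidableEq V]
    {σ : Equiv.Perm V} (hσ : σ ∈ fpfInvolutions V) {x y : V → ZMod 2}
    (hx : x ∈ invariantSpace σ) (hy : y ∈ invariantSpace σ) : ∑ v, x v * y v = 0 := by
  rw [mem_fpfInvolutions] at hσ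
  refine Finset.sum_involution (fun v _ => σ v) ?_ ?_ ?_ ?_
  · intro v _
    rw [hx v, hy v]
    exact CharTwo.add_self_eq_zero _
  · intro v _ _
    exact (hσ v).2
  · simp
  · intro v _
    exact (hσ v).1

variable (m : ℕ)

/-- The coordinate of a vertex. -/
def vertexCoord (v : ℕ) : (Fin (2 * m + 2) → ZMod 2) →ₗ[ZMod 2] ZMod 2 :=
  LinearMap.proj (Fin.ofNat (2 * m + 2) v)

theorem vertexCoord_val (x : Fin (2 * m + 2) → ZMod 2) (v : Fin (2 * m + 2)) :
    vertexCoord m v x = x v := by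
  simp [vertexCoord]

theorem sum_range_two_mul_add_two {K : Type*} [AddCommMonoid K] (f : ℕ → K) :
    ∑ v ∈ Finset.range (2 * m + 2), f v
      = f 0 + ∑ i ∈ Finset.range m, (f (2 * i + 1) + f (2 * i + 2)) + f (2 * m + 1) := by
  rw [Finset.sum_range_succ]
  congr 1
  induction m with
  | zero => simp
  | succ m ih =>
    rw [show 2 * (m + 1) + 1 = 2 * m + 1 + 1 + 1 from rfl, Finset.sum_range_succ,
      Finset.sum_range_succ, ih, Finset.sum_range_succ, add_assoc, add_assoc]

theorem isotropicOn_invariantSpace {σ : Equiv.Perm (Fin (2 * m + 2))}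
    (hσ : σ ∈ fpfInvolutions (Fin (2 * m + 2))) :
    IsotropicOn (invariantSpace σ) (vertexCoord m 0) (vertexCoord m (2 * m + 1))
      (fun i => vertexCoord m (2 * i + 1)) (fun i => vertexCoord m (2 * i + 2)) m := by
  intro x hx y hy
  rw [← sum_mul_eq_zero_of_invariant hσ hx hy,
    ← sum_range_two_mul_add_two m fun v => vertexCoord m v x * vertexCoord m v y,
    Finset.sum_range]
  simp only [vertexCoord_val]

theorem forall_vertex_iff {P : ℕ → Prop} : (∀ v : Fin (2 * m + 2), P v) ↔
    P 0 ∧ (∀ i < m, P (2 * i + 1) ∧ P (2 * i + 2)) ∧ P (2 * m + 1) := by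
  constructor
  · intro h
    exact ⟨h ⟨0, by omega⟩, fun i hi => ⟨h ⟨2 * i + 1, by omega⟩, h ⟨2 * i + 2, by omega⟩⟩,
      h ⟨2 * m + 1, by omega⟩⟩
  · rintro ⟨h0, h1, h2⟩ ⟨v, hv⟩
    rcases Nat.eq_zero_or_pos v with rfl | hpos
    · exact h0
    obtain ⟨i, hi | hi⟩ : ∃ i, v = 2 * i + 1 ∨ v = 2 * i + 2 := ⟨(v - 1) / 2, by omega⟩
    · subst hi
      rcases eq_or_ne i m with rfl | hne
      · exact h2
      · exact (h1 i (by omega)).1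
    · subst hi
      exact (h1 i (by omega)).2

theorem cutVertex_odd {t i : ℕ} (hi : i < m) : cutVertex m t (2 * i + 1) = cutFst t i := by
  unfold cutVertex
  rw [if_neg (by omega), if_neg (by omega), if_pos (by omega)]
  congr 1
  omega

theorem cutVertex_even {t i : ℕ} (_hi : i < m) : cutVertex m t (2 * i + 2) = cutSnd t i := by
  unfold cutVertex
  rw [if_neg (by omega), if_neg (by omega), if_neg (by omega)]
  congr 1
  omega

theorem cutVertex_last {t : ℕ} : cutVertex m t (2 * m + 1) = cutSide t m := by
  unfold cutVertex
  rw [if_neg (by omega), if_pos rfl]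

theorem cutVertex_zero {t : ℕ} : cutVertex m t 0 = 0 := rfl

/-- The conditions in `cutCount` prescribe every coordinate, so they single out one labelling `x₀`,
the cut itself; it is counted exactly if it is invariant. -/
theorem cutCount_invariantSpace (σ : Equiv.Perm (Fin (2 * m + 2))) (t : ℕ) :
    cutCount (invariantSpace σ) (vertexCoord m 0) (vertexCoord m (2 * m + 1))
      (fun i => vertexCoord m (2 * i + 1)) (fun i => vertexCoord m (2 * i + 2)) m t
      = if ∀ v, cutVertex m t (σ v) = cutVertex m t v then 1 else 0 := by
  classical
  let x₀ : Fin (2 * m + 2) → ZMod 2 := fun v => cutVertex m t v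
  have key : ∀ x : Fin (2 * m + 2) → ZMod 2, (vertexCoord m 0 x = 0 ∧
      (∀ i < m, vertexCoord m (2 * i + 1) x = cutFst t i ∧ vertexCoord m (2 * i + 2) x = cutSnd t i)
      ∧ vertexCoord m (2 * m + 1) x = cutSide t m) ↔ x = x₀ := by
    intro x
    have h := forall_vertex_iff m (P := fun v => vertexCoord m v x = cutVertex m t v)
    rw [cutVertex_zero, cutVertex_last, Nat.cast_zero] at h
    have h' : (∀ i < m, vertexCoord m (2 * i + 1) x = cutFst t i ∧
        vertexCoord m (2 * i + 2) x = cutSnd t i) ↔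
        (∀ i < m, vertexCoord m (2 * i + 1) x = cutVertex m t (2 * i + 1) ∧
        vertexCoord m (2 * i + 2) x = cutVertex m t (2 * i + 2)) :=
      forall₂_congr fun i hi => by rw [cutVertex_odd m hi, cutVertex_even m hi]
    rw [h', ← h, funext_iff]
    exact forall_congr' fun v => by rw [vertexCoord_val]
  unfold cutCount
  simp only [key]
  have : ∀ x, (x ∈ invariantSpace σ ∧ x = x₀) ↔ (x = x₀ ∧ x₀ ∈ invariantSpace σ) := by
    intro x
    constructor
    · rintro ⟨h, rfl⟩
      exact ⟨rfl, h⟩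
    · rintro ⟨rfl, h⟩
      exact ⟨h, rfl⟩
  simp only [this, ite_and, Finset.sum_ite_eq', Finset.mem_univ, if_true]
  refine if_congr ?_ rfl rfl
  exact forall_congr' fun v => cutVertex_cast_inj

/-- The only labellings invariant under both permutations are the constant ones. -/
def ConnectedPair {V : Type*} (v₀ : V) (σ τ : Equiv.Perm V) : Prop :=
  ∀ x : V → ZMod 2, (∀ v, x (σ v) = x v) → (∀ v, x (τ v) = x v) → x v₀ = 0 → x = 0

open Classical in
/-- The bilinear form of the indicators of invariance detects the pairs of involutions that
generate a transitive group. -/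
theorem digitForm_indicator {σ τ : Equiv.Perm (Fin (2 * m + 2))}
    (hσ : σ ∈ fpfInvolutions (Fin (2 * m + 2))) (hτ : τ ∈ fpfInvolutions (Fin (2 * m + 2))) :
    digitForm (K := ZMod 2) m
      (fun t => if ∀ v, cutVertex m t (σ v) = cutVertex m t v then 1 else 0)
      (fun t => if ∀ v, cutVertex m t (τ v) = cutVertex m t v then 1 else 0)
      = if ConnectedPair 0 σ τ then 1 else 0 := by
  have d : ∀ {σ : Equiv.Perm (Fin (2 * m + 2))}, σ ∈ fpfInvolutions (Fin (2 * m + 2)) →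
      m + 1 ≤ Module.finrank (ZMod 2) (invariantSpace σ) := fun h => by
    have := card_le_two_mul_finrank_invariantSpace h
    rw [Fintype.card_fin] at this
    omega
  have h := digitForm_cutCount m _ _ _ _ _ _ _ _ _ _ (isotropicOn_invariantSpace m hσ)
    (isotropicOn_invariantSpace m hτ) (d hσ) (d hτ)
  rw [digitForm_congr (fun t _ => cutCount_invariantSpace m σ t)
    (fun t _ => cutCount_invariantSpace m τ t)] at h
  -- Agreement in all coordinates means equality, so the agreeing pairs are the labellings invariant
  -- under both permutations and zero at vertex `0`.
  have hmem : ∀ w : (Fin (2 * m + 2) → ZMod 2) × (Fin (2 * m + 2) → ZMod 2),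
      (w ∈ agreeSpace (invariantSpace σ) (invariantSpace τ) (vertexCoord m 0)
        (fun i => vertexCoord m (2 * i + 1)) (fun i => vertexCoord m (2 * i + 2)) (vertexCoord m 0)
        (fun i => vertexCoord m (2 * i + 1)) (fun i => vertexCoord m (2 * i + 2)) m
        ∧ vertexCoord m (2 * m + 1) w.1 = vertexCoord m (2 * m + 1) w.2) ↔
      w.2 = w.1 ∧ (w.1 ∈ invariantSpace σ ∧ w.1 ∈ invariantSpace τ ∧ w.1 0 = 0) := by
    rintro ⟨x, y⟩
    rw [mem_agreeSpace]
    have e : y = x ↔ _ := (funext_iff.trans (forall_congr' fun v => by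
      rw [← vertexCoord_val m y, ← vertexCoord_val m x, eq_comm])).trans
      (forall_vertex_iff m (P := fun v => vertexCoord m v x = vertexCoord m v y))
    have hx0 : vertexCoord m 0 x = x 0 := vertexCoord_val m x 0
    have hy0 : vertexCoord m 0 y = y 0 := vertexCoord_val m y 0
    constructor
    · rintro ⟨⟨a, b, c, d, f⟩, g⟩
      have hyx : y = x := e.2 ⟨c.trans d.symm, f, g⟩
      exact ⟨hyx, a, hyx ▸ b, hx0.symm.trans c⟩
    · rintro ⟨hyx, a, b, c⟩
      have he := e.1 hyx
      have hyx' : y = x := hyx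
      subst hyx'
      exact ⟨⟨a, b, hx0.trans c, hx0.trans c, he.2.1⟩, he.2.2⟩
  rw [h, Fintype.sum_prod_type]
  simp only [hmem, ite_and, Finset.sum_ite_eq', Finset.mem_univ, if_true]
  simp only [← ite_and]
  split_ifs with hc
  · rw [Finset.sum_eq_single 0]
    · exact if_pos ⟨Submodule.zero_mem _, Submodule.zero_mem _, rfl⟩
    · rintro x - hx
      exact if_neg fun ⟨a, b, c⟩ => hx (hc x a b c)
    · simp
  -- Translation by a nonzero labelling `x₀` of this kind pairs off all of them, so their number is
  -- even.
  · unfold ConnectedPair at hc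
    push Not at hc
    obtain ⟨x₀, hs, ht, h0, hne⟩ := hc
    have h2 : x₀ + x₀ = 0 := funext fun v => CharTwo.add_self_eq_zero _
    refine Finset.sum_involution (fun x _ => x + x₀) ?_ ?_ ?_ ?_
    · intro x _
      have : (x + x₀ ∈ invariantSpace σ ∧ x + x₀ ∈ invariantSpace τ ∧ (x + x₀) 0 = 0) ↔
          (x ∈ invariantSpace σ ∧ x ∈ invariantSpace τ ∧ x 0 = 0) := by
        rw [Submodule.add_mem_iff_left _ (show x₀ ∈ invariantSpace σ from hs),
          Submodule.add_mem_iff_left _ (show x₀ ∈ invariantSpace τ from ht), Pi.add_apply, h0,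
          add_zero]
      rw [if_congr this rfl rfl]
      exact CharTwo.add_self_eq_zero _
    · intro x _ _ hx
      exact hne (by simpa using hx)
    · simp
    · intro x _
      rw [add_assoc, h2, add_zero]

variable {K : Type*} [CommRing K]

/-- The matrix `A` with the entries across the cut coded by `t` replaced by zero. -/
def cutMatrix (A : Fin (2 * m + 2) → Fin (2 * m + 2) → K) (t : ℕ) : Matrix (Fin (2 * m + 2)) (Fin (2 * m + 2)) K :=
  fun u v => if cutVertex m t u = cutVertex m t v then A u v else 0

/-- The value computed by the algorithm. -/
def cutDetForm (A₁ A₂ : Fin (2 * m + 2) → Fin (2 * m + 2) → K) : K :=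
  digitForm m (fun t => (cutMatrix m A₁ t).det) (fun t => (cutMatrix m A₂ t).det)

theorem det_cutMatrix [CharP K 2] {A : Fin (2 * m + 2) → Fin (2 * m + 2) → K} (hs : ∀ u v, A u v = A v u) (hd : ∀ v, A v v = 0)
    (t : ℕ) : (cutMatrix m A t).det = ∑ σ ∈ fpfInvolutions (Fin (2 * m + 2)), (∏ v, A v (σ v))
      * if ∀ v, cutVertex m t (σ v) = cutVertex m t v then 1 else 0 := by
  rw [Matrix.det_eq_sum_fpfInvolutions]
  · refine Finset.sum_congr rfl fun σ _ => ?_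
    unfold cutMatrix
    split_ifs with h
    · rw [mul_one]
      exact Finset.prod_congr rfl fun v _ => if_pos (h v).symm
    · push Not at h
      obtain ⟨v, hv⟩ := h
      rw [mul_zero]
      exact Finset.prod_eq_zero (Finset.mem_univ v) (if_neg hv.symm)
  · intro u v
    unfold cutMatrix
    rw [hs u v]
    exact if_congr eq_comm rfl rfl
  · intro v
    unfold cutMatrix
    rw [if_pos rfl, hd]

open Classical in
theorem cutDetForm_eq_sum [CharP K 2] {A₁ A₂ : Fin (2 * m + 2) → Fin (2 * m + 2) → K} (hs₁ : ∀ u v, A₁ u v = A₁ v u)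
    (hd₁ : ∀ v, A₁ v v = 0) (hs₂ : ∀ u v, A₂ u v = A₂ v u) (hd₂ : ∀ v, A₂ v v = 0) :
    cutDetForm m A₁ A₂ = ∑ σ ∈ fpfInvolutions (Fin (2 * m + 2)),
      ∑ τ ∈ fpfInvolutions (Fin (2 * m + 2)), (∏ v, A₁ v (σ v)) * (∏ v, A₂ v (τ v))
        * if ConnectedPair 0 σ τ then 1 else 0 := by
  unfold cutDetForm
  rw [digitForm_congr (fun t _ => det_cutMatrix m hs₁ hd₁ t) (fun t _ => det_cutMatrix m hs₂ hd₂ t),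
    digitForm_sum]
  refine Finset.sum_congr rfl fun σ hσ => Finset.sum_congr rfl fun τ hτ => ?_
  -- The identity of indicators holds over `ZMod 2`; characteristic two supplies the ring
  -- homomorphism that carries it to `K`.
  have h := congrArg (ZMod.castHom (dvd_refl 2) K) (digitForm_indicator m hσ hτ)
  rw [map_digitForm] at h
  simp only [apply_ite (ZMod.castHom (dvd_refl 2) K), map_one, map_zero] at h
  rw [← h]

end Cuts

/-! ## Division-free determinants by closed ordered walks -/

section Clow
variable {K : Type*} [CommRing K]

/-- The total weight of the partial closed ordered walk sequences of length `p + 1` whose current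
walk has its head at `i` and has reached `j`. -/
def clow (A : ℕ → ℕ → K) (N : ℕ) : ℕ → ℕ → ℕ → K
  | 0, i, j => A i j
  | p + 1, i, j => (∑ l ∈ Finset.range N, if i < l then clow A N p l l else 0) * A i j
      + ∑ k ∈ Finset.range N, (if i < k then clow A N p i k else 0) * A k j

open PowerSeries in
/-- The generating function of the walks. -/
noncomputable def clowSeries (A : ℕ → ℕ → K) (N i j : ℕ) : PowerSeries K :=
  PowerSeries.mk fun p => clow A N p i j

open PowerSeries in
/-- The generating function of the complete sequences with all heads at least `i`. -/
noncomputable def clowTotal (A : ℕ → ℕ → K) (N i : ℕ) : PowerSeries K :=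
  1 + X * ∑ l ∈ Finset.range N, if i ≤ l then clowSeries A N l l else 0

-- Split by the last arc. Either it is the first arc of its walk and leaves the head `i` after a
-- complete, possibly empty, sequence with all heads above `i`; or it continues from some `k > i`,
-- since a walk stays above its head until it closes.
open PowerSeries in
theorem clowSeries_eq (A : ℕ → ℕ → K) (N i j : ℕ) : clowSeries A N i j =
    clowTotal A N (i + 1) * C (A i j)
      + X * ∑ k ∈ Finset.range N, (if i < k then clowSeries A N i k else 0) * C (A k j) := by
  have : clowTotal A N (i + 1) * C (A i j)
      + X * ∑ k ∈ Finset.range N, (if i < k then clowSeries A N i k else 0) * C (A k j)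
      = C (A i j) + X * ((∑ l ∈ Finset.range N, if i < l then clowSeries A N l l else 0) * C (A i j)
      + ∑ k ∈ Finset.range N, (if i < k then clowSeries A N i k else 0) * C (A k j)) := by
    unfold clowTotal
    simp only [Nat.succ_le_iff]
    ring
  rw [this]
  ext p
  cases p with
  | zero => simp [clowSeries, clow]
  | succ p =>
    rw [map_add, coeff_succ_X_mul, coeff_C, if_neg (Nat.succ_ne_zero p), zero_add, map_add,
      coeff_mul_C, map_sum, map_sum]
    simp only [clowSeries, coeff_mk, clow, coeff_mul_C, apply_ite (coeff p), map_zero]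

open PowerSeries in
theorem clowTotal_succ (A : ℕ → ℕ → K) {N i : ℕ} (hi : i < N) :
    clowTotal A N i = clowTotal A N (i + 1) + X * clowSeries A N i i := by
  unfold clowTotal
  rw [add_assoc, ← mul_add]
  congr 2
  rw [← Finset.sum_erase_add _ _ (Finset.mem_range.2 hi), if_pos le_rfl]
  congr 1
  rw [← Finset.sum_erase_add (f := fun l => if i + 1 ≤ l then clowSeries A N l l else 0) _
    (Finset.mem_range.2 hi), if_neg (by omega), add_zero]
  refine Finset.sum_congr rfl fun l hl => if_congr ?_ rfl rfl
  have := Finset.ne_of_mem_erase hl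
  omega

open PowerSeries in
/-- The matrix `1 + X A` for the block of `k` rows and columns of `A` from `i` on. -/
noncomputable def blockSeries (A : ℕ → ℕ → K) (i k : ℕ) : Matrix (Fin k) (Fin k) (PowerSeries K) :=
  fun a b => (if a = b then 1 else 0) + X * C (A (i + a) (i + b))

theorem sum_range_ite_lt {M : Type*} [AddCommMonoid M] {N i k : ℕ} (h : i + 1 + k = N)
    (f : ℕ → M) : ∑ l ∈ Finset.range N, (if i < l then f l else 0)
      = ∑ b : Fin k, f (i + 1 + b) := by
  rw [← h, Finset.sum_range_add, Finset.sum_eq_zero, zero_add, Finset.sum_range]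
  · exact Finset.sum_congr rfl fun b _ => if_pos (by omega)
  · intro l hl
    exact if_neg (by have := Finset.mem_range.1 hl; omega)

-- Induction from the last row upwards, by the Schur complement of the block from `i + 1` on, which
-- is invertible because its determinant has constant coefficient one. The row of walks with head
-- `i` solves a linear system with that block, which identifies the correction term of the
-- complement with the walks that close at `i`.
open PowerSeries in
theorem clowTotal_eq_det [CharP K 2] (A : ℕ → ℕ → K) {N : ℕ} :
    ∀ k i, i + k = N → clowTotal A N i = (blockSeries A i k).det := by
  have hch : ∀ a : PowerSeries K, a + a = 0 := fun a => by
    have h2 : (2 : K) = 0 := CharTwo.two_eq_zero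
    have : (2 : PowerSeries K) = 0 := by
      rw [← map_ofNat (C (R := K)) 2, h2, map_zero]
    rw [← two_mul, this, zero_mul]
  intro k
  induction k with
  | zero =>
    intro i hi
    rw [Matrix.det_fin_zero, clowTotal, Finset.sum_eq_zero, mul_zero, add_zero]
    intro l hl
    exact if_neg (by have := Finset.mem_range.1 hl; omega)
  | succ k ih =>
    intro i hi
    have hd := ih (i + 1) (by omega)
    have hunit : IsUnit (blockSeries A (i + 1) k).det := by
      rw [← hd, isUnit_iff_constantCoeff]
      simp [clowTotal]
    let x : Matrix (Fin 1) (Fin k) (PowerSeries K) := fun _ b => clowSeries A N i (i + 1 + b)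
    let r : Matrix (Fin 1) (Fin k) (PowerSeries K) := fun _ b => X * C (A i (i + 1 + b))
    let c : Matrix (Fin k) (Fin 1) (PowerSeries K) := fun b _ => X * C (A (i + 1 + b) i)
    let a : Matrix (Fin 1) (Fin 1) (PowerSeries K) := fun _ _ => 1 + X * C (A i i)
    have hblock : (blockSeries A i (1 + k)).submatrix finSumFinEquiv finSumFinEquiv
        = Matrix.fromBlocks a r c (blockSeries A (i + 1) k) := by
      ext1 u v
      rcases u with u | u <;> rcases v with v | v
      · simp [blockSeries, Subsingleton.elim u v]
        rfl
      · have : ¬ Fin.castAdd k u = Fin.natAdd 1 v := fun h => by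
          have := congrArg Fin.val h
          simp at this
          omega
        rw [Matrix.fromBlocks_apply₁₂]
        simp [blockSeries, this, add_assoc, r]
      · have : ¬ Fin.natAdd 1 u = Fin.castAdd k v := fun h => by
          have := congrArg Fin.val h
          simp at this
        rw [Matrix.fromBlocks_apply₂₁]
        simp [blockSeries, this, add_assoc, c]
      · rw [Matrix.fromBlocks_apply₂₂]
        simp [blockSeries, add_assoc]
    -- This is `clowSeries_eq` in matrix form. The identity part of the block contributes the
    -- continued walks a second time; the two copies cancel and only the initial arcs remain.
    have hx : (X : PowerSeries K) • (x * blockSeries A (i + 1) k) = clowTotal A N (i + 1) • r := by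
      ext1 u b
      rw [Matrix.smul_apply, Matrix.smul_apply, Matrix.mul_apply, smul_eq_mul, smul_eq_mul]
      simp only [blockSeries, x, r, mul_add, Finset.sum_add_distrib, mul_ite, mul_one, mul_zero,
        Finset.sum_ite_eq', Finset.mem_univ, if_true]
      conv_lhs => rw [clowSeries_eq]
      simp only [ite_mul, zero_mul, sum_range_ite_lt (show i + 1 + k = N by omega)
        (fun l => clowSeries A N i l * C (A l (i + 1 + b)))]
      have : ∑ l : Fin k, clowSeries A N i (i + 1 + l) * (X * C (A (i + 1 + l) (i + 1 + b)))
          = X * ∑ l : Fin k, clowSeries A N i (i + 1 + l) * C (A (i + 1 + l) (i + 1 + b)) := by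
        rw [Finset.mul_sum]
        exact Finset.sum_congr rfl fun l _ => by ring
      rw [this]
      linear_combination hch (X * (X * ∑ l : Fin k,
        clowSeries A N i (i + 1 + l) * C (A (i + 1 + l) (i + 1 + b))))
    let _ := Matrix.invertibleOfIsUnitDet _ hunit
    rw [show (k + 1) = 1 + k from add_comm _ _,
      ← Matrix.det_submatrix_equiv_self finSumFinEquiv (blockSeries A i (1 + k)), hblock,
      Matrix.det_fromBlocks₂₂, Matrix.det_fin_one, Matrix.sub_apply, mul_sub, ← hd]
    have hx' : clowTotal A N (i + 1) • (r * ⅟(blockSeries A (i + 1) k) * c)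
        = (X : PowerSeries K) • (x * c) := by
      rw [← Matrix.smul_mul, ← Matrix.smul_mul, ← hx, Matrix.smul_mul, Matrix.mul_assoc,
        mul_invOf_self, Matrix.mul_one, Matrix.smul_mul]
    have hx'' := congrFun (congrFun hx' 0) 0
    rw [Matrix.smul_apply, Matrix.smul_apply, smul_eq_mul, smul_eq_mul, Matrix.mul_apply (M := x)]
      at hx''
    rw [hx'', clowTotal_succ A (show i < N by omega), clowSeries_eq]
    simp only [x, c, a, ite_mul, zero_mul, sum_range_ite_lt (show i + 1 + k = N by omega)
        (fun l => clowSeries A N i l * C (A l i))]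
    have : ∑ l : Fin k, clowSeries A N i (i + 1 + l) * (X * C (A (i + 1 + l) i))
        = X * ∑ l : Fin k, clowSeries A N i (i + 1 + l) * C (A (i + 1 + l) i) := by
      rw [Finset.mul_sum]
      exact Finset.sum_congr rfl fun l _ => by ring
    rw [this]
    linear_combination hch (X * (X * ∑ l : Fin k,
        clowSeries A N i (i + 1 + l) * C (A (i + 1 + l) i)))

/-- In characteristic two, the determinant is the total weight of the closed ordered walk
sequences of full length. -/
theorem sum_clow_eq_det [CharP K 2] [Nontrivial K] (A : ℕ → ℕ → K) (N : ℕ) :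
    ∑ l ∈ Finset.range (N + 1), clow A (N + 1) N l l
      = (Matrix.of fun i j : Fin (N + 1) => A i j).det := by
  set M : Matrix (Fin (N + 1)) (Fin (N + 1)) K := Matrix.of fun i j => A i j with hM
  have h1 := clowTotal_eq_det A (N := N + 1) (N + 1) 0 (zero_add _)
  have h2 := congrArg (PowerSeries.coeff (N + 1)) h1
  -- As `-1 = 1`, this is the determinant of `1 - X A`, the reversed characteristic polynomial. Its
  -- coefficient of degree `N + 1` is the constant coefficient of the characteristic polynomial,
  -- hence the determinant.
  have h3 : (blockSeries A 0 (N + 1)).det = (M.charpolyRev : PowerSeries K) := by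
    rw [Matrix.charpolyRev, ← Polynomial.coeToPowerSeries.ringHom_apply, RingHom.map_det]
    congr 1
    ext1 a b
    have hX : (-1 : K) = 1 := CharTwo.neg_eq 1
    simp only [blockSeries, hM, RingHom.mapMatrix_apply, Matrix.map_apply, Matrix.sub_apply,
      Matrix.smul_apply, Matrix.of_apply, smul_eq_mul, map_sub, map_mul,
      Polynomial.coeToPowerSeries.ringHom_apply, Polynomial.coe_X, Polynomial.coe_C, zero_add,
      Matrix.one_apply, apply_ite ((↑) : Polynomial K → PowerSeries K), Polynomial.coe_one,
      Polynomial.coe_zero]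
    rw [sub_eq_add_neg, ← mul_neg, ← map_neg, CharTwo.neg_eq]
  rw [h3, Polynomial.coeff_coe, ← Matrix.reverse_charpoly, Polynomial.coeff_reverse,
    Matrix.charpoly_natDegree_eq_dim, Fintype.card_fin, Polynomial.revAt_le le_rfl, Nat.sub_self]
    at h2
  have h4 : M.det = M.charpoly.coeff 0 := by
    rw [Matrix.det_eq_sign_charpoly_coeff, CharTwo.neg_eq, one_pow, one_mul]
  rw [h4, ← h2, clowTotal, map_add, PowerSeries.coeff_succ_X_mul, PowerSeries.coeff_one,
    if_neg (Nat.succ_ne_zero N), zero_add, map_sum]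
  exact Finset.sum_congr rfl fun l _ => by simp [clowSeries]

end Clow

/-! ## Natural numbers as polynomials over the field with two elements -/

section BitPoly
open Polynomial

/-- Natural numbers as polynomials, by their bits. -/
noncomputable def bitPoly (a : ℕ) : (ZMod 2)[X] :=
  if a = 0 then 0 else X * bitPoly (a / 2) + C (a : ZMod 2)
termination_by a
decreasing_by omega

theorem bitPoly_zero : bitPoly 0 = 0 := by rw [bitPoly, if_pos rfl]

theorem bitPoly_eq (a : ℕ) : bitPoly a = X * bitPoly (a / 2) + C (a : ZMod 2) := by
  by_cases h : a = 0
  · subst h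
    simp [bitPoly_zero]
  · rw [bitPoly, if_neg h]

theorem bitPoly_xor (a b : ℕ) : bitPoly (a ^^^ b) = bitPoly a + bitPoly b := by
  induction a using Nat.strong_induction_on generalizing b with
  | _ a ih =>
    rcases Nat.eq_zero_or_pos a with rfl | ha
    · rw [Nat.zero_xor, bitPoly_zero, zero_add]
    rw [bitPoly_eq (a ^^^ b), bitPoly_eq a, bitPoly_eq b, Nat.xor_div_two, ih _ (by omega)]
    have : ((a ^^^ b : ℕ) : ZMod 2) = a + b := by
      rw [← Nat.cast_add, ZMod.natCast_eq_natCast_iff]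
      exact Nat.xor_mod_two_eq
    rw [this, C_add]
    ring

theorem bitPoly_eq_zero {a : ℕ} : bitPoly a = 0 ↔ a = 0 := by
  refine ⟨fun h => ?_, fun h => by rw [h, bitPoly_zero]⟩
  induction a using Nat.strong_induction_on with
  | _ a ih =>
    by_contra ha
    rw [bitPoly_eq] at h
    have h0 : (a : ZMod 2) = 0 := by simpa using congrArg (coeff · 0) h
    rw [h0, C_0, add_zero] at h
    have h1 := ih (a / 2) (by omega) ((mul_eq_zero.1 h).resolve_left X_ne_zero)
    rw [ZMod.natCast_eq_zero_iff] at h0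
    omega

theorem bitPoly_injective : Function.Injective bitPoly := fun a b h => by
  have : bitPoly (a ^^^ b) = 0 := by rw [bitPoly_xor, h, CharTwo.add_self_eq_zero]
  exact Nat.xor_eq_zero_iff.1 (bitPoly_eq_zero.1 this)

theorem bitPoly_two_mul (a : ℕ) : bitPoly (2 * a) = X * bitPoly a := by
  rw [bitPoly_eq, Nat.mul_div_cancel_left _ (by norm_num), Nat.cast_mul]
  have : ((2 : ℕ) : ZMod 2) = 0 := rfl
  rw [this, zero_mul, C_0, add_zero]

theorem bitPoly_mul_mod_two (a b : ℕ) : bitPoly (a * (b % 2)) = bitPoly a * C (b : ZMod 2) := by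
  rw [← ZMod.natCast_mod b 2]
  rcases Nat.mod_two_eq_zero_or_one b with h | h <;> rw [h] <;> simp [bitPoly_zero]

/-- Multiplication without carries. -/
def clMul (a b : ℕ) : ℕ :=
  if b = 0 then 0 else a * (b % 2) ^^^ clMul (2 * a) (b / 2)
termination_by b
decreasing_by omega

theorem clMul_zero (a : ℕ) : clMul a 0 = 0 := by rw [clMul, if_pos rfl]

theorem bitPoly_clMul (a b : ℕ) : bitPoly (clMul a b) = bitPoly a * bitPoly b := by
  induction b using Nat.strong_induction_on generalizing a with
  | _ b ih =>
    by_cases hb : b = 0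
    · subst hb
      rw [clMul_zero, bitPoly_zero, mul_zero]
    · rw [clMul, if_neg hb, bitPoly_xor, ih _ (by omega), bitPoly_two_mul, bitPoly_mul_mod_two,
        bitPoly_eq b]
      ring

theorem clMul_lt {a b s t : ℕ} (ha : a < 2 ^ s) (hb : b < 2 ^ t) : clMul a b < 2 ^ (s + t) := by
  induction t generalizing a b s with
  | zero =>
    have : b = 0 := by simpa using hb
    rw [this, clMul_zero]
    positivity
  | succ t ih =>
    by_cases h : b = 0
    · rw [h, clMul_zero]
      positivity
    rw [clMul, if_neg h]
    refine Nat.xor_lt_two_pow ?_ ?_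
    · calc a * (b % 2) ≤ a * 1 := Nat.mul_le_mul_left _ (by omega)
        _ < 2 ^ s := by rwa [mul_one]
        _ ≤ _ := Nat.pow_le_pow_right (by norm_num) (by omega)
    · have h1 := ih (a := 2 * a) (b := b / 2) (s := s + 1) (by rw [pow_succ]; omega)
        (by rw [pow_succ] at hb; omega)
      rwa [show s + 1 + t = s + (t + 1) by omega] at h1

/-- The bitwise exclusive or of finitely many numbers. -/
def xorSum (f : ℕ → ℕ) : ℕ → ℕ
  | 0 => 0
  | n + 1 => xorSum f n ^^^ f n

theorem bitPoly_xorSum (f : ℕ → ℕ) (n : ℕ) :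
    bitPoly (xorSum f n) = ∑ i ∈ Finset.range n, bitPoly (f i) := by
  induction n with
  | zero => rw [xorSum, bitPoly_zero, Finset.sum_range_zero]
  | succ n ih => rw [xorSum, bitPoly_xor, ih, Finset.sum_range_succ]

theorem xorSum_lt {f : ℕ → ℕ} {n s : ℕ} (h : ∀ i < n, f i < 2 ^ s) : xorSum f n < 2 ^ s := by
  induction n with
  | zero => exact Nat.two_pow_pos s
  | succ n ih =>
    exact Nat.xor_lt_two_pow (ih fun i hi => h i (by omega)) (h n (by omega))

/-- The recursion of `clow` for polynomials coded by numbers. -/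
def clowBits (A : ℕ → ℕ → ℕ) (N : ℕ) : ℕ → ℕ → ℕ → ℕ
  | 0, i, j => A i j
  | p + 1, i, j => clMul (xorSum (fun l => clowBits A N p l l * (1 - (1 - (l - i)))) N) (A i j)
      ^^^ xorSum (fun k => clMul (clowBits A N p i k * (1 - (1 - (k - i)))) (A k j)) N

/-- With truncated subtraction, `1 - (1 - d)` is the indicator of `d ≠ 0`, and `l - i ≠ 0` says `i <
l`. This replaces a test by arithmetic, here and in the program. -/
theorem bitPoly_mul_sub (a i l : ℕ) :
    bitPoly (a * (1 - (1 - (l - i)))) = if i < l then bitPoly a else 0 := by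
  split_ifs with h
  · rw [show 1 - (1 - (l - i)) = 1 by omega, mul_one]
  · rw [show 1 - (1 - (l - i)) = 0 by omega, mul_zero, bitPoly_zero]

theorem bitPoly_clowBits (A : ℕ → ℕ → ℕ) (N p i j : ℕ) :
    bitPoly (clowBits A N p i j) = clow (fun i j => bitPoly (A i j)) N p i j := by
  induction p generalizing i j with
  | zero => rfl
  | succ p ih =>
    simp only [clowBits, clow, bitPoly_xor, bitPoly_clMul, bitPoly_xorSum, bitPoly_mul_sub, ih]

theorem mul_sub_le (a i l : ℕ) : a * (1 - (1 - (l - i))) ≤ a :=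
  (Nat.mul_le_mul_left a (show 1 - (1 - (l - i)) ≤ 1 by omega)).trans_eq (mul_one a)

/-- Each step multiplies by one more entry of `s` bits, and exclusive or does not lengthen. So
numbers grow linearly in `p` and words stay of polynomial length. -/
theorem clowBits_lt {A : ℕ → ℕ → ℕ} {N s : ℕ} (h : ∀ i < N, ∀ j < N, A i j < 2 ^ s) (p : ℕ) :
    ∀ i < N, ∀ j < N, clowBits A N p i j < 2 ^ ((p + 1) * s) := by
  induction p with
  | zero => simpa [clowBits] using h
  | succ p ih =>
    intro i hi j hj
    rw [clowBits, show (p + 1 + 1) * s = (p + 1) * s + s by ring]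
    refine Nat.xor_lt_two_pow (clMul_lt (xorSum_lt fun l hl => ?_) (h i hi j hj))
      (xorSum_lt fun k hk => clMul_lt ?_ (h k hk j hj))
    · exact (mul_sub_le _ _ _).trans_lt (ih l hl l hl)
    · exact (mul_sub_le _ _ _).trans_lt (ih i hi k hk)

end BitPoly

/-! ## Random weights -/

section Weights

/-- There are two fixed-point-free involutions along the given relations that together generate
a transitive group. -/
def HasConnectedPair (m : ℕ) (R₁ R₂ : ℕ → ℕ → ℕ) : Prop :=
  ∃ σ ∈ fpfInvolutions (Fin (2 * m + 2)), ∃ τ ∈ fpfInvolutions (Fin (2 * m + 2)),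
    ConnectedPair 0 σ τ ∧ (∀ v : Fin (2 * m + 2), R₁ v (σ v) ≠ 0)
      ∧ ∀ v : Fin (2 * m + 2), R₂ v (τ v) ≠ 0

/-- The index of the weight of the unordered pair `u`, `v` in the `w`-th matrix. -/
def pairIndex (N w u v : ℕ) : ℕ := (w * N + (u + (v - u))) * N + (u - (u - v))

/-- The terms `u + (v - u)` and `u - (u - v)` are the maximum and the minimum of `u` and `v`. -/
theorem pairIndex_comm (N w u v : ℕ) : pairIndex N w u v = pairIndex N w v u := by
  unfold pairIndex
  rw [show u + (v - u) = v + (u - v) by omega, show u - (u - v) = v - (v - u) by omega]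

theorem pairIndex_lt {N w u v : ℕ} (hw : w < 2) (hu : u < N) (hv : v < N) :
    pairIndex N w u v < 2 * N * N := by
  have h1 : w * N + (u + (v - u)) + 1 ≤ 2 * N := by
    have : w * N ≤ 1 * N := Nat.mul_le_mul_right _ (by omega)
    omega
  calc pairIndex N w u v < (w * N + (u + (v - u))) * N + N := by unfold pairIndex; omega
    _ = (w * N + (u + (v - u)) + 1) * N := by ring
    _ ≤ _ := Nat.mul_le_mul_right _ h1

theorem pairIndex_mod {N w u v : ℕ} (hu : u < N) :
    pairIndex N w u v % N = u - (u - v) := by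
  unfold pairIndex
  rw [add_comm, Nat.add_mul_mod_self_right, Nat.mod_eq_of_lt (by omega)]

theorem pairIndex_div {N w u v : ℕ} (hu : u < N) :
    pairIndex N w u v / N = w * N + (u + (v - u)) := by
  unfold pairIndex
  rw [add_comm, Nat.add_mul_div_right _ _ (by omega), Nat.div_eq_of_lt (by omega), zero_add]

variable {K : Type*} [CommRing K]

/-- The symmetric matrix of weights supported on a relation. -/
def weightMatrix (R : ℕ → ℕ → ℕ) (N w : ℕ) (g : ℕ → K) (u v : ℕ) : K :=
  if R u v ≠ 0 ∧ u ≠ v then g (pairIndex N w u v) else 0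

/-- The value computed by the algorithm for given weights. -/
def weightForm (m : ℕ) (R₁ R₂ : ℕ → ℕ → ℕ) (g : ℕ → K) : K :=
  cutDetForm m (fun u v => weightMatrix R₁ (2 * m + 2) 0 g u v)
    (fun u v => weightMatrix R₂ (2 * m + 2) 1 g u v)

/-- A relation on the numbers below `N` is symmetric. -/
def SymmOn (N : ℕ) (R : ℕ → ℕ → ℕ) : Prop := ∀ u < N, ∀ v < N, R u v ≠ 0 → R v u ≠ 0

variable {m : ℕ} {R₁ R₂ : ℕ → ℕ → ℕ}

theorem weightMatrix_symm {N : ℕ} {R : ℕ → ℕ → ℕ} (hR : SymmOn N R) (w : ℕ) (g : ℕ → K)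
    {u v : ℕ} (hu : u < N) (hv : v < N) : weightMatrix R N w g u v = weightMatrix R N w g v u := by
  unfold weightMatrix
  rw [pairIndex_comm]
  exact if_congr ⟨fun h => ⟨hR u hu v hv h.1, h.2.symm⟩, fun h => ⟨hR v hv u hu h.1, h.2.symm⟩⟩
    rfl rfl

theorem weightMatrix_diag (R : ℕ → ℕ → ℕ) (N w : ℕ) (g : ℕ → K) (v : ℕ) :
    weightMatrix R N w g v v = 0 := if_neg fun h => h.2 rfl

open Classical in
theorem weightForm_eq_sum [CharP K 2] (h₁ : SymmOn (2 * m + 2) R₁) (h₂ : SymmOn (2 * m + 2) R₂)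
    (g : ℕ → K) : weightForm m R₁ R₂ g = ∑ σ ∈ fpfInvolutions (Fin (2 * m + 2)),
      ∑ τ ∈ fpfInvolutions (Fin (2 * m + 2)),
        (∏ v : Fin (2 * m + 2), weightMatrix R₁ (2 * m + 2) 0 g v (σ v))
        * (∏ v : Fin (2 * m + 2), weightMatrix R₂ (2 * m + 2) 1 g v (τ v)) * if ConnectedPair 0 σ τ then 1 else 0 :=
  cutDetForm_eq_sum m (fun u v => weightMatrix_symm h₁ 0 g u.2 v.2)
    (fun _ => weightMatrix_diag _ _ _ _ _) (fun u v => weightMatrix_symm h₂ 1 g u.2 v.2)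
    (fun _ => weightMatrix_diag _ _ _ _ _)

/-- A nonzero sum has a nonzero term, and that term exhibits the pair. This holds for all weights,
hence the absence of false positive answers. -/
theorem hasConnectedPair_of_weightForm_ne_zero [CharP K 2] (h₁ : SymmOn (2 * m + 2) R₁)
    (h₂ : SymmOn (2 * m + 2) R₂) {g : ℕ → K} (h : weightForm m R₁ R₂ g ≠ 0) :
    HasConnectedPair m R₁ R₂ := by
  classical
  rw [weightForm_eq_sum h₁ h₂] at h
  obtain ⟨σ, hσ, h⟩ := Finset.exists_ne_zero_of_sum_ne_zero h
  obtain ⟨τ, hτ, h⟩ := Finset.exists_ne_zero_of_sum_ne_zero h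
  have hc : ConnectedPair 0 σ τ := by
    by_contra hc
    rw [if_neg hc, mul_zero] at h
    exact h rfl
  have hp := left_ne_zero_of_mul h
  refine ⟨σ, hσ, τ, hτ, hc, fun v => ?_, fun v => ?_⟩
  · have hv : weightMatrix R₁ (2 * m + 2) 0 g v (σ v) ≠ 0 := fun h0 =>
      left_ne_zero_of_mul hp (Finset.prod_eq_zero (Finset.mem_univ v) h0)
    exact (ite_ne_right_iff.1 hv).1.1
  · have hv : weightMatrix R₂ (2 * m + 2) 1 g v (τ v) ≠ 0 := fun h0 =>
      right_ne_zero_of_mul hp (Finset.prod_eq_zero (Finset.mem_univ v) h0)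
    exact (ite_ne_right_iff.1 hv).1.1

theorem map_cutDetForm {L : Type*} [CommRing L] (f : K →+* L)
    (A₁ A₂ : Fin (2 * m + 2) → Fin (2 * m + 2) → K) :
    f (cutDetForm m A₁ A₂) = cutDetForm m (fun u v => f (A₁ u v)) (fun u v => f (A₂ u v)) := by
  have h : ∀ (A : Fin (2 * m + 2) → Fin (2 * m + 2) → K) t,
      f (cutMatrix m A t).det = (cutMatrix m (fun u v => f (A u v)) t).det := fun A t => by
    rw [RingHom.map_det]
    congr 1
    ext1 u v
    simp only [RingHom.mapMatrix_apply, Matrix.map_apply, cutMatrix, apply_ite f, map_zero]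
  simp only [cutDetForm, map_digitForm, h]

theorem map_weightForm {L : Type*} [CommRing L] (f : K →+* L) (g : ℕ → K) :
    f (weightForm m R₁ R₂ g) = weightForm m R₁ R₂ (fun i => f (g i)) := by
  simp only [weightForm, map_cutDetForm, weightMatrix, apply_ite f, map_zero]

theorem weightForm_congr {g g' : ℕ → K}
    (h : ∀ i < 2 * (2 * m + 2) * (2 * m + 2), g i = g' i) :
    weightForm m R₁ R₂ g = weightForm m R₁ R₂ g' := by
  have : ∀ (R : ℕ → ℕ → ℕ) (w : ℕ), w < 2 → ∀ u v : Fin (2 * m + 2),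
      weightMatrix R (2 * m + 2) w g u v = weightMatrix R (2 * m + 2) w g' u v := by
    intro R w hw u v
    unfold weightMatrix
    rw [h _ (pairIndex_lt hw u.2 v.2)]
  simp only [weightForm, this _ _ zero_lt_two, this _ _ one_lt_two]

/-- Weights for which only one pair of involutions contributes. -/
theorem exists_weightForm_ne_zero [CharP K 2] [Nontrivial K] (h₁ : SymmOn (2 * m + 2) R₁)
    (h₂ : SymmOn (2 * m + 2) R₂) (h : HasConnectedPair m R₁ R₂) :
    ∃ g : ℕ → K, weightForm m R₁ R₂ g ≠ 0 := by
  classical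
  unfold HasConnectedPair at h
  set N := 2 * m + 2 with hN
  obtain ⟨σ, hσ, τ, hτ, hc, hR₁, hR₂⟩ := h
  -- Weight one on the pairs matched by `σ` in the first matrix and by `τ` in the second, zero
  -- elsewhere. Dividing an index by `N` gives the larger endpoint, shifted by `N` for the second
  -- matrix; the remainder is the smaller endpoint.
  let g : ℕ → K := fun i => if i / N < N
    then (if (σ (Fin.ofNat N (i / N)) : ℕ) = i % N then 1 else 0)
    else (if (τ (Fin.ofNat N (i / N - N)) : ℕ) = i % N then 1 else 0)
  -- An involution maps the larger endpoint to the smaller one exactly if it matches the two, in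
  -- either order.
  have key : ∀ (ρ : Equiv.Perm (Fin N)), ρ ∈ fpfInvolutions (Fin N) → ∀ u v : Fin N,
      ((ρ (Fin.ofNat N (u + (v - u))) : ℕ) = u - (u - v) ↔ ρ u = v) := by
    intro ρ hρ u v
    rw [mem_fpfInvolutions] at hρ
    rcases le_total (u : ℕ) v with huv | huv
    · rw [show (u : ℕ) + (v - u) = v by omega, show (u : ℕ) - (u - v) = u by omega,
        Fin.ofNat_val_eq_self, Fin.val_inj]
      exact ⟨fun h => by rw [← h, (hρ v).1], fun h => by rw [← h, (hρ u).1]⟩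
    · rw [show (u : ℕ) + (v - u) = u by omega, show (u : ℕ) - (u - v) = v by omega,
        Fin.ofNat_val_eq_self, Fin.val_inj]
  have g0 : ∀ u v : Fin N, weightMatrix R₁ N 0 g u v
      = if R₁ u v ≠ 0 ∧ u ≠ v then (if σ u = v then 1 else 0) else 0 := by
    intro u v
    unfold weightMatrix
    refine if_congr (by rw [Ne, Ne, Ne, Fin.ext_iff]) ?_ rfl
    simp only [g]
    rw [pairIndex_div u.2, pairIndex_mod u.2, zero_mul, zero_add, if_pos (by omega)]
    exact if_congr (key σ hσ u v) rfl rfl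
  have g1 : ∀ u v : Fin N, weightMatrix R₂ N 1 g u v
      = if R₂ u v ≠ 0 ∧ u ≠ v then (if τ u = v then 1 else 0) else 0 := by
    intro u v
    unfold weightMatrix
    refine if_congr (by rw [Ne, Ne, Ne, Fin.ext_iff]) ?_ rfl
    simp only [g]
    rw [pairIndex_div u.2, pairIndex_mod u.2, one_mul, if_neg (by omega), Nat.add_sub_cancel_left]
    exact if_congr (key τ hτ u v) rfl rfl
  refine ⟨g, ?_⟩
  rw [weightForm_eq_sum h₁ h₂, Finset.sum_eq_single σ, Finset.sum_eq_single τ, if_pos hc,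
    Finset.prod_eq_one, Finset.prod_eq_one]
  · simp
  · intro v _
    rw [g1, if_pos ⟨hR₂ v, ((mem_fpfInvolutions.1 hτ v).2).symm⟩, if_pos rfl]
  · intro v _
    rw [g0, if_pos ⟨hR₁ v, ((mem_fpfInvolutions.1 hσ v).2).symm⟩, if_pos rfl]
  · intro τ' _ hne
    obtain ⟨v, hv⟩ : ∃ v, τ' v ≠ τ v := by
      by_contra hcon
      push Not at hcon
      exact hne (Equiv.ext hcon)
    have h0 : ∏ v : Fin (2 * m + 2), weightMatrix R₂ (2 * m + 2) 1 g v (τ' v) = 0 :=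
      Finset.prod_eq_zero (Finset.mem_univ v) (by
        rw [g1, if_neg (c := τ v = τ' v) (fun h => hv h.symm), ite_self])
    rw [h0, mul_zero, zero_mul]
  · exact fun h => absurd hτ h
  · intro σ' _ hne
    obtain ⟨v, hv⟩ : ∃ v, σ' v ≠ σ v := by
      by_contra hcon
      push Not at hcon
      exact hne (Equiv.ext hcon)
    refine Finset.sum_eq_zero fun τ' _ => ?_
    have h0 : ∏ v : Fin (2 * m + 2), weightMatrix R₁ (2 * m + 2) 0 g v (σ' v) = 0 :=
      Finset.prod_eq_zero (Finset.mem_univ v) (by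
        rw [g0, if_neg (c := σ v = σ' v) (fun h => hv h.symm), ite_self])
    rw [h0, zero_mul, zero_mul]
  · exact fun h => absurd hσ h

/-- The algorithm's value as a polynomial in the weights. -/
noncomputable def weightPoly (K : Type*) [CommRing K] (m : ℕ) (R₁ R₂ : ℕ → ℕ → ℕ) :
    MvPolynomial (Fin (2 * (2 * m + 2) * (2 * m + 2))) K :=
  weightForm m R₁ R₂ fun i =>
    if h : i < 2 * (2 * m + 2) * (2 * m + 2) then MvPolynomial.X ⟨i, h⟩ else 0

theorem eval_weightPoly (g : ℕ → K) :
    MvPolynomial.eval (fun i : Fin _ => g i) (weightPoly K m R₁ R₂) = weightForm m R₁ R₂ g := by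
  rw [weightPoly, map_weightForm]
  refine weightForm_congr fun i hi => ?_
  rw [dif_pos hi, MvPolynomial.eval_X]

/-- Read off from the expansion over pairs of involutions, where each term is a product of two times
`2 * m + 2` weights or zeros. -/
theorem totalDegree_weightPoly [CharP K 2] [Nontrivial K] (h₁ : SymmOn (2 * m + 2) R₁)
    (h₂ : SymmOn (2 * m + 2) R₂) :
    (weightPoly K m R₁ R₂).totalDegree ≤ 2 * (2 * m + 2) := by
  classical
  unfold weightPoly
  set G : ℕ → MvPolynomial (Fin (2 * (2 * m + 2) * (2 * m + 2))) K := fun i =>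
    if h : i < 2 * (2 * m + 2) * (2 * m + 2) then MvPolynomial.X ⟨i, h⟩ else 0 with hG
  have hGle : ∀ i, (G i).totalDegree ≤ 1 := by
    intro i
    by_cases h : i < 2 * (2 * m + 2) * (2 * m + 2)
    · rw [hG]
      simp only [dif_pos h, MvPolynomial.totalDegree_X, le_refl]
    · rw [hG]
      simp only [dif_neg h, MvPolynomial.totalDegree_zero, zero_le]
  rw [weightForm_eq_sum h₁ h₂]
  have hprod : ∀ (R : ℕ → ℕ → ℕ) (w : ℕ) (ρ : Equiv.Perm (Fin (2 * m + 2))),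
      (∏ v : Fin (2 * m + 2), weightMatrix R (2 * m + 2) w G v (ρ v)).totalDegree
        ≤ 2 * m + 2 := by
    intro R w ρ
    refine (MvPolynomial.totalDegree_finsetProd _ _).trans ?_
    refine (Finset.sum_le_sum (g := fun _ => 1) fun v _ => ?_).trans (by simp)
    unfold weightMatrix
    split_ifs
    · exact hGle _
    · simp
  refine MvPolynomial.totalDegree_finsetSum_le fun σ _ =>
    MvPolynomial.totalDegree_finsetSum_le fun τ _ => ?_
  refine (MvPolynomial.totalDegree_mul _ _).trans ?_
  have h3 : (if ConnectedPair 0 σ τ then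
      (1 : MvPolynomial (Fin (2 * (2 * m + 2) * (2 * m + 2))) K) else 0).totalDegree = 0 := by
    split_ifs <;> simp
  have := MvPolynomial.totalDegree_mul
    (∏ v : Fin (2 * m + 2), weightMatrix R₁ (2 * m + 2) 0 G v (σ v))
    (∏ v : Fin (2 * m + 2), weightMatrix R₂ (2 * m + 2) 1 G v (τ v))
  have := hprod R₁ 0 σ
  have := hprod R₂ 1 τ
  omega

end Weights

/-! ## Coin flips -/

section Coins

/-- The number whose binary digits are `L` successive coin flips. -/
def coinWord (r : ℕ → Bool) (s : ℕ) : ℕ → ℕ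
  | 0 => 0
  | L + 1 => 2 * coinWord r s L + (r (s + L)).toNat

theorem coinWord_lt (r : ℕ → Bool) (s L : ℕ) : coinWord r s L < 2 ^ L := by
  induction L with
  | zero => simp [coinWord]
  | succ L ih =>
    rw [coinWord, pow_succ]
    have := (r (s + L)).toNat_le
    omega

theorem coinWord_inj {r r' : ℕ → Bool} {s L : ℕ} (h : coinWord r s L = coinWord r' s L) :
    ∀ b < L, r (s + b) = r' (s + b) := by
  induction L with
  | zero => simp
  | succ L ih =>
    rw [coinWord, coinWord] at h
    have h1 := (r (s + L)).toNat_le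
    have h2 := (r' (s + L)).toNat_le
    intro b hb
    rcases Nat.lt_succ_iff_lt_or_eq.1 hb with hb | rfl
    · exact ih (by omega) b hb
    · have h3 : (r (s + b)).toNat = (r' (s + b)).toNat := by omega
      revert h3
      cases r (s + b) <;> cases r' (s + b) <;> simp

open scoped ENNReal

theorem RAM.coinMeasure_cylinder (r₀ : ℕ → Bool) (T : ℕ) :
    RAM.coinMeasure {r | ∀ t < T, r t = r₀ t} = (2⁻¹ : ℝ≥0∞) ^ T := by
  have h : {r : ℕ → Bool | ∀ t < T, r t = r₀ t}
      = Set.pi (Finset.range T : Set ℕ) fun t => {r₀ t} := by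
    ext r
    simp
  rw [h, RAM.coinMeasure, Measure.infinitePi_pi _ fun _ _ => measurableSet_singleton _]
  simp

instance RAM.isProbabilityMeasure_coinMeasure : IsProbabilityMeasure RAM.coinMeasure := by
  unfold RAM.coinMeasure
  infer_instance

/-- If the prescribed words can occur at all, they determine the first `M * L` flips. -/
theorem RAM.coinMeasure_words_le (L M : ℕ) (y : ℕ → ℕ) :
    RAM.coinMeasure {r | ∀ i < M, coinWord r (i * L) L = y i} ≤ (2⁻¹ : ℝ≥0∞) ^ (M * L) := by
  rcases Set.eq_empty_or_nonempty {r | ∀ i < M, coinWord r (i * L) L = y i} with h | ⟨r₀, h₀⟩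
  · rw [h, measure_empty]
    exact zero_le
  · rw [← RAM.coinMeasure_cylinder r₀]
    refine measure_mono fun r hr t ht => ?_
    have hL : 0 < L := Nat.pos_of_ne_zero fun h => by simp [h] at ht
    have hi : t / L < M := (Nat.div_lt_iff_lt_mul hL).2 ht
    have := coinWord_inj ((hr (t / L) hi).trans (h₀ (t / L) hi).symm) (t % L) (Nat.mod_lt _ hL)
    rwa [mul_comm, Nat.div_add_mod] at this

open Polynomial in
/-- With random weights of `L` bits, the algorithm detects an existing pair with probability at
least one half. -/
theorem RAM.half_le_coinMeasure_weightForm {m L : ℕ} {R₁ R₂ : ℕ → ℕ → ℕ}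
    (h₁ : SymmOn (2 * m + 2) R₁) (h₂ : SymmOn (2 * m + 2) R₂) (h : HasConnectedPair m R₁ R₂)
    (hL : 4 * (2 * m + 2) ≤ 2 ^ L) :
    1 / 2 ≤ RAM.coinMeasure
      {r | weightForm m R₁ R₂ (fun i => bitPoly (coinWord r (i * L) L)) ≠ 0} := by
  classical
  set M := 2 * (2 * m + 2) * (2 * m + 2) with hM
  set p := weightPoly (ZMod 2)[X] m R₁ R₂ with hp
  have hp0 : p ≠ 0 := by
    obtain ⟨g, hg⟩ := exists_weightForm_ne_zero (K := (ZMod 2)[X]) h₁ h₂ h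
    intro h0
    rw [← eval_weightPoly, ← hp, h0, map_zero] at hg
    exact hg rfl
  set S : Finset (ZMod 2)[X] := (Finset.range (2 ^ L)).image bitPoly with hS
  have hScard : S.card = 2 ^ L := by
    rw [hS, Finset.card_image_of_injective _ bitPoly_injective, Finset.card_range]
  set Z := {f ∈ Fintype.piFinset fun _ : Fin M => S | MvPolynomial.eval f p = 0} with hZ
  -- Schwartz–Zippel on the grid of polynomials coded by `L` bits. The degree is at most `2 * (2 * m
  -- + 2)`, so by `hL` at most half of the grid points are zeros.
  have hsz : (Z.card : ℚ≥0) / ((2 ^ L) ^ M : ℚ≥0) ≤ p.totalDegree / 2 ^ L := by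
    have := MvPolynomial.schwartz_zippel_totalDegree hp0 S
    rw [hScard] at this
    simpa using this
  have hcard : Z.card * 2 ≤ 2 ^ (M * L) := by
    have hdeg : p.totalDegree ≤ 2 * (2 * m + 2) := totalDegree_weightPoly h₁ h₂
    have h1 : (p.totalDegree : ℚ≥0) / 2 ^ L ≤ 1 / 2 := by
      rw [div_le_div_iff₀ (by positivity) (by positivity), one_mul]
      have : p.totalDegree * 2 ≤ 2 ^ L := by omega
      exact_mod_cast this
    have h2 := hsz.trans h1
    rw [div_le_div_iff₀ (by positivity) (by positivity), one_mul, ← pow_mul, mul_comm L M] at h2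
    exact_mod_cast h2
  -- The bad event is covered by one cylinder for each zero of `p` in the grid, with
  -- `Function.invFun bitPoly` decoding the coordinates. Only subadditivity is used, so the good
  -- event need not be shown measurable.
  have hcover : (Set.univ : Set (ℕ → Bool)) ⊆
      {r | weightForm m R₁ R₂ (fun i => bitPoly (coinWord r (i * L) L)) ≠ 0} ∪
      ⋃ f ∈ Z, {r | ∀ i < M, coinWord r (i * L) L
        = Function.invFun bitPoly (if h : i < M then f ⟨i, h⟩ else 0)} := by
    intro r _
    by_cases hr : weightForm m R₁ R₂ (fun i => bitPoly (coinWord r (i * L) L)) = 0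
    · refine Or.inr (Set.mem_iUnion₂.2 ⟨fun i => bitPoly (coinWord r (i * L) L), ?_, ?_⟩)
      · rw [hZ, Finset.mem_filter, Fintype.mem_piFinset]
        refine ⟨fun i => Finset.mem_image_of_mem _ (Finset.mem_range.2 (coinWord_lt _ _ _)), ?_⟩
        rw [hp, eval_weightPoly fun i => bitPoly (coinWord r (i * L) L), hr]
      · intro i hi
        rw [dif_pos hi, Function.leftInverse_invFun bitPoly_injective]
    · exact Or.inl hr
  have hbad : RAM.coinMeasure (⋃ f ∈ Z, {r | ∀ i < M, coinWord r (i * L) L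
        = Function.invFun bitPoly (if h : i < M then f ⟨i, h⟩ else 0)}) ≤ 1 / 2 := by
    refine (measure_biUnion_finset_le _ _).trans ?_
    refine (Finset.sum_le_sum fun f _ => RAM.coinMeasure_words_le L M _).trans ?_
    rw [Finset.sum_const, nsmul_eq_mul]
    have h2 : (2 : ℝ≥0∞) * 2⁻¹ = 1 := ENNReal.mul_inv_cancel (by simp) (by simp)
    have hc : (Z.card : ℝ≥0∞) * 2 ≤ 2 ^ (M * L) := by exact_mod_cast hcard
    calc (Z.card : ℝ≥0∞) * 2⁻¹ ^ (M * L)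
        = (Z.card : ℝ≥0∞) * (2 * 2⁻¹) * 2⁻¹ ^ (M * L) := by rw [h2, mul_one]
      _ = (Z.card : ℝ≥0∞) * 2 * 2⁻¹ ^ (M * L) * 2⁻¹ := by ring
      _ ≤ 2 ^ (M * L) * 2⁻¹ ^ (M * L) * 2⁻¹ := by gcongr
      _ = 1 / 2 := by rw [← mul_pow, h2, one_pow, one_mul, one_div]
  have htot := (measure_mono hcover).trans (measure_union_le (μ := RAM.coinMeasure) _ _)
  rw [measure_univ] at htot
  have h3 : (1 : ℝ≥0∞) ≤ RAM.coinMeasure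
      {r | weightForm m R₁ R₂ (fun i => bitPoly (coinWord r (i * L) L)) ≠ 0} + 1 / 2 :=
    htot.trans (by gcongr)
  refine ENNReal.le_of_add_le_add_right (a := 1 / 2) (by simp) ?_
  rw [ENNReal.add_halves]
  exact h3

end Coins

/-! ## The value on natural numbers -/

section OutBits

/-- `weightMatrix` on natural numbers, by arithmetic operations. -/
def weightBits (R : ℕ → ℕ → ℕ) (N w : ℕ) (g : ℕ → ℕ) (u v : ℕ) : ℕ :=
  (1 - (1 - R u v)) * (1 - (1 - ((u - v) + (v - u)))) * g (pairIndex N w u v)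

theorem bitPoly_weightBits (R : ℕ → ℕ → ℕ) (N w : ℕ) (g : ℕ → ℕ) (u v : ℕ) :
    bitPoly (weightBits R N w g u v) = weightMatrix R N w (fun i => bitPoly (g i)) u v := by
  unfold weightBits weightMatrix
  split_ifs with h
  · rw [show 1 - (1 - R u v) = 1 by omega, show 1 - (1 - ((u - v) + (v - u))) = 1 by omega, one_mul,
      one_mul]
  · rcases Nat.eq_zero_or_pos (R u v) with h0 | h0
    · rw [h0, Nat.sub_zero, Nat.sub_self, zero_mul, zero_mul, bitPoly_zero]
    · have : u = v := by
        by_contra hne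
        exact h ⟨by omega, hne⟩
      rw [this, Nat.sub_self, add_zero, Nat.sub_zero, Nat.sub_self, mul_zero, zero_mul,
        bitPoly_zero]

/-- `cutMatrix` on natural numbers, by arithmetic operations. -/
def cutBits (m : ℕ) (A : ℕ → ℕ → ℕ) (t i j : ℕ) : ℕ :=
  A i j * (1 - (cutVertex m t i ^^^ cutVertex m t j))

theorem bitPoly_cutBits (m : ℕ) (A : ℕ → ℕ → ℕ) (t : ℕ) (i j : ℕ) :
    bitPoly (cutBits m A t i j)
      = if cutVertex m t i = cutVertex m t j then bitPoly (A i j) else 0 := by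
  unfold cutBits
  split_ifs with h
  · rw [h, Nat.xor_self, Nat.sub_zero, mul_one]
  · have : cutVertex m t i ^^^ cutVertex m t j ≠ 0 := fun h0 => h (Nat.xor_eq_zero_iff.1 h0)
    rw [show 1 - (cutVertex m t i ^^^ cutVertex m t j) = 0 by omega, mul_zero, bitPoly_zero]

/-- The determinant of the matrix restricted by a cut, on natural numbers. -/
def detBits (m : ℕ) (A : ℕ → ℕ → ℕ) (t : ℕ) : ℕ :=
  xorSum (fun l => clowBits (cutBits m A t) (2 * m + 2) (2 * m + 1) l l) (2 * m + 2)

theorem bitPoly_detBits (m : ℕ) (A : ℕ → ℕ → ℕ) (t : ℕ) :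
    bitPoly (detBits m A t) = (cutMatrix m (fun u v => bitPoly (A u v)) t).det := by
  rw [detBits, bitPoly_xorSum]
  simp only [bitPoly_clowBits]
  rw [sum_clow_eq_det]
  congr 1
  ext1 u v
  exact bitPoly_cutBits m A t u v

/-- The value computed by the program. -/
def outBits (m : ℕ) (A₁ A₂ : ℕ → ℕ → ℕ) : ℕ :=
  xorSum (fun t => clMul (detBits m A₁ t) (digitTransform (· ^^^ ·) (detBits m A₂) m t)) (3 ^ m)

/-- Since `bitPoly` turns exclusive or into addition and carry-less into ordinary multiplication, it
commutes with every stage of the computation. As it vanishes only at zero, testing the number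
amounts to testing the polynomial. -/
theorem bitPoly_outBits (m : ℕ) (R₁ R₂ : ℕ → ℕ → ℕ) (g : ℕ → ℕ) :
    bitPoly (outBits m (weightBits R₁ (2 * m + 2) 0 g) (weightBits R₂ (2 * m + 2) 1 g))
      = weightForm m R₁ R₂ (fun i => bitPoly (g i)) := by
  rw [outBits, bitPoly_xorSum]
  simp only [bitPoly_clMul, bitPoly_detBits, bitPoly_weightBits,
    digitTransform_map (· ^^^ ·) (· + ·) bitPoly bitPoly_xor]
  rfl

end OutBits

/-! ## Bounded programs on arrays, and their compilation -/

namespace RAM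

namespace Expr

instance : Add Expr := ⟨.op .add⟩
instance : Sub Expr := ⟨.op .sub⟩
instance : Mul Expr := ⟨.op .mul⟩
instance : Div Expr := ⟨.op .div⟩
instance : Mod Expr := ⟨.op .mod⟩
instance : XorOp Expr := ⟨.op .xor⟩
instance (k : ℕ) : OfNat Expr k := ⟨.const k⟩

@[simp] theorem eval_add (s : State) (a b : Expr) : (a + b).eval s = a.eval s + b.eval s := rfl
@[simp] theorem eval_sub (s : State) (a b : Expr) : (a - b).eval s = a.eval s - b.eval s := rfl
@[simp] theorem eval_mul (s : State) (a b : Expr) : (a * b).eval s = a.eval s * b.eval s := rfl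
@[simp] theorem eval_div (s : State) (a b : Expr) : (a / b).eval s = a.eval s / b.eval s := rfl
@[simp] theorem eval_mod (s : State) (a b : Expr) : (a % b).eval s = a.eval s % b.eval s := rfl
@[simp] theorem eval_xor (s : State) (a b : Expr) : (a ^^^ b).eval s = a.eval s ^^^ b.eval s := rfl
@[simp] theorem eval_ofNat (s : State) (k : ℕ) : (ofNat(k) : Expr).eval s = k := rfl
@[simp] theorem eval_const (s : State) (k : ℕ) : (const k).eval s = k := rfl
@[simp] theorem eval_reg (s : State) (x : ℕ) : (reg x).eval s = s.reg x := rfl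
@[simp] theorem eval_load (s : State) (a : Expr) : (load a).eval s = s.mem (a.eval s) := rfl

/-- The size of an expression. -/
def wt : Expr → ℕ
  | .const k => 1 + k.size
  | .reg _ => 1
  | .load a => 1 + a.wt
  | .op _ a b => 1 + a.wt + b.wt

/-- All registers in the expression belong to `A`. -/
def RegsIn (A : Set ℕ) : Expr → Prop
  | .const _ => True
  | .reg x => x ∈ A
  | .load a => a.RegsIn A
  | .op _ a b => a.RegsIn A ∧ b.RegsIn A

@[simp] theorem regsIn_add {A : Set ℕ} (a b : Expr) : (a + b).RegsIn A ↔ a.RegsIn A ∧ b.RegsIn A :=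
  Iff.rfl
@[simp] theorem regsIn_sub {A : Set ℕ} (a b : Expr) : (a - b).RegsIn A ↔ a.RegsIn A ∧ b.RegsIn A :=
  Iff.rfl
@[simp] theorem regsIn_mul {A : Set ℕ} (a b : Expr) : (a * b).RegsIn A ↔ a.RegsIn A ∧ b.RegsIn A :=
  Iff.rfl
@[simp] theorem regsIn_div {A : Set ℕ} (a b : Expr) : (a / b).RegsIn A ↔ a.RegsIn A ∧ b.RegsIn A :=
  Iff.rfl
@[simp] theorem regsIn_mod {A : Set ℕ} (a b : Expr) : (a % b).RegsIn A ↔ a.RegsIn A ∧ b.RegsIn A :=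
  Iff.rfl
@[simp] theorem regsIn_xor {A : Set ℕ} (a b : Expr) : (a ^^^ b).RegsIn A ↔ a.RegsIn A ∧ b.RegsIn A :=
  Iff.rfl
@[simp] theorem regsIn_ofNat {A : Set ℕ} (k : ℕ) : (ofNat(k) : Expr).RegsIn A := trivial
@[simp] theorem regsIn_const {A : Set ℕ} (k : ℕ) : (const k).RegsIn A := trivial
@[simp] theorem regsIn_reg {A : Set ℕ} {x : ℕ} : (reg x).RegsIn A ↔ x ∈ A := Iff.rfl
@[simp] theorem regsIn_load {A : Set ℕ} (a : Expr) : (load a).RegsIn A ↔ a.RegsIn A := Iff.rfl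

theorem eval_congr {A : Set ℕ} {s s' : State} (hr : ∀ x ∈ A, s.reg x = s'.reg x)
    (hm : s.mem = s'.mem) : ∀ {e : Expr}, e.RegsIn A → e.eval s = e.eval s'
  | .const _, _ => rfl
  | .reg x, he => hr x he
  | .load a, he => by
    rw [eval_load, eval_load, hm, eval_congr (e := a) hr hm he]
  | .op o a b, he => by
    rw [eval, eval, eval_congr hr hm he.1, eval_congr hr hm he.2]

end Expr

/-- All registers and memory cells hold numbers of at most `S` bits. -/
def State.Bdd (S : ℕ) (s : State) : Prop := (∀ x, s.reg x < 2 ^ S) ∧ ∀ a, s.mem a < 2 ^ S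

theorem Op.eval_lt (o : Op) {a b x y : ℕ} (ha : a < 2 ^ x) (hb : b < 2 ^ y) :
    o.eval a b < 2 ^ (1 + x + y) := by
  have hx : 2 ^ x ≤ 2 ^ (x + y) := Nat.pow_le_pow_right two_pos (Nat.le_add_right _ _)
  have hy : 2 ^ y ≤ 2 ^ (x + y) := Nat.pow_le_pow_right two_pos (Nat.le_add_left _ _)
  have h2 : 2 ^ (1 + x + y) = 2 * 2 ^ (x + y) := by rw [add_assoc, pow_add, pow_one]
  rw [h2]
  cases o with
  | add => simp only [Op.eval]; omega
  | sub => simp only [Op.eval]; omega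
  | mul =>
    have := Nat.mul_lt_mul'' ha hb
    rw [← pow_add] at this
    simp only [Op.eval]; omega
  | div => have := Nat.div_le_self a b; simp only [Op.eval]; omega
  | mod => have := Nat.mod_le a b; simp only [Op.eval]; omega
  | xor =>
    have := Nat.xor_lt_two_pow (ha.trans_le hx) (hb.trans_le hy)
    simp only [Op.eval]; omega

theorem Expr.eval_lt {S : ℕ} {s : State} (h : s.Bdd S) : ∀ e : Expr,
    e.eval s < 2 ^ (e.wt * (S + 1))
  | .const k => (Nat.lt_size_self k).trans_le (Nat.pow_le_pow_right two_pos (by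
      rw [wt]; nlinarith))
  | .reg x => (h.1 x).trans_le (Nat.pow_le_pow_right two_pos (by rw [wt]; omega))
  | .load a => (h.2 _).trans_le (Nat.pow_le_pow_right two_pos (by rw [wt]; nlinarith))
  | .op o a b => (o.eval_lt (a.eval_lt h) (b.eval_lt h)).trans_le
      (Nat.pow_le_pow_right two_pos (by rw [wt]; nlinarith))

/-- There are at most `wt` nodes, and by `Expr.eval_lt` each has a value of at most `wt * (S + 1)`
bits; hence the square. -/
theorem Expr.cost_le {S : ℕ} {s : State} (h : s.Bdd S) : ∀ e : Expr,
    e.cost s ≤ 2 * e.wt ^ 2 * (S + 1)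
  | .const k => by rw [wt, cost]; nlinarith
  | .reg x => by
    have := Nat.size_le.2 (h.1 x)
    rw [wt, cost]; nlinarith
  | .load a => by
    have h1 := Nat.size_le.2 (h.2 (a.eval s))
    have h2 := a.cost_le h
    rw [wt, cost]; nlinarith [Nat.zero_le (a.wt * (S + 1))]
  | .op o a b => by
    have h1 := Nat.size_le.2 ((Expr.op o a b).eval_lt h)
    have h2 := a.cost_le h
    have h3 := b.cost_le h
    rw [cost]
    rw [eval] at h1
    rw [wt] at h1 ⊢
    nlinarith [Nat.zero_le (a.wt * b.wt * (S + 1)), Nat.zero_le (a.wt * (S + 1)),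
      Nat.zero_le (b.wt * (S + 1))]

/-- Memory cell `i` of array `j`; register `1` points to the end of the input. -/
def cell (j : ℕ) (i : Expr) : Expr := .reg 1 + (16 * i + .const j)

/-- The content of a memory cell of array `j`. -/
def arr (j : ℕ) (i : Expr) : Expr := .load (cell j i)

/-- Programs on sixteen arrays with loops of fixed length. -/
inductive Prog
  | set (j : ℕ) (i e : Expr)
  | flip (j : ℕ) (i : Expr)
  | seq (p q : Prog)
  | loop (x b : ℕ) (p : Prog)

/-- The arrays and the number of coins flipped. -/
structure Store where
  val : ℕ → ℕ → ℕ
  coins : ℕ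

/-- The memory that contains an input of `B` cells and the given arrays. -/
def encode (B : ℕ) (inp : ℕ → ℕ) (V : ℕ → ℕ → ℕ) (a : ℕ) : ℕ :=
  if a < B then inp a else V ((a - B) % 16) ((a - B) / 16)

theorem encode_cell (B : ℕ) (inp : ℕ → ℕ) (V : ℕ → ℕ → ℕ) {j : ℕ} (hj : j < 16) (i : ℕ) :
    encode B inp V (B + (16 * i + j)) = V j i := by
  rw [encode, if_neg (by omega), Nat.add_sub_cancel_left, Nat.mul_add_mod, Nat.mod_eq_of_lt hj,
    Nat.mul_add_div (by norm_num), Nat.div_eq_of_lt hj, add_zero]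

/-- The arrays are interleaved modulo sixteen behind the input, so different cells have different
addresses and no write reaches the input. -/
theorem update_encode (B : ℕ) (inp : ℕ → ℕ) (V : ℕ → ℕ → ℕ) {j : ℕ} (hj : j < 16) (i y : ℕ) :
    Function.update (encode B inp V) (B + (16 * i + j)) y
      = encode B inp (Function.update V j (Function.update (V j) i y)) := by
  funext a
  by_cases ha : a = B + (16 * i + j)
  · rw [ha, Function.update_self, encode_cell _ _ _ hj, Function.update_self, Function.update_self]
  · rw [Function.update_of_ne ha, encode, encode]
    split_ifs with h
    · rfl
    · by_cases h1 : (a - B) % 16 = j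
      · rw [h1, Function.update_self, Function.update_of_ne]
        rintro h2
        omega
      · rw [Function.update_of_ne h1]

/-- The state of the machine that corresponds to a store. -/
def toState (inp : ℕ → ℕ) (env : ℕ → ℕ) (V : ℕ → ℕ → ℕ) : State :=
  ⟨env, encode (env 1) inp V, 0⟩

@[simp] theorem toState_reg (inp env : ℕ → ℕ) (V : ℕ → ℕ → ℕ) (x : ℕ) :
    (toState inp env V).reg x = env x := rfl

theorem eval_cell (s : State) (j : ℕ) (i : Expr) :
    (cell j i).eval s = s.reg 1 + (16 * i.eval s + j) := rfl

theorem eval_arr (inp env : ℕ → ℕ) (V : ℕ → ℕ → ℕ) {j : ℕ} (hj : j < 16) (i : Expr) :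
    (arr j i).eval (toState inp env V) = V j (i.eval (toState inp env V)) :=
  encode_cell _ _ _ hj _

@[simp] theorem regsIn_cell {A : Set ℕ} {j : ℕ} (i : Expr) :
    (cell j i).RegsIn A ↔ 1 ∈ A ∧ i.RegsIn A := by
  simp [cell]

@[simp] theorem regsIn_arr {A : Set ℕ} {j : ℕ} (i : Expr) :
    (arr j i).RegsIn A ↔ 1 ∈ A ∧ i.RegsIn A := by
  simp [arr]

/-- Iterate the functions `f 0, f 1, …, f (n - 1)`. -/
def iter {α : Type*} (f : ℕ → α → α) : ℕ → α → α
  | 0, a => a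
  | n + 1, a => f n (iter f n a)

theorem iter_induction {α : Type*} {f : ℕ → α → α} {n : ℕ} {a : α} (I : ℕ → α → Prop)
    (h0 : I 0 a) (h : ∀ i < n, ∀ b, I i b → I (i + 1) (f i b)) : I n (iter f n a) := by
  induction n with
  | zero => exact h0
  | succ n ih =>
    exact h n n.lt_succ_self _ (ih fun i hi => h i (hi.trans n.lt_succ_self))

namespace Prog

/-- The machine program.  Register `2` holds a number by which all values are reduced. -/
def compile : Prog → Cmd
  | set j i e => .store (cell j i) (e % .reg 2)
  | flip j i => .seq (.flip 0) (.store (cell j i) (.reg 0))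
  | seq p q => .seq p.compile q.compile
  | loop x b p => .seq (.assign x 0)
      (.loop (.reg b - .reg x) (.seq p.compile (.assign x (.reg x + 1))))

/-- The effect of a program. -/
def run (r : ℕ → Bool) (inp : ℕ → ℕ) : Prog → (ℕ → ℕ) → Store → Store
  | set j i e, env, s => ⟨Function.update s.val j (Function.update (s.val j)
      (i.eval (toState inp env s.val)) (e.eval (toState inp env s.val) % env 2)), s.coins⟩
  | flip j i, env, s => ⟨Function.update s.val j (Function.update (s.val j)
      (i.eval (toState inp env s.val)) (r s.coins).toNat), s.coins + 1⟩
  | seq p q, env, s => q.run r inp env (p.run r inp env s)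
  | loop x b p, env, s => iter (fun i => p.run r inp (Function.update env x i)) (env b) s

/-- Well-formedness: the registers in `A` are read only; only these and inner loop counters are
read; the length of a loop is one of the constants in the registers `3` to `9`. -/
def WF : Prog → Set ℕ → Prop
  | set j i e, A => j < 16 ∧ i.RegsIn A ∧ e.RegsIn A
  | flip j i, A => j < 16 ∧ i.RegsIn A
  | seq p q, A => p.WF A ∧ q.WF A
  | loop x b p, A => x ∉ A ∧ x ≠ 0 ∧ b ∈ Set.Icc 3 9 ∧ p.WF (insert x A)

/-- The running time in units of the word length. -/
def steps : Prog → (ℕ → ℕ) → ℕ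
  | set j i e, _ => 1 + 2 * (cell j i).wt ^ 2 + 2 * (e % .reg 2).wt ^ 2
  | flip j i, _ => 4 + 2 * (cell j i).wt ^ 2
  | seq p q, env => p.steps env + q.steps env
  | loop _ b p, env => 22 + env b * (60 + p.steps env)

/-- Loop lengths are read from the registers `3` to `9` only. In `Prog.exec` the loop counters lie
outside these, so all rounds of a loop have the same time bound. -/
theorem steps_congr {env env' : ℕ → ℕ} (h : ∀ x ∈ Set.Icc 1 9, env x = env' x) :
    ∀ {p : Prog} {A : Set ℕ}, p.WF A → p.steps env = p.steps env'
  | set _ _ _, _, _ => rfl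
  | flip _ _, _, _ => rfl
  | seq p q, _, hp => by rw [steps, steps, steps_congr h hp.1, steps_congr h hp.2]
  | loop x b p, _, hp => by rw [steps, steps, steps_congr h hp.2.2.2,
      h b ⟨le_trans (by norm_num) hp.2.2.1.1, hp.2.2.1.2⟩]

end Prog

/-- The registers in `A` and the memory agree with a store. -/
structure Agree (inp env : ℕ → ℕ) (A : Set ℕ) (st : Store) (s : State) : Prop where
  reg : ∀ x ∈ A, s.reg x = env x
  mem : s.mem = encode (env 1) inp st.val
  coins : s.coins = st.coins

theorem Agree.eval {inp env : ℕ → ℕ} {A : Set ℕ} {st : Store} {s : State} (h : Agree inp env A st s)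
    {e : Expr} (he : e.RegsIn A) : e.eval s = e.eval (toState inp env st.val) :=
  Expr.eval_congr h.reg h.mem he

theorem State.Bdd.assign {S : ℕ} {s : State} (h : s.Bdd S) {y : ℕ} (hy : y < 2 ^ S) (x k : ℕ) :
    State.Bdd S ⟨Function.update s.reg x y, s.mem, k⟩ := by
  refine ⟨fun z => ?_, h.2⟩
  by_cases hz : z = x
  · simpa [hz] using hy
  · simpa [hz] using h.1 z

theorem State.Bdd.store {S : ℕ} {s : State} (h : s.Bdd S) {y : ℕ} (hy : y < 2 ^ S) (x k : ℕ) :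
    State.Bdd S ⟨s.reg, Function.update s.mem x y, k⟩ := by
  refine ⟨h.1, fun z => ?_⟩
  by_cases hz : z = x
  · simpa [hz] using hy
  · simpa [hz] using h.2 z

theorem Agree.assign {inp env : ℕ → ℕ} {A : Set ℕ} {st : Store} {s : State}
    (h : Agree inp env A st s) {x : ℕ} (hx : x ∉ A) (y : ℕ) :
    Agree inp env A st { s with reg := Function.update s.reg x y } :=
  ⟨fun z hz => by rw [← h.reg z hz]; exact Function.update_of_ne (ne_of_mem_of_not_mem hz hx) _ _,
    h.mem, h.coins⟩

theorem Agree.update {inp env : ℕ → ℕ} {A : Set ℕ} {st : Store} {s : State}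
    (h : Agree inp env A st s) {x : ℕ} (hx : x ∉ A) (h1 : 1 ∈ A) :
    Agree inp (Function.update env x (s.reg x)) (insert x A) st s where
  reg z hz := by
    by_cases hzx : z = x
    · rw [hzx, Function.update_self]
    · rw [Function.update_of_ne hzx, h.reg z (hz.resolve_left hzx)]
  mem := by rw [Function.update_of_ne (ne_of_mem_of_not_mem h1 hx), h.mem]
  coins := h.coins

theorem Agree.restrict {inp env : ℕ → ℕ} {A : Set ℕ} {st : Store} {s : State} {x y : ℕ}
    (h : Agree inp (Function.update env x y) (insert x A) st s) (hx : x ∉ A) (h1 : 1 ∈ A) :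
    Agree inp env A st s where
  reg z hz := by
    rw [h.reg z (Or.inr hz), Function.update_of_ne (ne_of_mem_of_not_mem hz hx)]
  mem := by rw [h.mem, Function.update_of_ne (ne_of_mem_of_not_mem h1 hx)]
  coins := h.coins

/-- The compiled program computes the effect of the program, in the given time. -/
theorem Prog.exec (r : ℕ → Bool) {S : ℕ} (hS : 0 < S) (inp : ℕ → ℕ) : ∀ (p : Prog) (A : Set ℕ),
    Set.Icc 1 9 ⊆ A → 0 ∉ A → p.WF A → ∀ (env : ℕ → ℕ) (st : Store) (s : State), s.Bdd S → 0 < env 2 →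
    Agree inp env A st s → ∃ t s', Exec r p.compile s t s' ∧ t ≤ p.steps env * (S + 1) ∧
      s'.Bdd S ∧ Agree inp env A (p.run r inp env st) s' := by
  intro p
  induction p with
  | set j i e =>
    intro A hA h0 hp env st s hs h2 ha
    obtain ⟨hj, hi, he⟩ := hp
    refine ⟨_, _, .store _ _ _, ?_, ?_, ?_⟩
    · have c1 := (cell j i).cost_le hs
      have c2 := (e % .reg 2).cost_le hs
      rw [steps]
      nlinarith
    -- The stored value is reduced modulo register `2`, which itself fits into `S` bits; so no write
    -- can break the bound.
    · refine hs.store ?_ _ _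
      rw [Expr.eval_mod, Expr.eval_reg]
      refine (Nat.mod_lt _ ?_).trans (hs.1 2)
      rw [ha.reg 2 (hA (by simp))]
      exact h2
    · refine ⟨ha.reg, ?_, ha.coins⟩
      simp only [run]
      rw [← update_encode _ _ _ hj, eval_cell, Expr.eval_mod, ha.eval hi, ha.eval he, ha.mem,
        ha.reg 1 (hA (by simp)), Expr.eval_reg, ha.reg 2 (hA (by simp))]
  | flip j i =>
    intro A hA h0 hp env st s hs h2 ha
    obtain ⟨hj, hi⟩ := hp
    have h1 : (r s.coins).toNat < 2 ^ S :=
      (Bool.toNat_lt _).trans_le (Nat.le_self_pow hS.ne' 2)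
    have hs1 := hs.assign h1 0 (s.coins + 1)
    have hr : ∀ x ∈ A, Function.update s.reg 0 (r s.coins).toNat x = s.reg x :=
      fun x hx => Function.update_of_ne (ne_of_mem_of_not_mem hx h0) _ _
    refine ⟨_, _, .seq (.flip _ _) (.store _ _ _), ?_, ?_, ?_⟩
    · have c1 := (cell j i).cost_le hs1
      have c2 := (Expr.reg 0).cost_le hs1
      simp only [Expr.wt] at c2
      rw [steps]
      nlinarith
    · exact hs1.store (by simpa using h1) _ _
    · refine ⟨fun x hx => (hr x hx).trans (ha.reg x hx), ?_, ?_⟩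
      · simp only [run]
        have hi' : i.eval (⟨Function.update s.reg 0 (r s.coins).toNat, s.mem, s.coins + 1⟩ : State)
            = i.eval (toState inp env st.val) :=
          Expr.eval_congr (fun x hx => (hr x hx).trans (ha.reg x hx)) ha.mem hi
        rw [← update_encode _ _ _ hj, eval_cell, hi']
        simp only [hr 1 (hA (by simp)), Expr.eval_reg, Function.update_self]
        rw [ha.mem, ha.reg 1 (hA (by simp)), ha.coins]
      · simp only [run]
        rw [ha.coins]
  | seq p q ihp ihq =>
    intro A hA h0 hp env st s hs h2 ha
    obtain ⟨t₁, s₁, e₁, ht₁, hs₁, ha₁⟩ := ihp A hA h0 hp.1 env st s hs h2 ha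
    obtain ⟨t₂, s₂, e₂, ht₂, hs₂, ha₂⟩ := ihq A hA h0 hp.2 env _ s₁ hs₁ h2 ha₁
    refine ⟨_, _, .seq e₁ e₂, ?_, hs₂, ha₂⟩
    rw [steps, add_mul]
    omega
  | loop x b p ih =>
    intro A hA h0 hp env st s hs h2 ha
    obtain ⟨hx, hx0, hb, hp⟩ := hp
    replace hb : b ∈ Set.Icc 1 9 := ⟨le_trans (by norm_num) hb.1, hb.2⟩
    have h1A : 1 ∈ A := hA (by simp)
    have h2x : 2 ≠ x := ne_of_mem_of_not_mem (hA (by simp)) hx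
    -- Induction on the number `k` of rounds left, from an arbitrary round `i` on, because the
    -- machine's loop unfolds at its first round.
    have key : ∀ k i, i + k = env b → ∀ s : State, s.Bdd S → s.reg x = i →
        Agree inp env A (iter (fun i => p.run r inp (Function.update env x i)) i st) s →
        ∃ t s', Exec r (.loop (.reg b - .reg x) (.seq p.compile (.assign x (.reg x + 1)))) s t s' ∧
          t ≤ (19 + k * (60 + p.steps env)) * (S + 1) ∧ s'.Bdd S ∧
          Agree inp env A
            (iter (fun i => p.run r inp (Function.update env x i)) (env b) st) s' := by
      intro k
      induction k with
      | zero =>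
        intro i hi s hs hxi ha
        refine ⟨_, s, .loopEnd ?_, ?_, hs, ?_⟩
        · rw [Expr.eval_sub, Expr.eval_reg, Expr.eval_reg, ha.reg b (hA hb)]
          omega
        · have := (Expr.reg b - .reg x).cost_le hs
          have hw : (Expr.reg b - .reg x).wt = 3 := rfl
          rw [hw] at this
          nlinarith
        · rw [← hi, add_zero]
          exact ha
      | succ k ihk =>
        intro i hi s hs hxi ha
        have ha' := ha.update hx h1A
        rw [hxi] at ha'
        obtain ⟨t₁, s₁, e₁, ht₁, hs₁, ha₁⟩ := ih (insert x A) (hA.trans (Set.subset_insert _ _))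
          (by simp [h0, hx0.symm]) hp _ _ s hs
          (by rwa [Function.update_of_ne h2x]) ha'
        have hx₁ : s₁.reg x = i := by
          rw [ha₁.reg x (Set.mem_insert _ _), Function.update_self]
        have ha₂ := ha₁.restrict hx h1A
        -- The counter never exceeds the loop length, which sits in a register and therefore fits
        -- into a word.
        have hbS := hs.1 b
        rw [ha.reg b (hA hb)] at hbS
        have hs₂ := hs₁.assign (y := i + 1) (by omega) x s₁.coins
        obtain ⟨t₂, s₂, e₂, ht₂, hs₂, ha₂⟩ := ihk (i + 1) (by omega) _ hs₂
          (Function.update_self _ _ _) (ha₂.assign hx _)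
        have he : Exec r (.assign x (.reg x + 1)) s₁ (1 + (Expr.reg x + 1).cost s₁)
            ⟨Function.update s₁.reg x (i + 1), s₁.mem, s₁.coins⟩ := by
          have := Exec.assign (r := r) x (.reg x + 1) s₁
          rwa [Expr.eval_add, Expr.eval_reg, hx₁] at this
        refine ⟨_, s₂, .loopStep ?_ (.seq e₁ he) e₂, ?_, hs₂, ha₂⟩
        · rw [Expr.eval_sub, Expr.eval_reg, Expr.eval_reg, ha.reg b (hA hb), hxi]
          omega
        · have c1 := (Expr.reg b - .reg x).cost_le hs
          have hw : (Expr.reg b - .reg x).wt = 3 := rfl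
          have c2 := (Expr.reg x + 1).cost_le hs₁
          have hw' : (Expr.reg x + 1).wt = 4 := rfl
          rw [hw] at c1
          rw [hw'] at c2
          rw [steps_congr (env' := env) (fun y hy => Function.update_of_ne
            (ne_of_mem_of_not_mem (hA hy) hx) _ _) hp]
            at ht₁
          nlinarith
    have hs₀ := hs.assign (y := 0) (by positivity) x s.coins
    obtain ⟨t, s', e, ht, hs', ha'⟩ := key (env b) 0 (zero_add _) _ hs₀
      (Function.update_self _ _ _) (ha.assign hx _)
    have he : Exec r (.assign x 0) s (1 + (0 : Expr).cost s) ⟨Function.update s.reg x 0, s.mem, s.coins⟩ :=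
      Exec.assign (r := r) x 0 s
    refine ⟨_, s', .seq he e, ?_, hs', ha'⟩
    have c0 : (0 : Expr).cost s = 1 := rfl
    rw [steps]
    nlinarith

/-! ### Running times as polynomials -/

namespace Prog

open Polynomial in
/-- A bound for the running time, as a polynomial in a bound for the lengths of all loops but
those whose length is in register `4`. -/
noncomputable def time : Prog → ℕ[X]
  | set j i e => C (1 + 2 * (cell j i).wt ^ 2 + 2 * (e % .reg 2).wt ^ 2)
  | flip j i => C (4 + 2 * (cell j i).wt ^ 2)
  | seq p q => p.time + q.time
  | loop _ b p => if b = 4 then 82 + p.time else 22 + X * (60 + p.time)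

/-- The number of nested loops whose length is in register `4`. -/
def depth : Prog → ℕ
  | set _ _ _ => 0
  | flip _ _ => 0
  | seq p q => max p.depth q.depth
  | loop _ b p => if b = 4 then p.depth + 1 else p.depth

/-- Only the loops of length `env 4`, later `3 ^ m`, must be kept apart: nesting them raises the
power. The other lengths are bounded by `D` and go into the polynomial. -/
theorem steps_le {env : ℕ → ℕ} {D : ℕ} (h4 : 0 < env 4)
    (h : ∀ b ∈ Set.Icc 3 9, b ≠ 4 → env b ≤ D) : ∀ {p : Prog} {A : Set ℕ}, p.WF A →
    p.steps env ≤ p.time.eval D * env 4 ^ p.depth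
  | set _ _ _, _, _ => by simp [steps, time, depth]
  | flip _ _, _, _ => by simp [steps, time, depth]
  | seq p q, _, hp => by
    have h1 := steps_le h4 h hp.1
    have h2 := steps_le h4 h hp.2
    rw [steps, time, depth, Polynomial.eval_add, add_mul]
    exact add_le_add
      (h1.trans (Nat.mul_le_mul_left _ (Nat.pow_le_pow_right h4 (le_max_left _ _))))
      (h2.trans (Nat.mul_le_mul_left _ (Nat.pow_le_pow_right h4 (le_max_right _ _))))
  | loop x b p, _, hp => by
    have h1 := steps_le h4 h hp.2.2.2
    have h2 : 0 < env 4 ^ p.depth := pow_pos h4 _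
    rw [steps, time, depth]
    split_ifs with hb
    · rw [Polynomial.eval_add, Polynomial.eval_ofNat, hb, pow_succ]
      nlinarith [Nat.mul_le_mul_left (env 4) h1, Nat.mul_le_mul h4 h2]
    · have h3 := h b hp.2.2.1 hb
      rw [Polynomial.eval_add, Polynomial.eval_ofNat, Polynomial.eval_mul, Polynomial.eval_X,
        Polynomial.eval_add, Polynomial.eval_ofNat]
      calc 22 + env b * (60 + p.steps env)
          ≤ 22 * env 4 ^ p.depth
            + D * (60 * env 4 ^ p.depth + p.time.eval D * env 4 ^ p.depth) := by
            gcongr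
            · omega
            · omega
        _ = _ := by ring

/-! ### Rules for the effect of a program -/

variable {r : ℕ → Bool} {inp env : ℕ → ℕ} {st : Store}

/-- The arrays that a program may change. -/
def writes : Prog → List ℕ
  | set j _ _ => [j]
  | flip j _ => [j]
  | seq p q => p.writes ++ q.writes
  | loop _ _ p => p.writes

/-- The frame rule: it allows each phase of the program to be verified in terms of the arrays it
uses. -/
theorem run_val_of_notMem {j : ℕ} : ∀ {p : Prog} {env : ℕ → ℕ} {st : Store}, j ∉ p.writes →
    (p.run r inp env st).val j = st.val j
  | set _ _ _, _, _, h => Function.update_of_ne (by simpa [writes] using h) _ _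
  | flip _ _, _, _, h => Function.update_of_ne (by simpa [writes] using h) _ _
  | seq p q, _, _, h => by
    rw [writes, List.mem_append, not_or] at h
    rw [run, run_val_of_notMem h.2, run_val_of_notMem h.1]
  | loop x b p, env, st, h =>
    iter_induction (fun _ (s : Store) => s.val j = st.val j) rfl fun i _ s hs => by
      rw [run_val_of_notMem (p := p) h, hs]

theorem run_seq (p q : Prog) :
    (seq p q).run r inp env st = q.run r inp env (p.run r inp env st) := rfl

theorem run_set_val (j : ℕ) (i e : Expr) (j' i' : ℕ) : ((set j i e).run r inp env st).val j' i'
    = if j' = j ∧ i' = i.eval (toState inp env st.val)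
      then e.eval (toState inp env st.val) % env 2 else st.val j' i' := by
  by_cases h : j' = j
  · subst h
    simp only [run, Function.update_self, Function.update_apply, true_and]
  · simp only [run, Function.update_of_ne h, h, false_and, if_false]

theorem run_set_coins (j : ℕ) (i e : Expr) : ((set j i e).run r inp env st).coins = st.coins := rfl

theorem run_flip_val (j : ℕ) (i : Expr) (j' i' : ℕ) : ((flip j i).run r inp env st).val j' i'
    = if j' = j ∧ i' = i.eval (toState inp env st.val)
      then (r st.coins).toNat else st.val j' i' := by
  by_cases h : j' = j
  · subst h
    simp only [run, Function.update_self, Function.update_apply, true_and]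
  · simp only [run, Function.update_of_ne h, h, false_and, if_false]

theorem run_flip_coins (j : ℕ) (i : Expr) :
    ((flip j i).run r inp env st).coins = st.coins + 1 := rfl

/-- The invariant rule for loops with the frame built in: in each round, arrays not written by the
body may be taken from the state before the loop. -/
theorem run_loop_induction {x b : ℕ} {p : Prog} (I : ℕ → Store → Prop) (h0 : I 0 st)
    (h : ∀ k < env b, ∀ s : Store, (∀ j ∉ p.writes, s.val j = st.val j) → I k s →
      I (k + 1) (p.run r inp (Function.update env x k) s)) :
    I (env b) ((loop x b p).run r inp env st) := by
  refine (iter_induction (fun k s => (∀ j ∉ p.writes, s.val j = st.val j) ∧ I k s)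
    ⟨fun _ _ => rfl, h0⟩ fun k hk s hs => ⟨fun j hj => ?_, h k hk s hs.1 hs.2⟩).2
  rw [run_val_of_notMem hj, hs.1 j hj]

end Prog

end RAM

/-! ## The program -/

namespace RAM

/-- The constants of the program: the sizes of the matrices, of the weights and of all numbers. -/
structure Params (m L : ℕ) (env : ℕ → ℕ) : Prop where
  reg2 : env 2 = 2 ^ (2 * ((2 * m + 3) * L) + 2)
  reg4 : env 4 = 3 ^ m
  reg5 : env 5 = 2 * m + 2
  reg6 : env 6 = m
  reg7 : env 7 = (2 * m + 3) * L
  reg8 : env 8 = L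
  reg9 : env 9 = 2 * (2 * m + 2) * (2 * m + 2)
  pos : 0 < L

namespace Params

variable {m L : ℕ} {env : ℕ → ℕ}

theorem update (h : Params m L env) {x : ℕ} (hx : 10 ≤ x) (y : ℕ) :
    Params m L (Function.update env x y) := by
  constructor
  all_goals first | rw [Function.update_of_ne (by omega)] | skip
  exacts [h.reg2, h.reg4, h.reg5, h.reg6, h.reg7, h.reg8, h.reg9, h.pos]

/-- Reduction modulo register `2` only guards the word length. Matrix entries have at most `(2 * m +
3) * L` bits and their carry-less products at most twice as many, so it never changes a value. -/
theorem mod (h : Params m L env) {a : ℕ} (ha : a < 2 ^ (2 * ((2 * m + 3) * L) + 2)) :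
    a % env 2 = a := by
  rw [h.reg2, Nat.mod_eq_of_lt ha]

theorem mod' (h : Params m L env) {a k : ℕ} (ha : a < 2 ^ k)
    (hk : k ≤ 2 * ((2 * m + 3) * L) + 2) : a % env 2 = a :=
  h.mod (ha.trans_le (Nat.pow_le_pow_right two_pos hk))

theorem mod_two (h : Params m L env) {a : ℕ} (ha : a < 2) : a % env 2 = a :=
  h.mod' (k := 1) ha (by omega)

end Params

open Prog

variable {m L : ℕ} {r : ℕ → Bool} {inp env : ℕ → ℕ} {st : Store}

theorem clMul_step (a b : ℕ) : clMul a b = a * (b % 2) ^^^ clMul (2 * a) (b / 2) := by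
  by_cases hb : b = 0
  · simp [hb, clMul_zero]
  · rw [clMul, if_neg hb]

/-- Carry-less multiplication of the numbers in the arrays `11` and `12`. -/
def mulProg : Prog :=
  .seq (.set 10 0 0) (.loop 15 7
    (.seq (.set 10 0 (arr 10 0 ^^^ arr 11 0 * (arr 12 0 % 2)))
      (.seq (.set 11 0 (2 * arr 11 0)) (.set 12 0 (arr 12 0 / 2)))))

/-- The exclusive or of the accumulator with the product of the remaining operands is invariant.
After `k` rounds the accumulator and the shifted operand have at most `T + k ≤ 2 * T` bits, so
nothing is cut off; after `T` rounds the second operand is used up. -/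
theorem run_mulProg (h : Params m L env) (ha : st.val 11 0 < 2 ^ ((2 * m + 3) * L))
    (hb : st.val 12 0 < 2 ^ ((2 * m + 3) * L)) :
    (mulProg.run r inp env st).val 10 0 = clMul (st.val 11 0) (st.val 12 0) := by
  set T := (2 * m + 3) * L with hT
  have key := run_loop_induction (r := r) (inp := inp) (env := env) (x := 15) (b := 7)
    (st := (Prog.set 10 0 0).run r inp env st)
    (p := (.seq (.set 10 0 (arr 10 0 ^^^ arr 11 0 * (arr 12 0 % 2)))
      (.seq (.set 11 0 (2 * arr 11 0)) (.set 12 0 (arr 12 0 / 2)))))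
    (fun k s => s.val 11 0 = st.val 11 0 * 2 ^ k ∧ s.val 12 0 = st.val 12 0 / 2 ^ k ∧
      s.val 10 0 < 2 ^ (T + k) ∧ clMul (st.val 11 0) (st.val 12 0)
        = s.val 10 0 ^^^ clMul (st.val 11 0 * 2 ^ k) (st.val 12 0 / 2 ^ k))
    (by simp [run_set_val]) ?_
  · rw [h.reg7, Nat.div_eq_of_lt hb, clMul_zero, Nat.xor_zero] at key
    exact key.2.2.2.symm
  · rintro k hk s - ⟨h11, h12, h10, hx⟩
    have h' := h.update (x := 15) (by norm_num) k
    rw [h.reg7] at hk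
    have b1 : s.val 11 0 < 2 ^ (T + k) := by
      rw [h11, pow_add]
      exact Nat.mul_lt_mul_of_pos_right ha (by positivity)
    have b2 : s.val 11 0 * (s.val 12 0 % 2) < 2 ^ (T + k) := by
      rcases Nat.mod_two_eq_zero_or_one (s.val 12 0) with e | e <;> rw [e] <;> simp [b1]
    have b3 := Nat.xor_lt_two_pow h10 b2
    have b4 : 2 * s.val 11 0 < 2 ^ (T + k + 1) := by rw [pow_succ]; omega
    have b5 : s.val 12 0 / 2 < 2 ^ T :=
      (Nat.div_le_self _ _).trans_lt (h12 ▸ (Nat.div_le_self _ _).trans_lt hb)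
    simp only [run_seq, run_set_val, eval_arr, Nat.reduceLT, Nat.reduceEqDiff, Expr.eval_xor,
      Expr.eval_mul, Expr.eval_mod, Expr.eval_div, Expr.eval_ofNat, and_true, if_true,
      if_false]
    rw [h'.mod' b3 (by omega), h'.mod' b4 (by omega), h'.mod' b5 (by omega)]
    refine ⟨by rw [h11]; ring, by rw [h12, Nat.div_div_eq_div_mul, pow_succ], ?_, ?_⟩
    · exact b3.trans_le (Nat.pow_le_pow_right two_pos (by omega))
    · rw [hx, clMul_step, Nat.xor_assoc, h11, h12, Nat.div_div_eq_div_mul, pow_succ]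
      congr 3
      ring

end RAM

/-! ### Powers of three, random weights and the weight matrices -/

namespace RAM

open Prog

variable {m L : ℕ} {r : ℕ → Bool} {inp env : ℕ → ℕ} {st : Store}

/-- The powers of three, in array `0`. -/
def powProg : Prog :=
  .seq (.set 0 0 1) (.loop 10 6 (.set 0 (.reg 10 + 1) (arr 0 (.reg 10) * 3)))

theorem Params.pow_lt (h : Params m L env) {i : ℕ} (hi : i ≤ m) :
    3 ^ i < 2 ^ (2 * ((2 * m + 3) * L) + 2) := by
  have h0 := h.pos
  calc 3 ^ i ≤ 3 ^ m := Nat.pow_le_pow_right (by norm_num) hi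
    _ ≤ (2 ^ 2) ^ m := Nat.pow_le_pow_left (by norm_num) _
    _ = 2 ^ (2 * m) := by rw [pow_mul]
    _ < _ := Nat.pow_lt_pow_right (by norm_num) (by nlinarith)

theorem run_powProg (h : Params m L env) :
    ∀ i ≤ m, (powProg.run r inp env st).val 0 i = 3 ^ i := by
  have key := run_loop_induction (r := r) (inp := inp) (env := env) (x := 10) (b := 6)
    (st := (Prog.set 0 0 1).run r inp env st) (p := .set 0 (.reg 10 + 1) (arr 0 (.reg 10) * 3))
    (fun k s => ∀ i ≤ k, s.val 0 i = 3 ^ i) ?_ ?_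
  · rw [h.reg6] at key
    exact key
  · intro i hi
    obtain rfl : i = 0 := by omega
    simp [run_set_val, h.mod_two]
  · intro k hk s _ hs i hi
    have h' := h.update (x := 10) le_rfl k
    rw [h.reg6] at hk
    simp only [run_set_val, Expr.eval_add, Expr.eval_mul, Expr.eval_ofNat, eval_arr,
      Nat.reduceLT, Expr.eval_reg, toState_reg, Function.update_self, true_and]
    split_ifs with hi'
    · rw [hs k le_rfl, ← pow_succ, h'.mod (h.pow_lt hk), hi']
    · exact hs i (by omega)

/-- Random weights, in array `1`. -/
def sampleProg : Prog :=
  .loop 10 9 (.seq (.set 1 (.reg 10) 0) (.loop 11 8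
    (.seq (.flip 9 0) (.set 1 (.reg 10) (2 * arr 1 (.reg 10) + arr 9 0)))))

/-- Weight `k` consumes exactly the `L` flips from number `k * L` on, so different weights use
disjoint blocks of coins. The alignment needs the coin counter to start at zero. -/
theorem run_sampleProg (h : Params m L env) (h0 : st.coins = 0) :
    ∀ k < 2 * (2 * m + 2) * (2 * m + 2),
      (sampleProg.run r inp env st).val 1 k = coinWord r (k * L) L := by
  have key := run_loop_induction (r := r) (inp := inp) (env := env) (x := 10) (b := 9)
    (st := st) (p := .seq (.set 1 (.reg 10) 0) (.loop 11 8
      (.seq (.flip 9 0) (.set 1 (.reg 10) (2 * arr 1 (.reg 10) + arr 9 0)))))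
    (fun k s => s.coins = k * L ∧ ∀ i < k, s.val 1 i = coinWord r (i * L) L)
    ⟨by rw [h0, zero_mul], by simp⟩ ?_
  · rw [h.reg9] at key
    exact key.2
  · intro k _ s _ ⟨hc, hs⟩
    have h' := h.update (x := 10) le_rfl k
    have key2 := run_loop_induction (r := r) (inp := inp) (env := Function.update env 10 k)
      (x := 11) (b := 8) (st := (Prog.set 1 (.reg 10) 0).run r inp (Function.update env 10 k) s)
      (p := .seq (.flip 9 0) (.set 1 (.reg 10) (2 * arr 1 (.reg 10) + arr 9 0)))
      (fun b s => s.coins = k * L + b ∧ s.val 1 k = coinWord r (k * L) b ∧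
        ∀ i < k, s.val 1 i = coinWord r (i * L) L) ?_ ?_
    · rw [h'.reg8] at key2
      refine ⟨by rw [run_seq, key2.1]; ring, fun i hi => ?_⟩
      rcases Nat.lt_succ_iff_lt_or_eq.1 hi with hi | rfl
      · exact key2.2.2 i hi
      · exact key2.2.1
    · refine ⟨hc, by simp [run_set_val, coinWord], fun i hi => ?_⟩
      rw [run_set_val, if_neg (by simp; omega), hs i hi]
    · intro b hb s _ ⟨hc, hk, hs⟩
      rw [h'.reg8] at hb
      have h'' := h'.update (x := 11) (by norm_num) b
      refine ⟨by rw [run_seq, run_set_coins, run_flip_coins, hc, add_assoc], ?_, fun i hi => ?_⟩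
      · simp only [run_seq, run_set_val, run_flip_val, eval_arr, Expr.eval_add, Expr.eval_mul,
          Expr.eval_ofNat, Expr.eval_reg, toState_reg, Nat.reduceLT, Nat.reduceEqDiff,
          OfNat.one_ne_ofNat, false_and, and_true, if_false, if_true, Function.update_apply, hk, hc]
        rw [← coinWord, h.mod' (coinWord_lt _ _ _)]
        have := h.pos
        nlinarith
      · simp [run_seq, run_set_val, run_flip_val, hs i hi, hi.ne]

/-- Filling a matrix row by row. -/
theorem run_loop_loop_set {x y b a : ℕ} {e : Expr} (hxy : x ≠ y) (hxb : b ≠ x) (hyb : b ≠ y)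
    (F : ℕ → ℕ → ℕ) (h : ∀ u < env b, ∀ v < env b, ∀ V : ℕ → ℕ → ℕ, (∀ j ≠ a, V j = st.val j) →
      e.eval (toState inp (Function.update (Function.update env x u) y v) V)
        % Function.update (Function.update env x u) y v 2 = F u v) :
    ∀ u < env b, ∀ v < env b, ((Prog.loop x b (.loop y b (.set a (.reg x * .reg b + .reg y) e))).run
      r inp env st).val a (u * env b + v) = F u v := by
  have key := run_loop_induction (r := r) (inp := inp) (env := env) (x := x) (b := b)
    (st := st) (p := .loop y b (.set a (.reg x * .reg b + .reg y) e))
    (fun k s => ∀ u < k, ∀ v < env b, s.val a (u * env b + v) = F u v) (by simp) ?_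
  · exact key
  · intro k hk s hf hs u hu v hv
    have hb : Function.update env x k b = env b := Function.update_of_ne hxb _ _
    have key2 := run_loop_induction (r := r) (inp := inp) (env := Function.update env x k)
      (x := y) (b := b) (st := s) (p := .set a (.reg x * .reg b + .reg y) e)
      (fun l s => (∀ u < k, ∀ v < env b, s.val a (u * env b + v) = F u v) ∧
        ∀ v < l, s.val a (k * env b + v) = F k v) ⟨hs, by simp⟩ ?_
    · rw [hb] at key2
      rcases Nat.lt_succ_iff_lt_or_eq.1 hu with hu | rfl
      · exact key2.1 u hu v hv
      · exact key2.2 v hv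
    · intro l hl s' hf' ⟨h1, h2⟩
      rw [hb] at hl
      have hidx : (Expr.reg x * .reg b + .reg y).eval
          (toState inp (Function.update (Function.update env x k) y l) s'.val)
          = k * env b + l := by
        simp [Function.update_of_ne hxy, Function.update_of_ne hyb, hb]
      have hval := h k hk l hl s'.val fun j hj => by
        rw [hf' j (by simpa [writes] using hj), hf j (by simpa [writes] using hj)]
      refine ⟨fun u hu v hv => ?_, fun v hv => ?_⟩
      · rw [run_set_val, hidx, if_neg, h1 u hu v hv]
        rintro ⟨-, e⟩
        have : (u + 1) * env b ≤ k * env b := Nat.mul_le_mul_right _ hu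
        rw [add_mul] at this
        omega
      · rw [run_set_val, hidx, hval]
        split_ifs with hc
        · rw [show v = l by omega]
        · exact h2 v (by omega)

/-- The weight of the edge from register `10` to register `11`. -/
def weightExpr (w : ℕ) (R : Expr) : Expr :=
  (1 - (1 - R)) * (1 - (1 - ((.reg 10 - .reg 11) + (.reg 11 - .reg 10)))) *
    arr 1 ((.const w * .reg 5 + (.reg 10 + (.reg 11 - .reg 10))) * .reg 5
      + (.reg 10 - (.reg 10 - .reg 11)))

/-- The matrix of weights of the relation `R`, in array `a`. -/
def fillProg (a w : ℕ) (R : Expr) : Prog :=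
  .loop 10 5 (.loop 11 5 (.set a (.reg 10 * .reg 5 + .reg 11) (weightExpr w R)))

theorem weightBits_lt {R : ℕ → ℕ → ℕ} {N w s : ℕ} {g : ℕ → ℕ} {u v : ℕ}
    (h : g (pairIndex N w u v) < 2 ^ s) : weightBits R N w g u v < 2 ^ s := by
  unfold weightBits
  refine lt_of_le_of_lt ?_ h
  have h1 : 1 - (1 - R u v) ≤ 1 := by omega
  have h2 : 1 - (1 - (u - v + (v - u))) ≤ 1 := by omega
  nlinarith [Nat.mul_le_mul h1 h2]

/-- The weights are read from array `1`, and the relation may depend on array `14`; hence `a` must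
be neither of them. -/
theorem run_fillProg (h : Params m L env) {a w : ℕ} (ha : 1 ≠ a) (ha' : 14 ≠ a) (hw : w < 2)
    {g : ℕ → ℕ} (hg : ∀ i, g i < 2 ^ L)
    (h1 : ∀ i < 2 * (2 * m + 2) * (2 * m + 2), st.val 1 i = g i) {R : Expr} {ρ : ℕ → ℕ → ℕ}
    (hR : ∀ u < 2 * m + 2, ∀ v < 2 * m + 2, ∀ V : ℕ → ℕ → ℕ, V 14 = st.val 14 →
      R.eval (toState inp (Function.update (Function.update env 10 u) 11 v) V) = ρ u v) :
    ∀ u < 2 * m + 2, ∀ v < 2 * m + 2,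
      ((fillProg a w R).run r inp env st).val a (u * (2 * m + 2) + v)
        = weightBits ρ (2 * m + 2) w g u v := by
  have key := run_loop_loop_set (r := r) (inp := inp) (st := st) (env := env) (x := 10) (y := 11)
    (b := 5) (a := a) (e := weightExpr w R) (by norm_num) (by norm_num) (by norm_num)
    (weightBits ρ (2 * m + 2) w g) ?_
  · rw [h.reg5] at key
    exact key
  · rw [h.reg5]
    intro u hu v hv V hV
    have h' := (h.update (x := 10) le_rfl u).update (x := 11) (by norm_num) v
    have e : (weightExpr w R).eval
        (toState inp (Function.update (Function.update env 10 u) 11 v) V)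
        = weightBits ρ (2 * m + 2) w g u v := by
      unfold weightBits
      rw [← h1 _ (pairIndex_lt hw hu hv), ← hR u hu v hv V (hV 14 ha'), ← hV 1 ha, pairIndex]
      simp only [weightExpr, Expr.eval_mul, Expr.eval_sub, Expr.eval_add, Expr.eval_ofNat,
        Expr.eval_const, Expr.eval_reg, eval_arr, toState_reg, h'.reg5, Function.update_apply,
        Nat.reduceEqDiff, Nat.reduceLT, if_true, if_false]
    rw [e, h'.mod' (weightBits_lt (hg _))]
    nlinarith

end RAM

/-! ### The matrix restricted by a cut -/

namespace RAM

open Prog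

variable {m L : ℕ} {r : ℕ → Bool} {inp env : ℕ → ℕ} {st : Store}

/-- The digit with index in register `11` of the number in register `10`. -/
def digitExpr : Expr := .reg 10 / arr 0 (.reg 11) % 3

/-- The values of `cutSide`, in array `7`. -/
def sideProg : Prog :=
  .seq (.set 7 0 0)
    (.loop 11 6 (.set 7 (.reg 11 + 1) ((arr 7 (.reg 11) + (1 - (digitExpr - 1))) % 2)))

theorem run_sideProg (h : Params m L env) (h0 : ∀ i ≤ m, st.val 0 i = 3 ^ i) :
    ∀ i ≤ m, (sideProg.run r inp env st).val 7 i = cutSide (env 10) i := by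
  have key := run_loop_induction (r := r) (inp := inp) (env := env) (x := 11) (b := 6)
    (st := (Prog.set 7 0 0).run r inp env st)
    (p := .set 7 (.reg 11 + 1) ((arr 7 (.reg 11) + (1 - (digitExpr - 1))) % 2))
    (fun k s => ∀ i ≤ k, s.val 7 i = cutSide (env 10) i) ?_ ?_
  · rw [h.reg6] at key
    exact key
  · intro i hi
    obtain rfl : i = 0 := by omega
    simp [run_set_val, cutSide]
  · intro k hk s hf hs i hi
    have h' := h.update (x := 11) (by norm_num) k
    rw [h.reg6] at hk
    have h3 : s.val 0 k = 3 ^ k := by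
      rw [hf 0 (by simp [writes]), run_set_val, if_neg (by simp), h0 k hk.le]
    simp only [run_set_val, Expr.eval_add, Expr.eval_sub, Expr.eval_mod, Expr.eval_div,
      digitExpr, Expr.eval_ofNat, eval_arr, Nat.reduceLT, Expr.eval_reg, toState_reg,
      Function.update_apply, Nat.reduceEqDiff, if_true, if_false, true_and, h3, hs k le_rfl]
    split_ifs with hi'
    · rw [h.mod_two (Nat.mod_lt _ two_pos), hi', cutSide]
    · exact hs i (by omega)

/-- The values of `cutVertex`, in array `8`. -/
def vertexProg : Prog :=
  .seq (.set 8 0 0) (.seq (.set 8 (.reg 6 + .reg 6 + 1) (arr 7 (.reg 6)))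
    (.loop 11 6 (.seq
      (.set 8 (.reg 11 + .reg 11 + 1) ((arr 7 (.reg 11) + digitExpr % 2) % 2))
      (.set 8 (.reg 11 + .reg 11 + 2) ((arr 7 (.reg 11) + (1 - digitExpr)) % 2)))))

theorem run_vertexProg (h : Params m L env) (h0 : ∀ i ≤ m, st.val 0 i = 3 ^ i)
    (h7 : ∀ i ≤ m, st.val 7 i = cutSide (env 10) i) :
    ∀ v < 2 * m + 2, (vertexProg.run r inp env st).val 8 v = cutVertex m (env 10) v := by
  have key := run_loop_induction (r := r) (inp := inp) (env := env) (x := 11) (b := 6)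
    (st := (Prog.set 8 (.reg 6 + .reg 6 + 1) (arr 7 (.reg 6))).run r inp env
      ((Prog.set 8 0 0).run r inp env st))
    (p := .seq (.set 8 (.reg 11 + .reg 11 + 1) ((arr 7 (.reg 11) + digitExpr % 2) % 2))
      (.set 8 (.reg 11 + .reg 11 + 2) ((arr 7 (.reg 11) + (1 - digitExpr)) % 2)))
    (fun k s => s.val 8 (2 * m + 1) = cutVertex m (env 10) (2 * m + 1) ∧
      ∀ v < 2 * k + 1, s.val 8 v = cutVertex m (env 10) v) ?_ ?_
  · rw [h.reg6] at key
    intro v hv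
    rcases Nat.lt_succ_iff_lt_or_eq.1 hv with hv | rfl
    · exact key.2 v hv
    · exact key.1
  · have h7m := h7 m le_rfl
    constructor
    · simp only [run_set_val, Expr.eval_add, Expr.eval_ofNat, Expr.eval_reg, toState_reg, h.reg6,
        eval_arr, Nat.reduceLT, Nat.reduceEqDiff, true_and, false_and, if_false]
      rw [if_pos (by ring), h7m, cutVertex_last, h.mod_two (cutSide_lt_two _ _)]
    · intro v hv
      obtain rfl : v = 0 := by omega
      simp [run_set_val, cutVertex_zero]
  · intro k hk s hf ⟨hl, hs⟩
    have h' := h.update (x := 11) (by norm_num) k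
    rw [h.reg6] at hk
    have h3 : s.val 0 k = 3 ^ k := by
      rw [hf 0 (by simp [writes]), run_set_val, if_neg (by simp), run_set_val, if_neg (by simp),
        h0 k hk.le]
    have h4 : s.val 7 k = cutSide (env 10) k := by
      rw [hf 7 (by simp [writes]), run_set_val, if_neg (by simp), run_set_val, if_neg (by simp),
        h7 k hk.le]
    have e : ∀ v, ((Prog.seq (.set 8 (.reg 11 + .reg 11 + 1) ((arr 7 (.reg 11) + digitExpr % 2) % 2))
        (.set 8 (.reg 11 + .reg 11 + 2) ((arr 7 (.reg 11) + (1 - digitExpr)) % 2))).run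
        r inp (Function.update env 11 k) s).val 8 v
        = if v = k + k + 2 then cutSnd (env 10) k else if v = k + k + 1 then cutFst (env 10) k
          else s.val 8 v := by
      intro v
      simp only [run_seq, run_set_val, Expr.eval_add, Expr.eval_sub, Expr.eval_mod, Expr.eval_div,
        digitExpr, Expr.eval_ofNat, eval_arr, Nat.reduceLT, Expr.eval_reg, toState_reg,
        Function.update_apply, Nat.reduceEqDiff, if_true, if_false, true_and, false_and, h3, h4]
      rw [h.mod_two (Nat.mod_lt _ two_pos), h.mod_two (Nat.mod_lt _ two_pos), cutSnd, cutFst]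
    constructor
    · rw [e, if_neg (by omega), if_neg (by omega), hl]
    · intro v hv
      rw [e]
      split_ifs with h1 h2
      · rw [h1, ← two_mul, cutVertex_even m hk]
      · rw [h2, ← two_mul, cutVertex_odd m hk]
      · exact hs v (by omega)

/-- The matrix in array `a`, restricted by the cut, in array `6`. -/
def cutProg (a : ℕ) : Prog :=
  .loop 11 5 (.loop 12 5 (.set 6 (.reg 11 * .reg 5 + .reg 12)
    (arr a (.reg 11 * .reg 5 + .reg 12) * (1 - (arr 8 (.reg 11) ^^^ arr 8 (.reg 12))))))

theorem mul_one_sub_le (a b : ℕ) : a * (1 - b) ≤ a :=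
  (Nat.mul_le_mul_left a (Nat.sub_le 1 b)).trans_eq (mul_one a)

theorem run_cutProg (h : Params m L env) {a : ℕ} (ha : a < 6) {A : ℕ → ℕ → ℕ}
    (hA : ∀ u < 2 * m + 2, ∀ v < 2 * m + 2, A u v < 2 ^ L)
    (hst : ∀ u < 2 * m + 2, ∀ v < 2 * m + 2, st.val a (u * (2 * m + 2) + v) = A u v)
    (h8 : ∀ v < 2 * m + 2, st.val 8 v = cutVertex m (env 10) v) :
    ∀ u < 2 * m + 2, ∀ v < 2 * m + 2,
      ((cutProg a).run r inp env st).val 6 (u * (2 * m + 2) + v) = cutBits m A (env 10) u v := by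
  have key := run_loop_loop_set (r := r) (inp := inp) (st := st) (env := env) (x := 11) (y := 12)
    (b := 5) (a := 6) (e := arr a (.reg 11 * .reg 5 + .reg 12)
      * (1 - (arr 8 (.reg 11) ^^^ arr 8 (.reg 12)))) (by norm_num) (by norm_num) (by norm_num)
    (cutBits m A (env 10)) ?_
  · rw [h.reg5] at key
    exact key
  · rw [h.reg5]
    intro u hu v hv V hV
    have h' := (h.update (x := 11) (by norm_num) u).update (x := 12) (by norm_num) v
    simp only [Expr.eval_mul, Expr.eval_sub, Expr.eval_add, Expr.eval_ofNat, Expr.eval_xor,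
      Expr.eval_reg, eval_arr, toState_reg, h'.reg5, eval_arr _ _ _ (show a < 16 by omega),
      Nat.reduceLT, Function.update_apply, Nat.reduceEqDiff, if_true, if_false]
    rw [hV a (by omega), hV 8 (by norm_num), h8 u hu, h8 v hv, hst u hu v hv]
    refine h.mod' (k := L) (lt_of_le_of_lt (mul_one_sub_le _ _) (hA u hu v hv)) ?_
    nlinarith

end RAM

/-! ### One entry of the recursion for closed ordered walks -/

namespace RAM

open Prog

variable {m L : ℕ} {r : ℕ → Bool} {inp env : ℕ → ℕ} {st : Store}

/-- The entry with indices `p`, `i`, `j` in array `6`. -/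
def layer (p i j : Expr) : Expr := arr 6 ((p * .reg 5 + i) * .reg 5 + j)

theorem eval_layer (V : ℕ → ℕ → ℕ) (p i j : Expr) : (layer p i j).eval (toState inp env V)
    = V 6 ((p.eval (toState inp env V) * env 5 + i.eval (toState inp env V)) * env 5
      + j.eval (toState inp env V)) :=
  eval_arr _ _ _ (by norm_num) _

/-- The sum over the diagonal in the recursion of `clowBits`. -/
def diagProg : Prog :=
  .seq (.set 9 0 0) (.loop 13 5 (.set 9 0 (arr 9 0 ^^^
    layer (.reg 11) (.reg 13) (.reg 13) * (1 - (1 - (.reg 13 - .reg 12))))))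

theorem run_diagProg (h : Params m L env) {F : ℕ → ℕ}
    (hst : ∀ l < 2 * m + 2,
      st.val 6 ((env 11 * (2 * m + 2) + l) * (2 * m + 2) + l) = F l)
    (hF : ∀ l < 2 * m + 2, F l < 2 ^ ((2 * m + 3) * L)) :
    (diagProg.run r inp env st).val 9 0
      = xorSum (fun l => F l * (1 - (1 - (l - env 12)))) (2 * m + 2) := by
  have key := run_loop_induction (r := r) (inp := inp) (env := env) (x := 13) (b := 5)
    (st := (Prog.set 9 0 0).run r inp env st)
    (p := .set 9 0 (arr 9 0 ^^^
      layer (.reg 11) (.reg 13) (.reg 13) * (1 - (1 - (.reg 13 - .reg 12)))))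
    (fun k s => s.val 9 0 = xorSum (fun l => F l * (1 - (1 - (l - env 12)))) k) ?_ ?_
  · rw [h.reg5] at key
    exact key
  · simp [run_set_val, xorSum]
  · intro k hk s hf hs
    rw [h.reg5] at hk
    have h6 : s.val 6 = st.val 6 := by
      rw [hf 6 (by simp [writes]), run_val_of_notMem (by simp [writes])]
    simp only [run_set_val, eval_layer, eval_arr, Expr.eval_xor, Expr.eval_mul, Expr.eval_sub,
      Expr.eval_ofNat, Expr.eval_reg, toState_reg, Nat.reduceLT, Function.update_apply,
      Nat.reduceEqDiff, and_self, if_true, if_false, h6, h.reg5, hst k hk, hs]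
    rw [xorSum, h.mod' (k := (2 * m + 3) * L) _ (by omega)]
    exact Nat.xor_lt_two_pow (xorSum_lt fun l hl => (mul_sub_le _ _ _).trans_lt (hF l (by omega)))
      ((mul_sub_le _ _ _).trans_lt (hF k hk))

/-- One term of the sum in `cellProg`. -/
def termProg : Prog :=
  .seq (.set 11 0 (layer (.reg 11) (.reg 12) (.reg 14) * (1 - (1 - (.reg 14 - .reg 12)))))
    (.seq (.set 12 0 (arr 6 (.reg 14 * .reg 5 + .reg 13)))
      (.seq mulProg (.set 13 0 (arr 13 0 ^^^ arr 10 0))))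

/-- One entry of the next layer. -/
def cellProg : Prog :=
  .seq (.seq (.set 11 0 (arr 9 0)) (.seq (.set 12 0 (arr 6 (.reg 12 * .reg 5 + .reg 13)))
    (.seq mulProg (.set 13 0 (arr 10 0)))))
    (.seq (.loop 14 5 termProg)
      (.set 6 (((.reg 11 + 1) * .reg 5 + .reg 12) * .reg 5 + .reg 13) (arr 13 0)))

theorem writes_mulProg : mulProg.writes = [10, 10, 11, 12] := rfl

theorem run_termProg (h : Params m L env) {x y s : ℕ}
    (hx : st.val 6 ((env 11 * (2 * m + 2) + env 12) * (2 * m + 2) + env 14) = x)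
    (hxlt : x < 2 ^ ((2 * m + 3) * L))
    (hy : st.val 6 (env 14 * (2 * m + 2) + env 13) = y) (hylt : y < 2 ^ ((2 * m + 3) * L))
    (hs : st.val 13 0 = s) (hslt : s < 2 ^ (2 * ((2 * m + 3) * L))) :
    (termProg.run r inp env st).val 13 0
      = s ^^^ clMul (x * (1 - (1 - (env 14 - env 12)))) y := by
  have hx' : x * (1 - (1 - (env 14 - env 12))) < 2 ^ ((2 * m + 3) * L) :=
    (mul_sub_le _ _ _).trans_lt hxlt
  rw [termProg, run_seq, run_seq, run_seq]
  set st₁ := (Prog.set 11 0 (layer (.reg 11) (.reg 12) (.reg 14)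
    * (1 - (1 - (.reg 14 - .reg 12))))).run r inp env st with hst₁
  set st₂ := (Prog.set 12 0 (arr 6 (.reg 14 * .reg 5 + .reg 13))).run r inp env st₁ with hst₂
  have h11 : st₂.val 11 0 = x * (1 - (1 - (env 14 - env 12))) := by
    rw [hst₂, run_val_of_notMem (by simp [writes]), hst₁]
    simp only [run_set_val, eval_layer, Expr.eval_mul, Expr.eval_sub, Expr.eval_ofNat,
      Expr.eval_reg, toState_reg, and_self, if_true, h.reg5, hx]
    exact h.mod' hx' (by omega)
  have h12 : st₂.val 12 0 = y := by
    rw [hst₂]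
    simp only [run_set_val, eval_arr, Expr.eval_mul, Expr.eval_add, Expr.eval_ofNat,
      Expr.eval_reg, toState_reg, and_self, if_true, h.reg5, Nat.reduceLT]
    rw [hst₁, run_val_of_notMem (by simp [writes]), hy, h.mod' hylt (by omega)]
  have h10 := run_mulProg (r := r) (inp := inp) h (h11 ▸ hx') (h12 ▸ hylt)
  have h13 : (mulProg.run r inp env st₂).val 13 0 = s := by
    rw [run_val_of_notMem (by simp [writes_mulProg]), hst₂, run_val_of_notMem (by simp [writes]),
      hst₁, run_val_of_notMem (by simp [writes]), hs]
  simp only [run_set_val, eval_arr, Expr.eval_xor, Expr.eval_ofNat, Nat.reduceLT, and_self,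
    if_true, h10, h13, h11, h12]
  refine h.mod' (Nat.xor_lt_two_pow hslt ?_) (by omega)
  rw [two_mul]
  exact clMul_lt hx' hylt

theorem run_cellProg (h : Params m L env) (h12 : env 12 < 2 * m + 2) (h13 : env 13 < 2 * m + 2)
    {A : ℕ → ℕ → ℕ} {X : ℕ → ℕ} {d : ℕ} (h9 : st.val 9 0 = d) (hd : d < 2 ^ ((2 * m + 3) * L))
    (hA : ∀ i < 2 * m + 2, ∀ j < 2 * m + 2, st.val 6 (i * (2 * m + 2) + j) = A i j)
    (hAlt : ∀ i < 2 * m + 2, ∀ j < 2 * m + 2, A i j < 2 ^ ((2 * m + 3) * L))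
    (hX : ∀ k < 2 * m + 2, st.val 6 ((env 11 * (2 * m + 2) + env 12) * (2 * m + 2) + k) = X k)
    (hXlt : ∀ k < 2 * m + 2, X k < 2 ^ ((2 * m + 3) * L)) (i : ℕ) :
    (cellProg.run r inp env st).val 6 i
      = if i = ((env 11 + 1) * (2 * m + 2) + env 12) * (2 * m + 2) + env 13 then
        clMul d (A (env 12) (env 13)) ^^^
          xorSum (fun k => clMul (X k * (1 - (1 - (k - env 12)))) (A k (env 13))) (2 * m + 2)
        else st.val 6 i := by
  set T := (2 * m + 3) * L with hT
  -- Products of two entries have at most `2 * T` bits, and so have all partial sums. That a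
  -- finished entry is short enough to be a factor again is known from `clowBits_lt`, not from this
  -- computation.
  have hslt : ∀ k ≤ 2 * m + 2, clMul d (A (env 12) (env 13)) ^^^
      xorSum (fun k => clMul (X k * (1 - (1 - (k - env 12)))) (A k (env 13))) k < 2 ^ (2 * T) := by
    intro k hk
    rw [two_mul]
    refine Nat.xor_lt_two_pow (clMul_lt hd (hAlt _ h12 _ h13)) (xorSum_lt fun l hl => ?_)
    exact clMul_lt ((mul_sub_le _ _ _).trans_lt (hXlt l (by omega))) (hAlt l (by omega) _ h13)
  rw [cellProg, run_seq, run_seq]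
  set st₁ := (Prog.seq (.set 11 0 (arr 9 0)) (.seq (.set 12 0 (arr 6 (.reg 12 * .reg 5 + .reg 13)))
    (.seq mulProg (.set 13 0 (arr 10 0))))).run r inp env st with hst₁
  have h6 : st₁.val 6 = st.val 6 := run_val_of_notMem (by simp [writes, writes_mulProg])
  have h13' : st₁.val 13 0 = clMul d (A (env 12) (env 13)) := by
    rw [hst₁, run_seq, run_seq, run_seq]
    set st₂ := (Prog.set 11 0 (arr 9 0)).run r inp env st with hst₂
    set st₃ := (Prog.set 12 0 (arr 6 (.reg 12 * .reg 5 + .reg 13))).run r inp env st₂ with hst₃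
    have e11 : st₃.val 11 0 = d := by
      rw [hst₃, run_val_of_notMem (by simp [writes]), hst₂]
      simp only [run_set_val, eval_arr, Expr.eval_ofNat, Nat.reduceLT, and_self, if_true, h9]
      exact h.mod' hd (by omega)
    have e12 : st₃.val 12 0 = A (env 12) (env 13) := by
      rw [hst₃]
      simp only [run_set_val, eval_arr, Expr.eval_mul, Expr.eval_add, Expr.eval_ofNat,
        Expr.eval_reg, toState_reg, and_self, if_true, h.reg5, Nat.reduceLT]
      rw [hst₂, run_val_of_notMem (by simp [writes]), hA _ h12 _ h13,
        h.mod' (hAlt _ h12 _ h13) (by omega)]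
    have e10 := run_mulProg (r := r) (inp := inp) (st := st₃) h (by rwa [e11])
      (by rw [e12]; exact hAlt _ h12 _ h13)
    simp only [run_set_val, eval_arr, Expr.eval_ofNat, Nat.reduceLT, and_self, if_true, e10,
      e11, e12]
    have := hslt 0 (Nat.zero_le _)
    rw [xorSum, Nat.xor_zero] at this
    exact h.mod' this (by omega)
  have key := run_loop_induction (r := r) (inp := inp) (env := env) (x := 14) (b := 5)
    (st := st₁) (p := termProg) (fun k s => s.val 13 0 = clMul d (A (env 12) (env 13)) ^^^
      xorSum (fun k => clMul (X k * (1 - (1 - (k - env 12)))) (A k (env 13))) k)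
    (by rw [h13', xorSum, Nat.xor_zero]) ?_
  · have hf : (run r inp (loop 14 5 termProg) env st₁).val 6 = st.val 6 := by
      rw [run_val_of_notMem (by simp [writes, termProg, writes_mulProg]), h6]
    rw [h.reg5] at key
    simp only [run_set_val, eval_arr, Expr.eval_mul, Expr.eval_add, Expr.eval_ofNat,
      Expr.eval_reg, toState_reg, true_and, h.reg5, Nat.reduceLT, key, hf]
    rw [h.mod' (hslt _ le_rfl) (by omega)]
  · intro k hk s hf hs
    rw [h.reg5] at hk
    have h' := h.update (x := 14) (by norm_num) k
    have e6 : s.val 6 = st.val 6 := by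
      rw [hf 6 (by simp [writes, termProg, writes_mulProg]), h6]
    have := run_termProg (r := r) (inp := inp) (st := s) h' (x := X k) (y := A k (env 13))
      (s := clMul d (A (env 12) (env 13)) ^^^
        xorSum (fun k => clMul (X k * (1 - (1 - (k - env 12)))) (A k (env 13))) k)
      (by simpa [e6, Function.update_apply] using hX k hk) (hXlt k hk)
      (by simpa [e6, Function.update_apply] using hA k hk _ h13) (hAlt k hk _ h13) hs
      (hslt k hk.le)
    rw [this, xorSum, Nat.xor_assoc]
    simp

end RAM

/-! ### All layers of the recursion, and the tables of determinants -/

namespace RAM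

open Prog

variable {m L : ℕ} {r : ℕ → Bool} {inp env : ℕ → ℕ} {st : Store}

/-- All layers of the recursion of `clowBits`. -/
def layersProg : Prog := .loop 11 5 (.loop 12 5 (.seq diagProg (.loop 13 5 cellProg)))

theorem writes_cellProg :
    cellProg.writes = [11, 12, 10, 10, 11, 12, 13, 11, 12, 10, 10, 11, 12, 13, 6] := rfl

theorem writes_diagProg : diagProg.writes = [9, 9] := rfl

theorem layer_index_lt {N p i k j : ℕ} (hk : k < N) :
    (p * N + i) * N + k < ((p + 1) * N + i) * N + j := by
  have : (p * N + i + 1) * N ≤ ((p + 1) * N + i) * N := Nat.mul_le_mul_right _ (by nlinarith)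
  rw [add_mul _ 1, one_mul] at this
  omega

theorem layer_index {N p i j : ℕ} (hi : i < N) (hj : j < N) {K : ℕ}
    (h : K = (p * N + i) * N + j) : K / N / N = p ∧ K / N % N = i ∧ K % N = j := by
  have h1 : K / N = p * N + i := by
    rw [h, mul_comm, Nat.mul_add_div (by omega), Nat.div_eq_of_lt hj, add_zero]
  have h2 : K % N = j := by rw [h, mul_comm, Nat.mul_add_mod, Nat.mod_eq_of_lt hj]
  refine ⟨?_, ?_, h2⟩
  · rw [h1, mul_comm, Nat.mul_add_div (by omega), Nat.div_eq_of_lt hi, add_zero]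
  · rw [h1, mul_comm, Nat.mul_add_mod, Nat.mod_eq_of_lt hi]

/-- Addresses `(p * N + i) * N + j` are filled in increasing order, and an entry depends only on the
preceding layer and on layer zero, the matrix itself. So "all addresses below `K` are correct" is an
invariant shared by the three nested loops. -/
theorem run_layersProg (h : Params m L env) {A : ℕ → ℕ → ℕ}
    (hst : ∀ i < 2 * m + 2, ∀ j < 2 * m + 2, st.val 6 (i * (2 * m + 2) + j) = A i j)
    (hA : ∀ i < 2 * m + 2, ∀ j < 2 * m + 2, A i j < 2 ^ L) :
    ∀ p < 2 * m + 2, ∀ i < 2 * m + 2, ∀ j < 2 * m + 2,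
      (layersProg.run r inp env st).val 6 ((p * (2 * m + 2) + i) * (2 * m + 2) + j)
        = clowBits A (2 * m + 2) p i j := by
  set N := 2 * m + 2 with hN
  have hNpos : 0 < N := by omega
  -- The loop fills the layers `1` to `N`, one more than the determinant needs. Entries of layer `N`
  -- have degree `N + 1 = 2 * m + 3` in the matrix entries, which is where the length `(2 * m + 3) *
  -- L` comes from.
  have hle : ∀ p < N + 1, (p + 1) * L ≤ (2 * m + 3) * L := fun p hp =>
    Nat.mul_le_mul_right _ (by omega)
  have hlt : ∀ p < N + 1, ∀ i < N, ∀ j < N, clowBits A N p i j < 2 ^ ((2 * m + 3) * L) :=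
    fun p hp i hi j hj =>
      (clowBits_lt hA p i hi j hj).trans_le (Nat.pow_le_pow_right two_pos (hle p hp))
  let I : ℕ → Store → Prop := fun K s => ∀ p i j, i < N → j < N → (p * N + i) * N + j < K →
    s.val 6 ((p * N + i) * N + j) = clowBits A N p i j
  have key := run_loop_induction (r := r) (inp := inp) (env := env) (x := 11) (b := 5)
    (st := st) (p := .loop 12 5 (.seq diagProg (.loop 13 5 cellProg)))
    (fun k s => I (((k + 1) * N + 0) * N + 0) s) ?_ ?_
  · intro p hp i hi j hj
    rw [h.reg5, ← hN] at key
    refine key p i j hi hj ((layer_index_lt (j := 0) hj).trans_le ?_)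
    nlinarith [Nat.mul_le_mul_right N (show (p + 1) * N + i ≤ (N + 1) * N by nlinarith)]
  · intro p i j hi hj hlt
    obtain rfl : p = 0 := by
      by_contra hp
      have : 1 * N ≤ p * N := Nat.mul_le_mul_right _ (by omega)
      nlinarith [Nat.mul_le_mul_right N (show N ≤ p * N + i by omega)]
    rw [zero_mul, zero_add, hst i hi j hj, clowBits]
  · intro p hp s _ hs
    rw [h.reg5] at hp
    have h' := h.update (x := 11) (by norm_num) p
    have key2 := run_loop_induction (r := r) (inp := inp) (env := Function.update env 11 p) (x := 12)
      (b := 5) (st := s) (p := .seq diagProg (.loop 13 5 cellProg))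
      (fun k s => I (((p + 1) * N + k) * N + 0) s) hs ?_
    · rw [h'.reg5] at key2
      refine (show (((p + 1 + 1) * N + 0) * N + 0) = ((p + 1) * N + N) * N + 0 by ring) ▸ key2
    · intro i hi s _ hs
      rw [h'.reg5] at hi
      have h'' := h'.update (x := 12) (by norm_num) i
      have hd := run_diagProg (r := r) (inp := inp) (st := s) h''
        (F := fun l => clowBits A N p l l)
        (fun l hl => by
          have := hs p l l hl hl (by
            have : (p * N + l + 1) * N ≤ ((p + 1) * N + i) * N :=
              Nat.mul_le_mul_right _ (by nlinarith)
            nlinarith)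
          simpa [Function.update_apply] using this)
        (fun l hl => hlt p (by omega) l hl l hl)
      have hi' : Function.update (Function.update env 11 p) 12 i 12 = i := Function.update_self _ _ _
      rw [hi'] at hd
      have hdlt : xorSum (fun l => clowBits A N p l l * (1 - (1 - (l - i)))) N
          < 2 ^ ((2 * m + 3) * L) :=
        xorSum_lt fun l hl => (mul_sub_le _ _ _).trans_lt (hlt p (by omega) l hl l hl)
      have key3 := run_loop_induction (r := r) (inp := inp)
        (env := Function.update (Function.update env 11 p) 12 i) (x := 13)
        (b := 5) (st := diagProg.run r inp (Function.update (Function.update env 11 p) 12 i) s)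
        (p := cellProg)
        (fun k s => I (((p + 1) * N + i) * N + k) s) ?_ ?_
      · rw [h''.reg5] at key3
        refine (show (((p + 1) * N + (i + 1)) * N + 0) = ((p + 1) * N + i) * N + N by ring) ▸ key3
      · intro q i' j' hi' hj' hq
        rw [run_val_of_notMem (by simp [writes_diagProg])]
        exact hs q i' j' hi' hj' hq
      · intro j hj s' hf hs'
        rw [h''.reg5] at hj
        have h3 := h''.update (x := 13) (by norm_num) j
        have hc := run_cellProg (r := r) (inp := inp) (st := s') h3
          (by simpa [Function.update_apply] using hi) (by simpa [Function.update_apply] using hj)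
          (A := A) (X := fun k => clowBits A N p i k)
          (by rw [hf 9 (by simp [writes_cellProg]), hd]) hdlt
          (fun i' hi' j' hj' => by
            have := hs' 0 i' j' hi' hj' (by
              have : (i' + 1) * N ≤ ((p + 1) * N + i) * N := Nat.mul_le_mul_right _ (by nlinarith)
              nlinarith)
            rwa [zero_mul, zero_add] at this)
          (fun i' hi' j' hj' => hlt 0 (by omega) i' hi' j' hj')
          (fun k hk => by
            simpa [Function.update_apply] using hs' p i k hi hk (layer_index_lt hk))
          (fun k hk => hlt p (by omega) i hi k hk)
        simp only [Function.update_apply, Nat.reduceEqDiff, if_true, if_false, ← hN] at hc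
        intro q i' j' hi' hj' hq
        simp only [hc]
        split_ifs with he
        · obtain ⟨e1, e2, e3⟩ := layer_index hi' hj' (Eq.refl ((q * N + i') * N + j'))
          obtain ⟨e4, e5, e6⟩ := layer_index hi hj he
          rw [show q = p + 1 from e1.symm.trans e4, show i' = i from e2.symm.trans e5,
            show j' = j from e3.symm.trans e6, clowBits]
        · exact hs' q i' j' hi' hj' (by omega)

/-- The determinant, from the last layer, in cell `t` of array `d`. -/
def detProg (d : ℕ) : Prog :=
  .seq (.set 13 0 0) (.seq
    (.loop 11 5 (.set 13 0 (arr 13 0 ^^^ layer (.reg 5 - 1) (.reg 11) (.reg 11))))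
    (.set d (.reg 10) (arr 13 0)))

theorem run_detProg (h : Params m L env) {d : ℕ} {F : ℕ → ℕ}
    (hst : ∀ l < 2 * m + 2, st.val 6 (((2 * m + 1) * (2 * m + 2) + l) * (2 * m + 2) + l) = F l)
    (hF : ∀ l < 2 * m + 2, F l < 2 ^ ((2 * m + 3) * L)) (hd : d < 6) (i : ℕ) :
    ((detProg d).run r inp env st).val d i
      = if i = env 10 then xorSum F (2 * m + 2) else st.val d i := by
  have key := run_loop_induction (r := r) (inp := inp) (env := env) (x := 11) (b := 5)
    (st := (Prog.set 13 0 0).run r inp env st)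
    (p := .set 13 0 (arr 13 0 ^^^ layer (.reg 5 - 1) (.reg 11) (.reg 11)))
    (fun k s => s.val 13 0 = xorSum F k) ?_ ?_
  · rw [h.reg5] at key
    rw [detProg, run_seq, run_seq]
    simp only [run_set_val, eval_arr, Expr.eval_ofNat, Expr.eval_reg, toState_reg, Nat.reduceLT,
      true_and, key]
    rw [h.mod' (xorSum_lt hF) (by omega), run_val_of_notMem (by simp [writes]; omega),
      run_val_of_notMem (by simp [writes]; omega)]
  · simp [run_set_val, xorSum]
  · intro k hk s hf hs
    rw [h.reg5] at hk
    have h6 : s.val 6 = st.val 6 := by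
      rw [hf 6 (by simp [writes]), run_val_of_notMem (by simp [writes])]
    simp only [run_set_val, eval_layer, eval_arr, Expr.eval_xor, Expr.eval_sub,
      Expr.eval_ofNat, Expr.eval_reg, toState_reg, Nat.reduceLT, Function.update_apply,
      Nat.reduceEqDiff, and_self, if_true, if_false, h6, h.reg5, hst k hk, hs,
      Nat.add_one_sub_one]
    rw [xorSum, h.mod' (k := (2 * m + 3) * L) _ (by omega)]
    exact Nat.xor_lt_two_pow (xorSum_lt fun l hl => hF l (by omega)) (hF k hk)

/-- The determinants of the matrix in array `a` for all cuts, in array `d`. -/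
def tableProg (a d : ℕ) : Prog :=
  .loop 10 4 (.seq sideProg (.seq vertexProg (.seq (cutProg a) (.seq layersProg (detProg d)))))

theorem writes_layersProg :
    layersProg.writes = [9, 9, 11, 12, 10, 10, 11, 12, 13, 11, 12, 10, 10, 11, 12, 13, 6] := rfl

theorem writes_tableProg (a d : ℕ) : (tableProg a d).writes = [7, 7, 8, 8, 8, 8, 6, 9, 9, 11, 12,
    10, 10, 11, 12, 13, 11, 12, 10, 10, 11, 12, 13, 6, 13, 13, d] := rfl

theorem detBits_lt {A : ℕ → ℕ → ℕ} (hA : ∀ i < 2 * m + 2, ∀ j < 2 * m + 2, A i j < 2 ^ L) (t : ℕ) :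
    detBits m A t < 2 ^ ((2 * m + 3) * L) := by
  refine xorSum_lt fun l hl => ?_
  refine (clowBits_lt (s := L) (fun i hi j hj => ?_) _ l hl l hl).trans_le
    (Nat.pow_le_pow_right two_pos (Nat.mul_le_mul_right _ (by omega)))
  exact (mul_one_sub_le _ _).trans_lt (hA i hi j hj)

theorem run_tableProg (h : Params m L env) {a d : ℕ} (ha : a < 6) (hd0 : d ≠ 0)
    (hd : d < 6) (had : a ≠ d)
    {A : ℕ → ℕ → ℕ} (hA : ∀ i < 2 * m + 2, ∀ j < 2 * m + 2, A i j < 2 ^ L)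
    (h0 : ∀ i ≤ m, st.val 0 i = 3 ^ i)
    (hst : ∀ u < 2 * m + 2, ∀ v < 2 * m + 2, st.val a (u * (2 * m + 2) + v) = A u v) :
    ∀ t < 3 ^ m, ((tableProg a d).run r inp env st).val d t = detBits m A t := by
  have key := run_loop_induction (r := r) (inp := inp) (env := env) (x := 10) (b := 4) (st := st)
    (p := .seq sideProg (.seq vertexProg (.seq (cutProg a) (.seq layersProg (detProg d)))))
    (fun k s => ∀ t < k, s.val d t = detBits m A t) (by simp) ?_
  · rw [h.reg4] at key
    exact key
  · intro k hk s hf hs t ht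
    have hw := writes_tableProg a d
    have h' := h.update (x := 10) le_rfl k
    have hk' : Function.update env 10 k 10 = k := Function.update_self _ _ _
    have f0 : s.val 0 = st.val 0 := hf 0 (show 0 ∉ (tableProg a d).writes by
      rw [hw]; simp [hd0.symm])
    have fa : s.val a = st.val a := hf a (show a ∉ (tableProg a d).writes by
      rw [hw]; simp; omega)
    rw [run_seq, run_seq, run_seq, run_seq]
    set s₁ := sideProg.run r inp (Function.update env 10 k) s with hs₁
    have g0 : ∀ i ≤ m, s₁.val 0 i = 3 ^ i := by
      rw [hs₁, run_val_of_notMem (by simp [sideProg, writes]), f0]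
      exact h0
    have g7 := run_sideProg (r := r) (inp := inp) (st := s) h' (by rwa [f0])
    set s₂ := vertexProg.run r inp (Function.update env 10 k) s₁ with hs₂
    have g8 := run_vertexProg (r := r) (inp := inp) (st := s₁) h' g0 g7
    set s₃ := (cutProg a).run r inp (Function.update env 10 k) s₂ with hs₃
    have ga : s₂.val a = st.val a := by
      rw [hs₂, run_val_of_notMem (by simp [vertexProg, writes]; omega), hs₁,
        run_val_of_notMem (by simp [sideProg, writes]; omega), fa]
    have g6 := run_cutProg (r := r) (inp := inp) (st := s₂) h' ha hA (by rwa [ga]) g8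
    rw [← hs₃, hk'] at g6
    set s₄ := layersProg.run r inp (Function.update env 10 k) s₃ with hs₄
    have hcut : ∀ i < 2 * m + 2, ∀ j < 2 * m + 2, cutBits m A k i j < 2 ^ L :=
      fun i hi j hj => (mul_one_sub_le _ _).trans_lt (hA i hi j hj)
    have gl := run_layersProg (r := r) (inp := inp) (st := s₃) h' g6 hcut
    have gd := run_detProg (r := r) (inp := inp) (st := s₄) h' (d := d)
      (F := fun l => clowBits (cutBits m A k) (2 * m + 2) (2 * m + 1) l l)
      (fun l hl => gl (2 * m + 1) (by omega) l hl l hl)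
      (fun l hl => (clowBits_lt hcut _ l hl l hl).trans_le
        (Nat.pow_le_pow_right two_pos (Nat.mul_le_mul_right _ (by omega)))) hd t
    have gs : s₄.val d = s.val d := by
      rw [hs₄, run_val_of_notMem (by simp [writes_layersProg]; omega), hs₃,
        run_val_of_notMem (by simp [cutProg, writes]; omega), hs₂,
        run_val_of_notMem (by simp [vertexProg, writes]; omega), hs₁,
        run_val_of_notMem (by simp [sideProg, writes]; omega)]
    rw [gd, hk', gs]
    split_ifs with he
    · rw [he, detBits]
    · exact hs t (by omega)

end RAM

/-! ### The transform, the final sum and the complete program -/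

namespace RAM

open Prog

variable {m L : ℕ} {r : ℕ → Bool} {inp env : ℕ → ℕ} {st : Store}

/-- The number in register `11` with its digit of index register `10` rotated. -/
def rotExpr (c : ℕ) : Expr :=
  .reg 11 - .reg 11 / arr 0 (.reg 10) % 3 * arr 0 (.reg 10)
    + (.reg 11 / arr 0 (.reg 10) % 3 + .const c) % 3 * arr 0 (.reg 10)

/-- The rounds of `digitTransform`, in array `5`. -/
def transformProg : Prog :=
  .loop 10 6 (.loop 11 4 (.set 5 ((.reg 10 + 1) * .reg 4 + .reg 11)
    (arr 5 (.reg 10 * .reg 4 + rotExpr 1) ^^^ arr 5 (.reg 10 * .reg 4 + rotExpr 2))))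

theorem digitTransform_xor_lt {T : ℕ → ℕ} {s : ℕ} (hT : ∀ t < 3 ^ m, T t < 2 ^ s) :
    ∀ i ≤ m, ∀ t < 3 ^ m, digitTransform (· ^^^ ·) T i t < 2 ^ s := by
  intro i
  induction i with
  | zero => exact fun _ => hT
  | succ i ih =>
    intro hi t ht
    exact Nat.xor_lt_two_pow (ih (by omega) _ (rotDigit_lt hi ht))
      (ih (by omega) _ (rotDigit_lt hi ht))

/-- Round `k` occupies its own block of `3 ^ m` cells from `k * 3 ^ m` on, so the next round reads a
block that is no longer being written. -/
theorem run_transformProg (h : Params m L env) (h0 : ∀ i ≤ m, st.val 0 i = 3 ^ i) {T : ℕ → ℕ}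
    (hst : ∀ t < 3 ^ m, st.val 5 t = T t) (hT : ∀ t < 3 ^ m, T t < 2 ^ ((2 * m + 3) * L)) :
    ∀ t < 3 ^ m, (transformProg.run r inp env st).val 5 (m * 3 ^ m + t)
      = digitTransform (· ^^^ ·) T m t := by
  have hlt := digitTransform_xor_lt hT
  have key := run_loop_induction (r := r) (inp := inp) (env := env) (x := 10) (b := 6) (st := st)
    (p := .loop 11 4 (.set 5 ((.reg 10 + 1) * .reg 4 + .reg 11)
      (arr 5 (.reg 10 * .reg 4 + rotExpr 1) ^^^ arr 5 (.reg 10 * .reg 4 + rotExpr 2))))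
    (fun k s => ∀ t < 3 ^ m, s.val 5 (k * 3 ^ m + t) = digitTransform (· ^^^ ·) T k t) ?_ ?_
  · rw [h.reg6] at key
    exact key
  · intro t ht
    rw [zero_mul, zero_add, hst t ht, digitTransform]
  · intro k hk s hf hs
    rw [h.reg6] at hk
    have h' := h.update (x := 10) le_rfl k
    have h3 : s.val 0 k = 3 ^ k := by rw [hf 0 (by simp [writes]), h0 k hk.le]
    have key2 := run_loop_induction (r := r) (inp := inp) (env := Function.update env 10 k) (x := 11)
      (b := 4) (st := s) (p := .set 5 ((.reg 10 + 1) * .reg 4 + .reg 11)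
        (arr 5 (.reg 10 * .reg 4 + rotExpr 1) ^^^ arr 5 (.reg 10 * .reg 4 + rotExpr 2)))
      (fun l s => (∀ t < 3 ^ m, s.val 5 (k * 3 ^ m + t) = digitTransform (· ^^^ ·) T k t) ∧
        ∀ t < l, s.val 5 ((k + 1) * 3 ^ m + t) = digitTransform (· ^^^ ·) T (k + 1) t)
      ⟨hs, by simp⟩ ?_
    · rw [h'.reg4] at key2
      exact key2.2
    · intro l hl s' hf' ⟨h1, h2⟩
      rw [h'.reg4] at hl
      have h3' : s'.val 0 k = 3 ^ k := by rw [hf' 0 (by simp [writes]), h3]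
      have hrot : ∀ c, (rotExpr c).eval (toState inp (Function.update (Function.update env 10 k) 11 l)
          s'.val) = rotDigit k c l := by
        intro c
        simp only [rotExpr, Expr.eval_add, Expr.eval_sub, Expr.eval_mul, Expr.eval_mod,
          Expr.eval_div, Expr.eval_ofNat, Expr.eval_const, Expr.eval_reg, toState_reg, eval_arr,
          Nat.reduceLT, Function.update_apply, Nat.reduceEqDiff, if_true, if_false, h3']
        rfl
      have e : ∀ i, ((Prog.set 5 ((.reg 10 + 1) * .reg 4 + .reg 11)
          (arr 5 (.reg 10 * .reg 4 + rotExpr 1) ^^^ arr 5 (.reg 10 * .reg 4 + rotExpr 2))).run r inp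
            (Function.update (Function.update env 10 k) 11 l) s').val 5 i
          = if i = (k + 1) * 3 ^ m + l then digitTransform (· ^^^ ·) T (k + 1) l
            else s'.val 5 i := by
        intro i
        simp only [run_set_val, Expr.eval_add, Expr.eval_mul, Expr.eval_xor,
          Expr.eval_ofNat, Expr.eval_reg, toState_reg, eval_arr, hrot,
          Nat.reduceLT, Function.update_apply, Nat.reduceEqDiff, if_true, if_false, true_and,
          h.reg4, h1 _ (rotDigit_lt hk hl)]
        rw [h.mod' (k := (2 * m + 3) * L) _ (by omega)]
        · rfl
        · exact Nat.xor_lt_two_pow (hlt k hk.le _ (rotDigit_lt hk hl))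
            (hlt k hk.le _ (rotDigit_lt hk hl))
      refine ⟨fun t ht => ?_, fun t ht => ?_⟩
      · rw [e, if_neg, h1 t ht]
        rw [add_mul, one_mul]
        omega
      · rw [e]
        split_ifs with he
        · rw [show t = l by omega]
        · exact h2 t (by omega)

/-- The sum over all cuts, in array `13`. -/
def outputProg : Prog :=
  .seq (.set 13 0 0) (.loop 10 4 (.seq (.set 11 0 (arr 4 (.reg 10)))
    (.seq (.set 12 0 (arr 5 (.reg 6 * .reg 4 + .reg 10)))
      (.seq mulProg (.set 13 0 (arr 13 0 ^^^ arr 10 0))))))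

theorem run_outputProg (h : Params m L env) {F G : ℕ → ℕ} (hF : ∀ t < 3 ^ m, st.val 4 t = F t)
    (hG : ∀ t < 3 ^ m, st.val 5 (m * 3 ^ m + t) = G t)
    (hFlt : ∀ t < 3 ^ m, F t < 2 ^ ((2 * m + 3) * L))
    (hGlt : ∀ t < 3 ^ m, G t < 2 ^ ((2 * m + 3) * L)) :
    (outputProg.run r inp env st).val 13 0 = xorSum (fun t => clMul (F t) (G t)) (3 ^ m) := by
  have key := run_loop_induction (r := r) (inp := inp) (env := env) (x := 10) (b := 4)
    (st := (Prog.set 13 0 0).run r inp env st)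
    (p := .seq (.set 11 0 (arr 4 (.reg 10)))
      (.seq (.set 12 0 (arr 5 (.reg 6 * .reg 4 + .reg 10)))
      (.seq mulProg (.set 13 0 (arr 13 0 ^^^ arr 10 0)))))
    (fun k s => s.val 13 0 = xorSum (fun t => clMul (F t) (G t)) k) ?_ ?_
  · rw [h.reg4] at key
    exact key
  · simp [run_set_val, xorSum]
  · intro k hk s hf hs
    rw [h.reg4] at hk
    have h' := h.update (x := 10) le_rfl k
    have f4 : s.val 4 = st.val 4 := by
      rw [hf 4 (by simp [writes, writes_mulProg]), run_val_of_notMem (by simp [writes])]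
    have f5 : s.val 5 = st.val 5 := by
      rw [hf 5 (by simp [writes, writes_mulProg]), run_val_of_notMem (by simp [writes])]
    rw [run_seq, run_seq, run_seq]
    set st₂ := (Prog.set 11 0 (arr 4 (.reg 10))).run r inp (Function.update env 10 k) s with hst₂
    set st₃ := (Prog.set 12 0 (arr 5 (.reg 6 * .reg 4 + .reg 10))).run r inp
      (Function.update env 10 k) st₂ with hst₃
    have e11 : st₃.val 11 0 = F k := by
      rw [hst₃, run_val_of_notMem (by simp [writes]), hst₂]
      simp only [run_set_val, eval_arr, Expr.eval_ofNat, Nat.reduceLT, and_self, if_true,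
        Expr.eval_reg, toState_reg, Function.update_self, f4, hF k hk]
      exact h'.mod' (hFlt k hk) (by omega)
    have e12 : st₃.val 12 0 = G k := by
      rw [hst₃]
      simp only [run_set_val, eval_arr, Expr.eval_mul, Expr.eval_add, Expr.eval_ofNat,
        Expr.eval_reg, toState_reg, and_self, if_true, h'.reg4, h'.reg6, Nat.reduceLT,
        Function.update_self]
      rw [hst₂, run_val_of_notMem (by simp [writes]), f5, hG k hk, h'.mod' (hGlt k hk) (by omega)]
    have e10 := run_mulProg (r := r) (inp := inp) (st := st₃) h' (by rw [e11]; exact hFlt k hk)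
      (by rw [e12]; exact hGlt k hk)
    have e13 : (mulProg.run r inp (Function.update env 10 k) st₃).val 13 0
        = xorSum (fun t => clMul (F t) (G t)) k := by
      rw [run_val_of_notMem (by simp [writes_mulProg]), hst₃,
        run_val_of_notMem (by simp [writes]), hst₂, run_val_of_notMem (by simp [writes]), hs]
    simp only [run_set_val, eval_arr, Expr.eval_xor, Expr.eval_ofNat, Nat.reduceLT, and_self,
      if_true, e10, e11, e12, e13]
    rw [← xorSum, h'.mod' (k := 2 * ((2 * m + 3) * L)) _ (by omega)]
    refine xorSum_lt fun t ht => ?_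
    rw [two_mul]
    exact clMul_lt (hFlt t (by omega)) (hGlt t (by omega))

/-- The program; `pre` computes the entries of array `14`, on which the relations `R₁` and `R₂`
between the registers `10` and `11` may depend. -/
def coreProg (pre : Prog) (R₁ R₂ : Expr) : Prog :=
  .seq sampleProg (.seq pre (.seq powProg (.seq (fillProg 2 0 R₁) (.seq (fillProg 3 1 R₂)
    (.seq (tableProg 2 4) (.seq (tableProg 3 5) (.seq transformProg outputProg)))))))

/-- The phases are put together by the frame rule. Sampling comes first, to start at the first coin,
and `pre` has to spare array `1`, where the weights are kept. -/
theorem run_coreProg (h : Params m L env) (h0 : st.coins = 0) {pre : Prog} (hpre : 1 ∉ pre.writes)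
    {R₁ R₂ : Expr} {ρ₁ ρ₂ : ℕ → ℕ → ℕ}
    (hR : ∀ V : ℕ → ℕ → ℕ,
      V 14 = (pre.run r inp env (sampleProg.run r inp env st)).val 14 →
      ∀ u < 2 * m + 2, ∀ v < 2 * m + 2,
        R₁.eval (toState inp (Function.update (Function.update env 10 u) 11 v) V) = ρ₁ u v ∧
        R₂.eval (toState inp (Function.update (Function.update env 10 u) 11 v) V) = ρ₂ u v) :
    ((coreProg pre R₁ R₂).run r inp env st).val 13 0 = outBits m
      (weightBits ρ₁ (2 * m + 2) 0 fun i => coinWord r (i * L) L)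
      (weightBits ρ₂ (2 * m + 2) 1 fun i => coinWord r (i * L) L) := by
  set g : ℕ → ℕ := fun i => coinWord r (i * L) L with hg
  have hglt : ∀ i, g i < 2 ^ L := fun i => coinWord_lt _ _ _
  rw [coreProg]
  iterate 8 rw [run_seq]
  set s₁ := sampleProg.run r inp env st with hs₁
  set s₂ := pre.run r inp env s₁ with hs₂
  set s₃ := powProg.run r inp env s₂ with hs₃
  set s₄ := (fillProg 2 0 R₁).run r inp env s₃ with hs₄
  set s₅ := (fillProg 3 1 R₂).run r inp env s₄ with hs₅
  set s₆ := (tableProg 2 4).run r inp env s₅ with hs₆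
  set s₇ := (tableProg 3 5).run r inp env s₆ with hs₇
  set s₈ := transformProg.run r inp env s₇ with hs₈
  have f₄ : ∀ j, j ≠ 2 → s₄.val j = s₃.val j := fun j hj =>
    run_val_of_notMem (by simpa [fillProg, writes] using hj)
  have f₅ : ∀ j, j ≠ 3 → s₅.val j = s₄.val j := fun j hj =>
    run_val_of_notMem (by simpa [fillProg, writes] using hj)
  have f₆ : ∀ j, j < 6 → j ≠ 4 → s₆.val j = s₅.val j := fun j hj hj' =>
    run_val_of_notMem (by simp [writes_tableProg]; omega)
  have f₇ : ∀ j, j < 6 → j ≠ 5 → s₇.val j = s₆.val j := fun j hj hj' =>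
    run_val_of_notMem (by simp [writes_tableProg]; omega)
  have w₁ := run_sampleProg (r := r) (inp := inp) h h0
  have w₂ : s₂.val 1 = s₁.val 1 := run_val_of_notMem hpre
  have w₃ : s₃.val 1 = s₁.val 1 := (run_val_of_notMem (by simp [powProg, writes])).trans w₂
  have e14 : s₃.val 14 = s₂.val 14 := run_val_of_notMem (by simp [powProg, writes])
  have p₃ := run_powProg (r := r) (inp := inp) (st := s₂) h
  have p₅ : s₅.val 0 = s₃.val 0 := by rw [f₅ 0 (by norm_num), f₄ 0 (by norm_num)]
  have p₆ : s₆.val 0 = s₃.val 0 := by rw [f₆ 0 (by norm_num) (by norm_num), p₅]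
  have p₇ : s₇.val 0 = s₃.val 0 := by rw [f₇ 0 (by norm_num) (by norm_num), p₆]
  have a₄ := run_fillProg (r := r) (inp := inp) (st := s₃) h (a := 2) (w := 0) (by norm_num)
    (by norm_num) two_pos hglt (by rwa [w₃])
    (R := R₁) (ρ := ρ₁) fun u hu v hv V hV => (hR V (hV.trans e14) u hu v hv).1
  have a₅ := run_fillProg (r := r) (inp := inp) (st := s₄) h (a := 3) (w := 1) (by norm_num)
    (by norm_num) one_lt_two hglt (by rwa [f₄ 1 (by norm_num), w₃])
    (R := R₂) (ρ := ρ₂) fun u hu v hv V hV =>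
      (hR V ((hV.trans (f₄ 14 (by norm_num))).trans e14) u hu v hv).2
  have hA₁ : ∀ i < 2 * m + 2, ∀ j < 2 * m + 2, weightBits ρ₁ (2 * m + 2) 0 g i j < 2 ^ L :=
    fun i _ j _ => weightBits_lt (hglt _)
  have hA₂ : ∀ i < 2 * m + 2, ∀ j < 2 * m + 2, weightBits ρ₂ (2 * m + 2) 1 g i j < 2 ^ L :=
    fun i _ j _ => weightBits_lt (hglt _)
  have t₆ := run_tableProg (r := r) (inp := inp) (st := s₅) h (a := 2) (d := 4) (by norm_num)
    (by norm_num) (by norm_num) (by norm_num) hA₁ (by rwa [p₅]) (by rwa [f₅ 2 (by norm_num)])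
  have t₇ := run_tableProg (r := r) (inp := inp) (st := s₆) h (a := 3) (d := 5) (by norm_num)
    (by norm_num) (by norm_num) (by norm_num) hA₂ (by rwa [p₆])
    (by rwa [f₆ 3 (by norm_num) (by norm_num)])
  have hT : ∀ t < 3 ^ m, detBits m (weightBits ρ₂ (2 * m + 2) 1 g) t < 2 ^ ((2 * m + 3) * L) :=
    fun t _ => detBits_lt hA₂ t
  have t₈ := run_transformProg (r := r) (inp := inp) (st := s₇) h (by rwa [p₇]) t₇ hT
  refine run_outputProg h ?_ t₈ (fun t _ => detBits_lt hA₁ t) (digitTransform_xor_lt hT m le_rfl)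
  rw [hs₈, run_val_of_notMem (by simp [transformProg, writes]), f₇ 4 (by norm_num) (by norm_num)]
  exact t₆

theorem wf_coreProg {pre : Prog} (hpre : pre.WF (Set.Icc 1 9)) {R₁ R₂ : Expr}
    (h₁ : R₁.RegsIn (insert 11 (insert 10 (Set.Icc 1 9))))
    (h₂ : R₂.RegsIn (insert 11 (insert 10 (Set.Icc 1 9)))) :
    (coreProg pre R₁ R₂).WF (Set.Icc 1 9) := by
  simp [coreProg, WF, hpre, sampleProg, powProg, fillProg, weightExpr, tableProg, sideProg,
    vertexProg, cutProg, layersProg, diagProg, cellProg, termProg, mulProg, detProg, transformProg,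
    rotExpr, outputProg, layer, digitExpr, h₁, h₂]

/-- No two loops over the `3 ^ m` codes are nested, so the exponential factor is `3 ^ m` and not a
higher power. -/
theorem depth_coreProg {pre : Prog} (hpre : pre.depth = 0) (R₁ R₂ : Expr) :
    (coreProg pre R₁ R₂).depth = 1 := by
  simp [coreProg, depth, hpre, sampleProg, powProg, fillProg, tableProg, sideProg,
    vertexProg, cutProg, layersProg, diagProg, cellProg, termProg, mulProg, detProg, transformProg,
    outputProg]

end RAM

/-! ## The machine -/

namespace RAM

variable {r : ℕ → Bool} {S : ℕ}

/-- Within `k` units of the word length, the program leads from one state to another. -/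
def Reaches (r : ℕ → Bool) (S k : ℕ) (c : Cmd) (s s' : State) : Prop :=
  s'.Bdd S ∧ ∃ t, Exec r c s t s' ∧ t ≤ k * (S + 1)

theorem Reaches.seq {k₁ k₂ : ℕ} {c₁ c₂ : Cmd} {s₁ s₂ s₃ : State} (h₁ : Reaches r S k₁ c₁ s₁ s₂)
    (h₂ : Reaches r S k₂ c₂ s₂ s₃) : Reaches r S (k₁ + k₂) (.seq c₁ c₂) s₁ s₃ := by
  obtain ⟨-, t₁, e₁, l₁⟩ := h₁
  obtain ⟨b, t₂, e₂, l₂⟩ := h₂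
  exact ⟨b, _, .seq e₁ e₂, by rw [add_mul]; omega⟩

theorem Reaches.mono {k k' : ℕ} {c : Cmd} {s s' : State} (h : Reaches r S k c s s') (hk : k ≤ k') :
    Reaches r S k' c s s' :=
  ⟨h.1, h.2.imp fun _ ht => ⟨ht.1, ht.2.trans (Nat.mul_le_mul_right _ hk)⟩⟩

theorem reaches_assign {s : State} (hs : s.Bdd S) (x : ℕ) {e : Expr} {y : ℕ} (he : e.eval s = y)
    (hy : y < 2 ^ S) : Reaches r S (1 + 2 * e.wt ^ 2) (.assign x e) s
      ⟨Function.update s.reg x y, s.mem, s.coins⟩ := by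
  subst he
  refine ⟨hs.assign hy _ _, _, .assign x e s, ?_⟩
  have := e.cost_le hs
  nlinarith

theorem reaches_ite {s s' : State} (hs : s.Bdd S) {k : ℕ} {e : Expr} {c₁ c₂ : Cmd}
    (he : e.eval s ≠ 0) (h : Reaches r S k c₁ s s') :
    Reaches r S (1 + 2 * e.wt ^ 2 + k) (.ite e c₁ c₂) s s' := by
  obtain ⟨b, t, ht, hk⟩ := h
  refine ⟨b, _, .iteTrue he ht, ?_⟩
  have := e.cost_le hs
  nlinarith

theorem reaches_ite_nop {s : State} (hs : s.Bdd S) {e : Expr} {c : Cmd}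
    (he : e.eval s = 0) : Reaches r S (2 + 2 * e.wt ^ 2) (.ite e c .nop) s s := by
  refine ⟨hs, _, .iteFalse he (.nop s), ?_⟩
  have := e.cost_le hs
  nlinarith

/-- Multiply register `x` by `q` as often as register `10` says. -/
def powLoop (x q : ℕ) : Cmd :=
  .loop (.reg 10) (.seq (.assign x (.reg x * .const q)) (.assign 10 (.reg 10 - 1)))

/-- As `q` is positive, intermediate values do not exceed the final one; only the latter has to fit
into a word. -/
theorem reaches_powLoop {x q : ℕ} (hx : x ≠ 10) (hq : 0 < q) (k : ℕ) : ∀ {s : State} (_ : s.Bdd S)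
    (_ : s.reg 10 = k) (_ : s.reg x * q ^ k < 2 ^ S),
    Reaches r S (3 + k * (100 + 2 * (3 + q.size) ^ 2)) (powLoop x q) s
      ⟨Function.update (Function.update s.reg x (s.reg x * q ^ k)) 10 0, s.mem, s.coins⟩ := by
  induction k with
  | zero =>
    intro s hs h10 _
    have e : (⟨Function.update (Function.update s.reg x (s.reg x * q ^ 0)) 10 0, s.mem, s.coins⟩ :
        State) = s := by
      rw [pow_zero, mul_one, Function.update_eq_self, ← h10, Function.update_eq_self]
    rw [e]
    refine ⟨hs, _, .loopEnd h10, ?_⟩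
    have := (Expr.reg 10).cost_le hs
    have hw : (Expr.reg 10).wt = 1 := rfl
    rw [hw] at this
    nlinarith
  | succ k ih =>
    intro s hs h10 hlt
    have hlt' : s.reg x * q < 2 ^ S := by
      refine lt_of_le_of_lt ?_ hlt
      rw [pow_succ']
      have : 0 < q ^ k := by positivity
      nlinarith [Nat.mul_le_mul_left (s.reg x * q) this]
    have h1 := reaches_assign (r := r) hs x (e := .reg x * .const q) (y := s.reg x * q) rfl hlt'
    have h2 := reaches_assign (r := r) h1.1 10 (e := .reg 10 - 1) (y := k)
      (by simp [Function.update_of_ne hx.symm, h10]) (by have := hs.1 10; omega)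
    obtain ⟨b, t, et, lt⟩ := h1.seq h2
    have h3 := ih b (by simp)
      (by simpa [Function.update_of_ne hx, mul_assoc, ← pow_succ'] using hlt)
    obtain ⟨b', t', et', lt'⟩ := h3
    have e : (⟨Function.update (Function.update (Function.update (Function.update s.reg x
        (s.reg x * q)) 10 k) x (Function.update (Function.update s.reg x (s.reg x * q)) 10 k x
        * q ^ k)) 10 0, s.mem, s.coins⟩ : State)
        = ⟨Function.update (Function.update s.reg x (s.reg x * q ^ (k + 1))) 10 0, s.mem,
          s.coins⟩ := by
      rw [Function.update_of_ne hx, Function.update_self, Function.update_comm hx.symm,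
        Function.update_idem, Function.update_idem, mul_assoc, ← pow_succ']
    rw [e] at b' et'
    refine ⟨b', _, .loopStep (by rw [Expr.eval_reg, h10]; omega) et et', ?_⟩
    have c := (Expr.reg 10).cost_le hs
    have hw : (Expr.reg 10).wt = 1 := rfl
    have hw1 : (Expr.reg x * .const q).wt = 3 + q.size := by
      change 1 + 1 + (1 + q.size) = _
      ring
    have hw2 : (Expr.reg 10 - 1).wt = 4 := rfl
    rw [hw] at c
    rw [hw1, hw2] at lt
    nlinarith

/-- The constants, computed from the number of vertices in register `3`. -/
def setup : Cmd :=
  .seq (.assign 1 (.reg 3 * .reg 3 + 1)) (.seq (.assign 5 (.reg 3 + .reg 3 % 2))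
  (.seq (.assign 6 ((.reg 5 - 2) / 2)) (.seq (.assign 8 (.reg 5 + 3))
  (.seq (.assign 7 ((.reg 5 + 1) * .reg 8)) (.seq (.assign 9 (2 * .reg 5 * .reg 5))
  (.seq (.assign 4 1) (.seq (.assign 10 (.reg 6)) (.seq (powLoop 4 3)
  (.seq (.assign 2 1) (.seq (.assign 10 (2 * .reg 7 + 2)) (powLoop 2 2)))))))))))

/-- The number of vertices is rounded up to the even number `2 * m + 2`, and weights get `L = 2 * m
+ 5` bits. The word length `2 * T + 3` is what the modulus `2 ^ (2 * T + 2)` in register `2`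
requires. -/
theorem reaches_setup {n m : ℕ} (hm : n + n % 2 = 2 * m + 2) {s : State}
    (hs : s.Bdd (2 * ((2 * m + 3) * (2 * m + 5)) + 3)) (h3 : s.reg 3 = n) :
    ∃ s', Reaches r (2 * ((2 * m + 3) * (2 * m + 5)) + 3)
      (5000 + 1000 * ((2 * m + 3) * (2 * m + 5))) setup s s' ∧
      Params m (2 * m + 5) s'.reg ∧ s'.reg 1 = n * n + 1 ∧ s'.reg 3 = n ∧ s'.mem = s.mem ∧
      s'.coins = s.coins := by
  set T := (2 * m + 3) * (2 * m + 5) with hT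
  have hlt : ∀ y ≤ 2 * T + 3, y < 2 ^ (2 * T + 3) := fun y hy =>
    hy.trans_lt (Nat.lt_two_pow_self)
  have hnm : n ≤ 2 * m + 2 := by omega
  have c1 := reaches_assign (r := r) hs 1 (e := .reg 3 * .reg 3 + 1) (y := n * n + 1)
    (by simp [h3]) (hlt _ (by nlinarith))
  have c2 := reaches_assign (r := r) c1.1 5 (e := .reg 3 + .reg 3 % 2) (y := 2 * m + 2)
    (by simp [h3, hm]) (hlt _ (by nlinarith))
  have c3 := reaches_assign (r := r) c2.1 6 (e := (.reg 5 - 2) / 2) (y := m)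
    (by simp) (hlt _ (by nlinarith))
  have c4 := reaches_assign (r := r) c3.1 8 (e := .reg 5 + 3) (y := 2 * m + 5)
    (by simp) (hlt _ (by nlinarith))
  have c5 := reaches_assign (r := r) c4.1 7 (e := (.reg 5 + 1) * .reg 8) (y := T)
    (by simp [hT]) (hlt _ (by nlinarith))
  have c6 := reaches_assign (r := r) c5.1 9 (e := 2 * .reg 5 * .reg 5)
    (y := 2 * (2 * m + 2) * (2 * m + 2))
    (by simp) (hlt _ (by nlinarith))
  have c7 := reaches_assign (r := r) c6.1 4 (e := 1) (y := 1) (by simp) (hlt _ (by nlinarith))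
  have c8 := reaches_assign (r := r) c7.1 10 (e := .reg 6) (y := m)
    (by simp) (hlt _ (by nlinarith))
  have hpow : 3 ^ m < 2 ^ (2 * T + 3) := by
    calc 3 ^ m ≤ (2 ^ 2) ^ m := Nat.pow_le_pow_left (by norm_num) _
      _ = 2 ^ (2 * m) := by rw [pow_mul]
      _ < _ := Nat.pow_lt_pow_right (by norm_num) (by nlinarith)
  have c9 := reaches_powLoop (r := r) (x := 4) (q := 3) (by norm_num) (by norm_num) m c8.1
    (by simp) (by simpa [Function.update_apply] using hpow)
  have c10 := reaches_assign (r := r) c9.1 2 (e := 1) (y := 1) (by simp) (hlt _ (by nlinarith))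
  have c11 := reaches_assign (r := r) c10.1 10 (e := 2 * .reg 7 + 2) (y := 2 * T + 2)
    (by simp) (hlt _ (by nlinarith))
  have c12 := reaches_powLoop (r := r) (x := 2) (q := 2) (by norm_num) (by norm_num) (2 * T + 2)
    c11.1 (by simp) (by
      simpa [Function.update_apply] using Nat.pow_lt_pow_right (by norm_num) (Nat.lt_succ_self _))
  refine ⟨_, (c1.seq (c2.seq (c3.seq (c4.seq (c5.seq (c6.seq (c7.seq (c8.seq (c9.seq (c10.seq
    (c11.seq c12))))))))))).mono ?_, ?_, ?_, ?_, rfl, rfl⟩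
  · have w1 : (Expr.reg 3 * .reg 3 + 1).wt = 6 := rfl
    have w2 : (Expr.reg 3 + .reg 3 % 2).wt = 7 := rfl
    have w3 : ((Expr.reg 5 - 2) / 2).wt = 9 := rfl
    have w4 : (Expr.reg 5 + 3).wt = 5 := rfl
    have w5 : ((Expr.reg 5 + 1) * .reg 8).wt = 6 := rfl
    have w6 : (2 * Expr.reg 5 * .reg 5).wt = 7 := rfl
    have w7 : (1 : Expr).wt = 2 := rfl
    have w8 : (Expr.reg 6).wt = 1 := rfl
    have w9 : (2 * Expr.reg 7 + 2).wt = 9 := rfl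
    have w10 : Nat.size 3 = 2 := rfl
    have w11 : Nat.size 2 = 2 := rfl
    rw [w1, w2, w3, w4, w5, w6, w7, w8, w9, w10, w11]
    nlinarith
  · constructor
    all_goals simp [hT]
  · simp
  · simp [h3]

/-- The whole program, guarded by a test. -/
def mainCmd (guard : Expr) (pre : Prog) (R₁ R₂ : Expr) : Cmd :=
  .seq (.assign 3 (.load 0)) (.ite guard
    (.seq setup (.seq (coreProg pre R₁ R₂).compile (.assign 0 (arr 13 0)))) .nop)

/-- The state of `mainCmd` at the test. -/
def testState (n : ℕ) (inp : ℕ → ℕ) : State := ⟨Function.update (fun _ => 0) 3 n, inp, 0⟩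

open Polynomial in
/-- The polynomial factor in the running time. -/
noncomputable def timePoly (guard : Expr) (pre : Prog) (R₁ R₂ : Expr) : ℕ[X] :=
  ((C (6000 + 2 * guard.wt ^ 2) + 1000 * X + (coreProg pre R₁ R₂).time) * (2 * X + 4)).comp
    ((X + 4) ^ 2 * 2)

theorem eval_timePoly (guard : Expr) (pre : Prog) (R₁ R₂ : Expr) (n : ℕ) :
    (timePoly guard pre R₁ R₂).eval n = ((6000 + 2 * guard.wt ^ 2) + 1000 * ((n + 4) ^ 2 * 2)
      + (coreProg pre R₁ R₂).time.eval ((n + 4) ^ 2 * 2)) * (2 * ((n + 4) ^ 2 * 2) + 4) := by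
  simp [timePoly]

theorem bdd_initState {n : ℕ} {inp : ℕ → ℕ} (hinp : ∀ a, inp a ≤ n + 1) {S : ℕ} (hS : n + 1 ≤ S) :
    (initState inp).Bdd S :=
  ⟨fun _ => Nat.two_pow_pos S, fun a => (hinp a).trans_lt (hS.trans_lt Nat.lt_two_pow_self)⟩

theorem mainCmd_of_not {guard : Expr} (pre : Prog) (R₁ R₂ : Expr) {n : ℕ} {inp : ℕ → ℕ}
    (hn : inp 0 = n) (hinp : ∀ a, inp a ≤ n + 1) (h : guard.eval (testState n inp) = 0) :
    ∃ t s, Exec r (mainCmd guard pre R₁ R₂) (initState inp) t s ∧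
      t ≤ (timePoly guard pre R₁ R₂).eval n ∧ s.reg 0 = 0 := by
  have hs := bdd_initState hinp le_rfl
  have c1 := reaches_assign (r := r) hs 3 (e := .load 0) (y := n) hn
    ((Nat.lt_succ_self n).trans Nat.lt_two_pow_self)
  obtain ⟨-, t, ht, hle⟩ := c1.seq (reaches_ite_nop (c := .seq setup
    (.seq (coreProg pre R₁ R₂).compile (.assign 0 (arr 13 0)))) c1.1 h)
  refine ⟨t, _, ht, hle.trans ?_, rfl⟩
  have w : (Expr.load 0).wt = 2 := rfl
  rw [w, eval_timePoly]
  exact Nat.mul_le_mul (by nlinarith) (by nlinarith)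

theorem mainCmd_of {guard : Expr} {pre : Prog} {R₁ R₂ : Expr} {n m : ℕ} {inp : ℕ → ℕ}
    (hn : inp 0 = n) (hinp : ∀ a, inp a ≤ n + 1) (h : guard.eval (testState n inp) ≠ 0)
    (hm : n + n % 2 = 2 * m + 2)
    (hpre : pre.WF (Set.Icc 1 9)) (hpre' : 1 ∉ pre.writes) (hdepth : pre.depth = 0)
    (h₁ : R₁.RegsIn (insert 11 (insert 10 (Set.Icc 1 9))))
    (h₂ : R₂.RegsIn (insert 11 (insert 10 (Set.Icc 1 9)))) {ρ₁ ρ₂ : ℕ → ℕ → ℕ}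
    (hR : ∀ env, Params m (2 * m + 5) env → env 1 = n * n + 1 → env 3 = n → ∀ st V,
      V 14 = (pre.run r inp env st).val 14 → ∀ u < 2 * m + 2, ∀ v < 2 * m + 2,
        R₁.eval (toState inp (Function.update (Function.update env 10 u) 11 v) V) = ρ₁ u v ∧
        R₂.eval (toState inp (Function.update (Function.update env 10 u) 11 v) V) = ρ₂ u v) :
    ∃ t s, Exec r (mainCmd guard pre R₁ R₂) (initState inp) t s ∧
      t ≤ (timePoly guard pre R₁ R₂).eval n * 3 ^ m ∧ s.reg 0 = outBits m
        (weightBits ρ₁ (2 * m + 2) 0 fun i => coinWord r (i * (2 * m + 5)) (2 * m + 5))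
        (weightBits ρ₂ (2 * m + 2) 1 fun i => coinWord r (i * (2 * m + 5)) (2 * m + 5)) := by
  set T := (2 * m + 3) * (2 * m + 5) with hT
  have hnm : n ≤ 2 * m + 2 := by omega
  have hmn : 2 * m + 1 ≤ n := by omega
  have hs := bdd_initState hinp (S := 2 * T + 3) (by nlinarith)
  have c1 := reaches_assign (r := r) hs 3 (e := .load 0) (y := n) hn
    (lt_of_le_of_lt (by nlinarith) (Nat.lt_two_pow_self (n := 2 * T + 3)))
  obtain ⟨s₂, c2, hp, h1, h3, hmem, hcoins⟩ := reaches_setup (r := r) hm c1.1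
    (by simp)
  -- The arrays start with whatever the memory holds behind the input, so no initialization is
  -- needed.
  set st : Store := ⟨fun j i => inp (s₂.reg 1 + (16 * i + j)), 0⟩ with hst
  have ha : Agree inp s₂.reg (Set.Icc 1 9) st s₂ := by
    refine ⟨fun _ _ => rfl, ?_, hcoins⟩
    rw [hmem]
    funext a
    rw [encode]
    split_ifs with hlt
    · rfl
    · change inp a = inp _
      congr 1
      have := Nat.div_add_mod (a - s₂.reg 1) 16
      omega
  obtain ⟨t₃, s₃, e₃, l₃, b₃, a₃⟩ := Prog.exec r (S := 2 * T + 3) (by omega) inp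
    (coreProg pre R₁ R₂) (Set.Icc 1 9) subset_rfl (by simp) (wf_coreProg hpre h₁ h₂) s₂.reg st s₂
    c2.1 (by rw [hp.reg2]; positivity) ha
  have hval := run_coreProg (r := r) (inp := inp) (st := st) hp rfl hpre' (R₁ := R₁) (R₂ := R₂)
    (ρ₁ := ρ₁) (ρ₂ := ρ₂) fun V hV u hu v hv => hR _ hp h1 h3 _ V hV u hu v hv
  have h13 : (arr 13 0).eval s₃ = outBits m
        (weightBits ρ₁ (2 * m + 2) 0 fun i => coinWord r (i * (2 * m + 5)) (2 * m + 5))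
        (weightBits ρ₂ (2 * m + 2) 1 fun i => coinWord r (i * (2 * m + 5)) (2 * m + 5)) := by
    rw [a₃.eval (e := arr 13 0) (by simp), eval_arr _ _ _ (by norm_num)]
    exact hval
  have c3 : Reaches r (2 * T + 3) _ _ s₂ s₃ := ⟨b₃, t₃, e₃, l₃⟩
  have c4 := reaches_assign (r := r) b₃ 0 h13 (by rw [← h13]; exact b₃.2 _)
  obtain ⟨-, t, ht, hle⟩ := c1.seq (reaches_ite (c₂ := .nop) c1.1 h (c2.seq (c3.seq c4)))
  refine ⟨t, _, ht, hle.trans ?_, by simp⟩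
  -- Since `2 * m + 2 ≤ n + 1`, this bounds `T` and every loop length other than `3 ^ m`.
  set D := (n + 4) ^ 2 * 2 with hD
  have hTD : T ≤ D := by rw [hT, hD]; nlinarith
  have h3m : 0 < 3 ^ m := by positivity
  have hsteps : (coreProg pre R₁ R₂).steps s₂.reg ≤ (coreProg pre R₁ R₂).time.eval D * 3 ^ m := by
    have := Prog.steps_le (env := s₂.reg) (D := D) (by rw [hp.reg4]; exact h3m) (fun b hb hb4 => ?_)
      (wf_coreProg hpre h₁ h₂)
    · rwa [depth_coreProg hdepth, hp.reg4, pow_one] at this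
    · obtain ⟨hb3, hb9⟩ := hb
      have d1 : n ≤ D := by rw [hD]; nlinarith
      have d2 : 2 * m + 5 ≤ D := by rw [hD]; nlinarith
      have d3 : 2 * (2 * m + 2) * (2 * m + 2) ≤ D := by
        have := Nat.mul_le_mul (show 2 * m + 2 ≤ n + 4 by omega) (show 2 * m + 2 ≤ n + 4 by omega)
        rw [hD, pow_two, mul_assoc]
        omega
      interval_cases b
      · rw [h3]; exact d1
      · exact absurd rfl hb4
      · rw [hp.reg5]; omega
      · rw [hp.reg6]; omega
      · rw [hp.reg7]; exact hTD
      · rw [hp.reg8]; exact d2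
      · rw [hp.reg9]; exact d3
  have w : (Expr.load 0).wt = 2 := rfl
  have w' : (arr 13 0).wt = 17 := rfl
  rw [w, w', eval_timePoly, ← hD, mul_right_comm]
  refine Nat.mul_le_mul ?_ (by omega)
  have h3m' : 6000 + 2 * guard.wt ^ 2 + 1000 * D
      ≤ (6000 + 2 * guard.wt ^ 2 + 1000 * D) * 3 ^ m := Nat.le_mul_of_pos_right _ h3m
  rw [add_mul _ (Polynomial.eval _ _)]
  omega

end RAM

/-! ### From runs of the machine to a decision with one-sided error -/

namespace RAM

theorem adjInput_zero {n : ℕ} (adj : Fin n → Fin n → Prop) : adjInput adj 0 = n := by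
  simp [adjInput]

theorem adjInput_le {n : ℕ} (adj : Fin n → Fin n → Prop) (a : ℕ) : adjInput adj a ≤ n + 1 := by
  unfold adjInput
  split_ifs <;> omega

open Classical in
theorem adjInput_cell {n : ℕ} (adj : Fin n → Fin n → Prop) (u v : Fin n) :
    adjInput adj (1 + u * n + v) = if adj u v then 1 else 0 := by
  unfold adjInput
  rw [if_neg (by omega)]
  refine if_congr ⟨?_, fun h => ⟨u, v, rfl, h⟩⟩ rfl rfl
  rintro ⟨u', v', h, hadj⟩
  have hn : 0 < n := u.pos
  have e : ∀ w z : Fin n, ((w : ℕ) * n + z) / n = w ∧ ((w : ℕ) * n + z) % n = z := fun w z => by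
    rw [mul_comm, Nat.mul_add_div hn, Nat.div_eq_of_lt z.2, Nat.mul_add_mod, Nat.mod_eq_of_lt z.2]
    exact ⟨add_zero _, rfl⟩
  have h' : (u : ℕ) * n + v = u' * n + v' := by omega
  obtain ⟨e1, e2⟩ := e u v
  obtain ⟨e3, e4⟩ := e u' v'
  rw [h'] at e1 e2
  rwa [show u = u' from Fin.ext (e1.symm.trans e3), show v = v' from Fin.ext (e2.symm.trans e4)]

/-- For fixed coins the run is unique, so acceptance is equivalent to a nonzero `weightForm`;
completeness and soundness are then the two statements about random and arbitrary weights. Graph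
theory enters only through the equivalence of `Yes` with `HasConnectedPair`. -/
theorem decides_mainCmd {guard : Expr} {pre : Prog} {R₁ R₂ : Expr}
    (hpre : pre.WF (Set.Icc 1 9)) (hpre' : 1 ∉ pre.writes) (hdepth : pre.depth = 0)
    (h₁ : R₁.RegsIn (insert 11 (insert 10 (Set.Icc 1 9))))
    (h₂ : R₂.RegsIn (insert 11 (insert 10 (Set.Icc 1 9))))
    {n : ℕ} {adj : Fin n → Fin n → Prop} {Yes : Prop}
    (hno : guard.eval (testState n (adjInput adj)) = 0 → ¬ Yes)
    (hyes : guard.eval (testState n (adjInput adj)) ≠ 0 → ∃ m : ℕ, n + n % 2 = 2 * m + 2 ∧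
      ∃ ρ₁ ρ₂ : ℕ → ℕ → ℕ, SymmOn (2 * m + 2) ρ₁ ∧ SymmOn (2 * m + 2) ρ₂ ∧
        (Yes ↔ HasConnectedPair m ρ₁ ρ₂) ∧
      ∀ r env, Params m (2 * m + 5) env → env 1 = n * n + 1 → env 3 = n → ∀ st V,
      V 14 = (pre.run r (adjInput adj) env st).val 14 → ∀ u < 2 * m + 2, ∀ v < 2 * m + 2,
        R₁.eval (toState (adjInput adj) (Function.update (Function.update env 10 u) 11 v) V)
          = ρ₁ u v ∧
        R₂.eval (toState (adjInput adj) (Function.update (Function.update env 10 u) 11 v) V)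
          = ρ₂ u v) :
    Decides (mainCmd guard pre R₁ R₂) (adjInput adj)
      (((timePoly guard pre R₁ R₂).eval n : ℕ) * (3 : ℝ) ^ ((n : ℝ) / 2)) Yes := by
  by_cases hg : guard.eval (testState n (adjInput adj)) = 0
  · have hex := fun r => mainCmd_of_not (r := r) pre R₁ R₂ (adjInput_zero adj) (adjInput_le adj) hg
    refine ⟨fun r => ?_, fun h => absurd h (hno hg), fun _ r hacc => ?_⟩
    · obtain ⟨t, s, h, ht, -⟩ := hex r
      refine ⟨t, s, h, ?_⟩
      have h3 : (1 : ℝ) ≤ (3 : ℝ) ^ ((n : ℝ) / 2) :=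
        Real.one_le_rpow (by norm_num) (by positivity)
      have ht' : (t : ℝ) ≤ ((timePoly guard pre R₁ R₂).eval n : ℕ) := by exact_mod_cast ht
      exact ht'.trans (le_mul_of_one_le_right (Nat.cast_nonneg _) h3)
    · obtain ⟨t, s, h, -, h0⟩ := hex r
      obtain ⟨t', s', h', h0'⟩ := hacc
      rw [(h'.deterministic h).2] at h0'
      exact h0' h0
  · obtain ⟨m, hm, ρ₁, ρ₂, hs₁, hs₂, hiff, hR⟩ := hyes hg
    have hex := fun r => mainCmd_of (r := r) (adjInput_zero adj) (adjInput_le adj) hg hm hpre hpre'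
      hdepth h₁ h₂ (hR r)
    have hacc : ∀ r, Accepts (mainCmd guard pre R₁ R₂) (adjInput adj) r ↔
        weightForm m ρ₁ ρ₂ (fun i => bitPoly (coinWord r (i * (2 * m + 5)) (2 * m + 5))) ≠ 0 := by
      intro r
      obtain ⟨t, s, h, -, h0⟩ := hex r
      rw [← bitPoly_outBits, Ne, bitPoly_eq_zero, ← h0]
      constructor
      · rintro ⟨t', s', h', h0'⟩
        rwa [(h'.deterministic h).2] at h0'
      · exact fun h' => ⟨t, s, h, h'⟩
    refine ⟨fun r => ?_, fun h => ?_, fun h r hr => ?_⟩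
    · obtain ⟨t, s, h, ht, -⟩ := hex r
      refine ⟨t, s, h, ?_⟩
      have h3 : (3 : ℝ) ^ m ≤ (3 : ℝ) ^ ((n : ℝ) / 2) := by
        rw [← Real.rpow_natCast]
        refine Real.rpow_le_rpow_of_exponent_le (by norm_num) ?_
        have : m * 2 ≤ n := by omega
        rw [le_div_iff₀ two_pos]
        exact_mod_cast this
      have ht' : (t : ℝ) ≤ ((timePoly guard pre R₁ R₂).eval n : ℕ) * 3 ^ m := by exact_mod_cast ht
      exact ht'.trans (mul_le_mul_of_nonneg_left h3 (Nat.cast_nonneg _))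
    · simp only [hacc]
      refine half_le_coinMeasure_weightForm hs₁ hs₂ (hiff.1 h) ?_
      -- The weights are long enough: `2 ^ (2 * m + 5)` is `32 * (2 ^ m) ^ 2`, at least `4 * (2 * m
      -- + 2)`.
      have : m < 2 ^ m := Nat.lt_two_pow_self
      rw [pow_add, pow_mul']
      nlinarith
    · exact h (hiff.2 (hasConnectedPair_of_weightForm_ne_zero hs₁ hs₂ ((hacc r).1 hr)))

end RAM

/-! ## Pairs of involutions and Hamiltonian cycles -/

section Alternating

variable {V : Type*}

open Classical in
/-- Follow one map on a set and another one outside. -/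
noncomputable def alternate (S : Set V) (f g : V → V) (v : V) : V := if v ∈ S then f v else g v

theorem alternate_of_mem {S : Set V} {f g : V → V} {v : V} (h : v ∈ S) :
    alternate S f g v = f v := if_pos h

theorem alternate_of_notMem {S : Set V} {f g : V → V} {v : V} (h : v ∉ S) :
    alternate S f g v = g v := if_neg h

theorem alternate_alternate {S : Set V} {f g f' g' : V → V} (hf : ∀ v ∈ S, f v ∉ S)
    (hg : ∀ v ∉ S, g v ∈ S) (h₁ : ∀ v ∈ S, g' (f v) = v) (h₂ : ∀ v ∉ S, f' (g v) = v) (v : V) :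
    alternate S f' g' (alternate S f g v) = v := by
  by_cases h : v ∈ S
  · rw [alternate_of_mem h, alternate_of_notMem (hf v h), h₁ v h]
  · rw [alternate_of_notMem h, alternate_of_mem (hg v h), h₂ v h]

/-- The involution that pairs the elements of `S` with their images. -/
noncomputable def pairing {S : Set V} {π : Equiv.Perm V} (hS : ∀ v, π v ∈ S ↔ v ∉ S) :
    Equiv.Perm V :=
  Function.Involutive.toPerm (alternate S π π.symm) (alternate_alternate
    (fun v hv h => (hS v).1 h hv)
    (fun v hv => by
      by_contra h
      exact hv (by rw [← π.apply_symm_apply v]; exact (hS _).2 h))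
    (fun v _ => π.symm_apply_apply v) (fun v _ => π.apply_symm_apply v))

theorem pairing_of_mem {S : Set V} {π : Equiv.Perm V} (hS : ∀ v, π v ∈ S ↔ v ∉ S) {v : V}
    (hv : v ∈ S) : pairing hS v = π v := alternate_of_mem hv

theorem pairing_of_notMem {S : Set V} {π : Equiv.Perm V} (hS : ∀ v, π v ∈ S ↔ v ∉ S) {v : V}
    (hv : v ∉ S) : pairing hS v = π.symm v := alternate_of_notMem hv

theorem apply_ne_of_alternating {S : Set V} {π : Equiv.Perm V} (hS : ∀ v, π v ∈ S ↔ v ∉ S)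
    (v : V) : π v ≠ v := fun h => by
  have := hS v
  rw [h] at this
  tauto

theorem pairing_mem_fpfInvolutions [Fintype V] [DecidableEq V] {S : Set V} {π : Equiv.Perm V}
    (hS : ∀ v, π v ∈ S ↔ v ∉ S) : pairing hS ∈ fpfInvolutions V := by
  refine mem_fpfInvolutions.2 fun v => ⟨Function.Involutive.toPerm_involutive _ v, ?_⟩
  by_cases hv : v ∈ S
  · rw [pairing_of_mem hS hv]
    exact apply_ne_of_alternating hS v
  · rw [pairing_of_notMem hS hv]
    exact fun h => apply_ne_of_alternating hS v (by rw [Equiv.symm_apply_eq] at h; exact h.symm)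

theorem pairing_rel {N : ℕ} {ρ : ℕ → ℕ → ℕ} (h : SymmOn N ρ) {S : Set (Fin N)}
    {π : Equiv.Perm (Fin N)} (hS : ∀ v, π v ∈ S ↔ v ∉ S) (hρ : ∀ v ∈ S, ρ v (π v) ≠ 0)
    (v : Fin N) : ρ v (pairing hS v) ≠ 0 := by
  by_cases hv : v ∈ S
  · rw [pairing_of_mem hS hv]
    exact hρ v hv
  · rw [pairing_of_notMem hS hv]
    have h1 : π.symm v ∈ S := by
      by_contra h1
      exact hv (by rw [← π.apply_symm_apply v]; exact (hS _).2 h1)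
    have h2 := hρ _ h1
    rw [π.apply_symm_apply] at h2
    exact h _ (π.symm v).2 _ v.2 h2

/-- An alternating cyclic permutation yields a connected pair of involutions. -/
theorem hasConnectedPair_of_perm {m : ℕ} {ρ₁ ρ₂ : ℕ → ℕ → ℕ} (h₁ : SymmOn (2 * m + 2) ρ₁)
    (h₂ : SymmOn (2 * m + 2) ρ₂) (π : Equiv.Perm (Fin (2 * m + 2))) (S : Set (Fin (2 * m + 2)))
    (hS : ∀ v, π v ∈ S ↔ v ∉ S)
    (hc : ∀ x : Fin (2 * m + 2) → ZMod 2, (∀ v, x (π v) = x v) → x 0 = 0 → x = 0)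
    (hρ₁ : ∀ v ∈ S, ρ₁ v (π v) ≠ 0) (hρ₂ : ∀ v ∉ S, ρ₂ v (π v) ≠ 0) :
    HasConnectedPair m ρ₁ ρ₂ := by
  have hS' : ∀ v, π v ∈ Sᶜ ↔ v ∉ Sᶜ := fun v => by
    rw [Set.mem_compl_iff, Set.mem_compl_iff, hS]
  refine ⟨pairing hS, pairing_mem_fpfInvolutions hS, pairing hS', pairing_mem_fpfInvolutions hS',
    fun x hx₁ hx₂ => hc x fun v => ?_, pairing_rel h₁ hS hρ₁, pairing_rel h₂ hS' hρ₂⟩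
  by_cases hv : v ∈ S
  · rw [← hx₁ v, pairing_of_mem hS hv]
  · rw [← hx₂ v, pairing_of_mem hS' hv]

variable {σ τ : Equiv.Perm V}

/-- Following two involutions alternately. -/
noncomputable def alternatePerm {S : Set V} (hσ : ∀ v, σ (σ v) = v) (hτ : ∀ v, τ (τ v) = v)
    (hσS : ∀ v, σ v ∈ S ↔ v ∉ S) (hτS : ∀ v, τ v ∈ S ↔ v ∉ S) : Equiv.Perm V where
  toFun := alternate S σ τ
  invFun := alternate S τ σ
  left_inv := alternate_alternate (fun v hv h => (hσS v).1 h hv) (fun v hv => (hτS v).2 hv)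
    (fun v _ => hσ v) (fun v _ => hτ v)
  right_inv := alternate_alternate (fun v hv h => (hτS v).1 h hv) (fun v hv => (hσS v).2 hv)
    (fun v _ => hτ v) (fun v _ => hσ v)

/-- The cycle of `v₀` under the alternating permutation is closed under both involutions. The
labelling that is `1` outside it is therefore invariant under both and zero at `v₀`, hence zero
everywhere. -/
theorem exists_perm_of_connectedPair {v₀ : V} {S : Set V} (hσ : ∀ v, σ (σ v) = v)
    (hτ : ∀ v, τ (τ v) = v) (h : ConnectedPair v₀ σ τ)
    (hσS : ∀ v, σ v ∈ S ↔ v ∉ S) (hτS : ∀ v, τ v ∈ S ↔ v ∉ S) :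
    ∃ π : Equiv.Perm V, (∀ v ∈ S, π v = σ v) ∧ (∀ v ∉ S, π v = τ v) ∧ ∀ v, π.SameCycle v₀ v := by
  classical
  set π := alternatePerm hσ hτ hσS hτS with hπ
  have h₁ : ∀ v ∈ S, π v = σ v := fun v hv => alternate_of_mem hv
  have h₂ : ∀ v ∉ S, π v = τ v := fun v hv => alternate_of_notMem hv
  refine ⟨π, h₁, h₂, fun v => ?_⟩
  have key := h (fun v => if π.SameCycle v₀ v then 0 else 1) (fun v => ?_) (fun v => ?_)
    (if_pos (Equiv.Perm.SameCycle.refl _ _))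
  · by_contra hv
    have := congrFun key v
    rw [if_neg hv] at this
    exact one_ne_zero this
  · refine if_congr ?_ rfl rfl
    by_cases hv : v ∈ S
    · rw [← h₁ v hv, Equiv.Perm.sameCycle_apply_right]
    · have := h₁ (σ v) ((hσS v).2 hv)
      rw [hσ] at this
      rw [← Equiv.Perm.sameCycle_apply_right, this]
  · refine if_congr ?_ rfl rfl
    by_cases hv : v ∈ S
    · have := h₂ (τ v) (fun h => (hτS v).1 h hv)
      rw [hτ] at this
      rw [← Equiv.Perm.sameCycle_apply_right, this]
    · rw [← h₂ v hv, Equiv.Perm.sameCycle_apply_right]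

/-- The orbits of a dihedral group generated by two fixed-point-free involutions are bipartite. -/
theorem exists_bipartition_of_connectedPair {v₀ : V} (hσ : ∀ v, σ (σ v) = v ∧ σ v ≠ v)
    (hτ : ∀ v, τ (τ v) = v ∧ τ v ≠ v) (h : ConnectedPair v₀ σ τ) :
    ∃ S : Set V, v₀ ∈ S ∧ (∀ v, σ v ∈ S ↔ v ∉ S) ∧ ∀ v, τ v ∈ S ↔ v ∉ S := by
  classical
  set ρ : Equiv.Perm V := τ * σ with hρ
  have hρσ : ∀ v, ρ (σ v) = τ v := fun v => by rw [hρ, Equiv.Perm.mul_apply, (hσ v).1]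
  have hσ1 : σ * σ = 1 := Equiv.ext fun v => (hσ v).1
  have hτ1 : τ * τ = 1 := Equiv.ext fun v => (hτ v).1
  have hσi : σ⁻¹ = σ := inv_eq_of_mul_eq_one_left hσ1
  have hτi : τ⁻¹ = τ := inv_eq_of_mul_eq_one_left hτ1
  have hconj : ∀ k : ℤ, σ * ρ ^ k = ρ ^ (-k) * σ := by
    intro k
    have h1 : σ * ρ * σ⁻¹ = ρ⁻¹ := by
      rw [hρ, mul_inv_rev, hσi, hτi, mul_assoc, mul_assoc τ, hσ1, mul_one]
    have h2 : σ * ρ ^ k * σ⁻¹ = ρ ^ (-k) := by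
      rw [← conj_zpow, h1, zpow_neg, inv_zpow]
    rw [← h2, inv_mul_cancel_right]
  have happ : ∀ (k : ℤ) v, σ ((ρ ^ k) v) = (ρ ^ (-k)) (σ v) := fun k v => by
    rw [← Equiv.Perm.mul_apply, hconj, Equiv.Perm.mul_apply]
  -- The rotations `ρ ^ i` carry `v₀` around its side, and the reflection `σ` maps this side to the
  -- other one.
  set O : Set V := {v | ∃ i : ℤ, (ρ ^ i) v₀ = v} with hO
  have hOρ : ∀ v, ρ v ∈ O ↔ v ∈ O := fun v => by
    constructor
    · rintro ⟨i, hi⟩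
      refine ⟨i - 1, ?_⟩
      rw [sub_eq_neg_add, zpow_add, zpow_neg, zpow_one, Equiv.Perm.mul_apply, hi,
        ← Equiv.Perm.mul_apply, inv_mul_cancel, Equiv.Perm.one_apply]
    · rintro ⟨i, hi⟩
      exact ⟨1 + i, by rw [zpow_add, zpow_one, Equiv.Perm.mul_apply, hi]⟩
  have hdisj : ∀ v ∈ O, σ v ∉ O := by
    rintro v ⟨i, rfl⟩ ⟨j, hj⟩
    rw [happ] at hj
    have hk : σ v₀ = (ρ ^ (i + j)) v₀ := by
      rw [zpow_add, Equiv.Perm.mul_apply, hj, ← Equiv.Perm.mul_apply, ← zpow_add, add_neg_cancel,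
        zpow_zero, Equiv.Perm.one_apply]
    -- If `σ v₀ = ρ ^ k v₀`, a point half way along is fixed by a reflection: by `σ` for even `k`,
    -- by `τ` for odd `k`. Neither has fixed points.
    rcases Int.even_or_odd' (i + j) with ⟨l, hl | hl⟩
    · refine (hσ ((ρ ^ l) v₀)).2 ?_
      rw [happ, hk, ← Equiv.Perm.mul_apply, ← zpow_add, hl]
      congr 2
      ring
    · refine (hτ ((ρ ^ (l + 1)) v₀)).2 ?_
      rw [← hρσ, happ, hk, ← Equiv.Perm.mul_apply, ← Equiv.Perm.mul_apply, ← zpow_one_add,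
        ← zpow_add, hl]
      congr 2
      ring
  -- The union of `O` and its image under `σ` is invariant under both involutions, so connectedness
  -- makes it everything.
  have hcov : ∀ v, v ∈ O ∨ σ v ∈ O := by
    have key := h (fun v => if v ∈ O ∨ σ v ∈ O then 0 else 1) (fun v => ?_) (fun v => ?_)
      (if_pos (Or.inl ⟨0, rfl⟩))
    · intro v
      by_contra hv
      have := congrFun key v
      rw [if_neg hv] at this
      exact one_ne_zero this
    · refine if_congr ?_ rfl rfl
      rw [(hσ v).1, or_comm]
    · refine if_congr ?_ rfl rfl
      rw [← hOρ (σ (τ v)), hρσ, (hτ v).1, ← hρσ v, hOρ, or_comm]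
  have hσO : ∀ v, σ v ∈ O ↔ v ∉ O := fun v =>
    ⟨fun h1 h2 => hdisj v h2 h1, fun h1 => (hcov v).resolve_left h1⟩
  refine ⟨O, ⟨0, rfl⟩, hσO, fun v => ?_⟩
  rw [← hρσ, hOρ, hσO]

end Alternating

/-! ### Hamiltonian cycles as closed sequences of vertices -/

namespace SimpleGraph

variable {n : ℕ} {G : SimpleGraph (Fin n)}

theorem hasHamiltonianCycle_of_seq (hn : 3 ≤ n) (d : ℕ → Fin n)
    (hinj : ∀ i < n, ∀ j < n, d i = d j → i = j) (hd : d n = d 0)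
    (hadj : ∀ i < n, G.Adj (d i) (d (i + 1))) : G.HasHamiltonianCycle := by
  have key : ∀ k ≤ n, ∃ p : G.Walk (d 0) (d k), p.support = (List.range (k + 1)).map d := by
    intro k
    induction k with
    | zero => exact fun _ => ⟨.nil, by simp⟩
    | succ k ih =>
      intro hk
      obtain ⟨p, hp⟩ := ih (by omega)
      refine ⟨p.concat (hadj k (by omega)), ?_⟩
      rw [Walk.support_concat, hp, List.range_succ (n := k + 1), List.map_append]
      simp
  obtain ⟨p, hp⟩ := key n le_rfl
  refine ⟨d 0, p.copy rfl hd, ?_⟩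
  have hs : (p.copy rfl hd).support = (List.range (n + 1)).map d := by
    rw [Walk.support_copy, hp]
  have hlen : (p.copy rfl hd).length = n := by
    have := congrArg List.length hs
    rw [Walk.length_support, List.length_map, List.length_range] at this
    omega
  have hnil : ¬ (p.copy rfl hd).Nil := fun h => by
    have := Walk.length_eq_zero_iff.2 h
    omega
  rw [Walk.isHamiltonianCycle_iff_isCycle_and_length_eq, Fintype.card_fin,
    Walk.isCycle_iff_isPath_tail_and_le_length]
  refine ⟨⟨?_, by omega⟩, hlen⟩
  -- The tail runs through `d 1, …, d n`; as `d n = d 0`, these are the `n` distinct values at `0,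
  -- …, n - 1`.
  rw [Walk.isPath_def, Walk.support_tail_of_not_nil _ hnil, hs, List.range_succ_eq_map,
    List.map_cons, List.tail_cons, List.map_map]
  refine List.Nodup.map_on (fun i hi j hj hij => ?_) List.nodup_range
  rw [List.mem_range] at hi hj
  simp only [Function.comp_apply] at hij
  rcases Nat.lt_or_ge (i + 1) n with h1 | h1 <;> rcases Nat.lt_or_ge (j + 1) n with h2 | h2
  · have := hinj _ h1 _ h2 hij
    omega
  · rw [show j.succ = n by omega, hd] at hij
    have := hinj _ h1 _ (by omega) hij
    omega
  · rw [show i.succ = n by omega, hd] at hij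
    have := hinj _ (by omega) _ h2 hij
    omega
  · omega

theorem HasHamiltonianCycle.exists_seq (h : G.HasHamiltonianCycle) (v : Fin n) :
    3 ≤ n ∧ ∃ d : ℕ → Fin n, d 0 = v ∧ d n = v ∧ (∀ i < n, ∀ j < n, d i = d j → i = j) ∧
      ∀ i < n, G.Adj (d i) (d (i + 1)) := by
  obtain ⟨u, p, hp⟩ := h
  obtain ⟨q, hq⟩ : ∃ q : G.Walk v v, q.IsHamiltonianCycle :=
    ⟨p.rotate v (hp.mem_support v), hp.rotate _⟩
  have hlen : q.length = n := by rw [hq.length_eq, Fintype.card_fin]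
  refine ⟨hlen ▸ hq.three_le_length, q.getVert, q.getVert_zero, ?_, ?_, ?_⟩
  · have := q.getVert_length
    rwa [hlen] at this
  · intro i hi j hj hij
    exact hq.isCycle.getVert_injOn' (by simp only [Set.mem_ofPred_eq]; omega)
      (by simp only [Set.mem_ofPred_eq]; omega) hij
  · exact fun i hi => q.adj_getVert_succ (by omega)

end SimpleGraph

/-! ## Undirected graphs -/

section Undirected

variable {n m : ℕ}

/-- Adjacency of residues. -/
def residueRel (inp : ℕ → ℕ) (n u v : ℕ) : ℕ := inp (1 + u % n * n + v % n)

/-- Adjacency of residues, where for odd `n` the two copies of `0` are joined to each other only. -/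
def twinRel (inp : ℕ → ℕ) (n u v : ℕ) : ℕ :=
  residueRel inp n u v * (1 - n % 2 * ((1 - u % n) + (1 - v % n)))
    + n % 2 * ((1 - u % n) * (1 - v % n))

variable {G : SimpleGraph (Fin n)}

theorem residueRel_ne_zero (hn : 0 < n) {u v : ℕ} : residueRel (adjInput G.Adj) n u v ≠ 0 ↔
    G.Adj ⟨u % n, Nat.mod_lt _ hn⟩ ⟨v % n, Nat.mod_lt _ hn⟩ := by
  have := RAM.adjInput_cell G.Adj ⟨u % n, Nat.mod_lt _ hn⟩ ⟨v % n, Nat.mod_lt _ hn⟩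
  rw [residueRel, show adjInput G.Adj (1 + u % n * n + v % n) = _ from this]
  simp

theorem twinRel_ne_zero {inp : ℕ → ℕ} {u v : ℕ} : twinRel inp n u v ≠ 0 ↔
    (residueRel inp n u v ≠ 0 ∧ (n % 2 = 1 → u % n ≠ 0 ∧ v % n ≠ 0)) ∨
      (n % 2 = 1 ∧ u % n = 0 ∧ v % n = 0) := by
  unfold twinRel
  rcases Nat.mod_two_eq_zero_or_one n with h | h
  · simp [h]
  · rw [h]
    rcases Nat.eq_zero_or_pos (u % n) with hu | hu <;> rcases Nat.eq_zero_or_pos (v % n) with hv | hv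
    · simp [hu, hv]
    · simp [hu, hv.ne', show 1 - v % n = 0 by omega]
    · simp [hv, hu.ne', show 1 - u % n = 0 by omega]
    · simp [hv.ne', hu.ne', show 1 - u % n = 0 by omega, show 1 - v % n = 0 by omega]

theorem symmOn_residueRel (hn : 0 < n) (N : ℕ) : SymmOn N (residueRel (adjInput G.Adj) n) := by
  intro u _ v _ h
  rw [residueRel_ne_zero hn] at h ⊢
  exact h.symm

theorem symmOn_twinRel (hn : 0 < n) (N : ℕ) : SymmOn N (twinRel (adjInput G.Adj) n) := by
  intro u hu v hv h
  rw [twinRel_ne_zero] at h ⊢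
  rcases h with ⟨h1, h2⟩ | ⟨h1, h2, h3⟩
  · exact Or.inl ⟨symmOn_residueRel hn N u hu v hv h1, fun h => (h2 h).symm⟩
  · exact Or.inr ⟨h1, h3, h2⟩

theorem finRotate_val (i : Fin (2 * m + 2)) :
    (finRotate (2 * m + 2) i : ℕ) = if (i : ℕ) = 2 * m + 1 then 0 else (i : ℕ) + 1 := by
  split_ifs with h
  · rw [show i = Fin.last (2 * m + 1) from Fin.ext h, finRotate_last]
    rfl
  · exact coe_finRotate_of_ne_last (i := i) fun h' => h (congrArg Fin.val h')

/-- List the cycle from vertex `0` on, and for odd `n` append the copy `n` of `0`. The length is now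
even, so steps from even positions form `σ` and steps from odd positions form `τ`. For odd `n` the
closing step, from the copy to `0`, starts at an odd position and is the twin edge. -/
theorem SimpleGraph.HasHamiltonianCycle.hasConnectedPair (hm : n + n % 2 = 2 * m + 2)
    (h : G.HasHamiltonianCycle) :
    HasConnectedPair m (residueRel (adjInput G.Adj) n) (twinRel (adjInput G.Adj) n) := by
  have hn : 0 < n := by omega
  obtain ⟨-, d, hd0, hdn, hinj, hadj⟩ := h.exists_seq ⟨0, hn⟩
  let c : Fin (2 * m + 2) → Fin (2 * m + 2) := fun i =>
    if (i : ℕ) < n then ⟨d i, by have := (d i).2; omega⟩ else Fin.last _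
  have hc : ∀ i : Fin (2 * m + 2), (c i : ℕ) = if (i : ℕ) < n then (d i : ℕ) else 2 * m + 1 := by
    intro i
    simp only [c]
    split_ifs <;> rfl
  -- Modulo `n` the copy is `0`, which is also `d n`; so the formula covers the additional position
  -- as well.
  have hcd : ∀ i : Fin (2 * m + 2), (⟨c i % n, Nat.mod_lt _ hn⟩ : Fin n) = d i := by
    intro i
    apply Fin.ext
    change (c i : ℕ) % n = d i
    rw [hc]
    split_ifs with h
    · exact Nat.mod_eq_of_lt (d i).2
    · have := i.2
      have h1 : (i : ℕ) = n := by omega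
      have h2 : 2 * m + 1 = n := by omega
      rw [h1, hdn, h2, Nat.mod_self]
  have hcinj : Function.Injective c := by
    intro i j hij
    have hij' := congrArg Fin.val hij
    rw [hc, hc] at hij'
    have hi := i.2
    have hj := j.2
    apply Fin.ext
    split_ifs at hij' with h1 h2 h2
    · exact hinj _ h1 _ h2 (Fin.ext hij')
    · have := (d i).2
      omega
    · have := (d j).2
      omega
    · omega
  let e : Fin (2 * m + 2) ≃ Fin (2 * m + 2) :=
    Equiv.ofBijective c (Finite.injective_iff_bijective.1 hcinj)
  have he : ∀ i, e i = c i := fun i => rfl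
  let π : Equiv.Perm (Fin (2 * m + 2)) := (e.symm.trans (finRotate _)).trans e
  have hπ : ∀ i, π (e i) = e (finRotate _ i) := fun i => by simp [π]
  have hadjc : ∀ i : Fin (2 * m + 2), (i : ℕ) < n → residueRel (adjInput G.Adj) n (e i)
      (e (finRotate _ i)) ≠ 0 := by
    intro i hi
    rw [residueRel_ne_zero hn, he, he, hcd, hcd, finRotate_val]
    split_ifs with h
    · have := hadj i hi
      rwa [show (i : ℕ) + 1 = n by omega, hdn, ← hd0] at this
    · exact hadj i hi
  refine hasConnectedPair_of_perm (symmOn_residueRel hn _) (symmOn_twinRel hn _) π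
    {v | (e.symm v : ℕ) % 2 = 0} (fun v => ?_) (fun x hx h0 => ?_) (fun v hv => ?_) (fun v hv => ?_)
  · obtain ⟨i, rfl⟩ := e.surjective v
    rw [hπ]
    simp only [Set.mem_ofPred_eq, Equiv.symm_apply_apply, finRotate_val]
    split_ifs <;> omega
  · have hk : ∀ k (hk : k < 2 * m + 2), x (e ⟨k, hk⟩) = 0 := by
      intro k
      induction k with
      | zero =>
        intro hk
        have : e ⟨0, hk⟩ = 0 := by
          apply Fin.ext
          rw [he, hc, if_pos hn]
          simp [hd0]
        rw [this, h0]
      | succ k ih =>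
        intro hk
        rw [← ih (by omega), ← hx (e ⟨k, _⟩), hπ]
        congr 2
        apply Fin.ext
        rw [finRotate_val, if_neg (by simp; omega)]
    funext v
    obtain ⟨i, rfl⟩ := e.surjective v
    exact hk i i.2
  · obtain ⟨i, rfl⟩ := e.surjective v
    rw [Set.mem_ofPred_eq, Equiv.symm_apply_apply] at hv
    rw [hπ]
    exact hadjc i (by have := i.2; omega)
  · obtain ⟨i, rfl⟩ := e.surjective v
    rw [Set.mem_ofPred_eq, Equiv.symm_apply_apply] at hv
    rw [hπ, twinRel_ne_zero]
    have hval : ∀ j : Fin (2 * m + 2), (e j : ℕ) % n = d j := fun j => congrArg Fin.val (hcd j)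
    have hi2 := i.2
    by_cases hlast : n % 2 = 1 ∧ (i : ℕ) = 2 * m + 1
    · refine Or.inr ⟨hlast.1, ?_, ?_⟩
      · rw [hval, hlast.2, show 2 * m + 1 = n by omega, hdn]
      · rw [hval, finRotate_val, if_pos hlast.2, hd0]
    · have hi : (i : ℕ) < n := by omega
      refine Or.inl ⟨hadjc i hi, fun hodd => ?_⟩
      have hne : ∀ j : Fin (2 * m + 2), (j : ℕ) < n → (j : ℕ) ≠ 0 → (e j : ℕ) % n ≠ 0 := by
        intro j hj hj0 h
        rw [hval] at h
        exact hj0 (hinj _ hj _ hn (by rw [hd0]; exact Fin.ext h))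
      refine ⟨hne i hi (by omega), hne _ ?_ ?_⟩
      · rw [finRotate_val, if_neg (by omega)]
        omega
      · rw [finRotate_val, if_neg (by omega)]
        omega

theorem pow_apply_mem_iff {V : Type*} {S : Set V} {π : Equiv.Perm V} (hS : ∀ v, π v ∈ S ↔ v ∉ S)
    {v : V} (hv : v ∈ S) (i : ℕ) : (π ^ i) v ∈ S ↔ i % 2 = 0 := by
  induction i with
  | zero => simpa using hv
  | succ i ih =>
    rw [pow_succ', Equiv.Perm.mul_apply, hS, ih]
    omega

/-- Following `σ` and `τ` alternately from `0` visits all `2 * m + 2` vertices in one cycle. For odd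
`n` the twin edge is forced to be its last step, so the first `n` steps, with the copy read as `0`,
close up to a Hamiltonian cycle. -/
theorem hasHamiltonianCycle_of_hasConnectedPair (hm : n + n % 2 = 2 * m + 2) (hn3 : 3 ≤ n)
    (h : HasConnectedPair m (residueRel (adjInput G.Adj) n) (twinRel (adjInput G.Adj) n)) :
    G.HasHamiltonianCycle := by
  have hn : 0 < n := by omega
  obtain ⟨σ, hσ, τ, hτ, hc, hρ₁, hρ₂⟩ := h
  rw [mem_fpfInvolutions] at hσ hτ
  obtain ⟨S, h0S, hσS, hτS⟩ := exists_bipartition_of_connectedPair hσ hτ hc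
  obtain ⟨π, hπσ, hπτ, hcyc⟩ := exists_perm_of_connectedPair (fun v => (hσ v).1)
    (fun v => (hτ v).1) hc hσS hτS
  have hπS : ∀ v, π v ∈ S ↔ v ∉ S := fun v => by
    by_cases hv : v ∈ S
    · rw [hπσ v hv, hσS]
    · rw [hπτ v hv, hτS]
  have hon : π.IsCycleOn (Finset.univ : Finset (Fin (2 * m + 2))) :=
    ⟨by simp [Set.bijOn_univ], fun u _ v _ => (hcyc u).symm.trans (hcyc v)⟩
  have hinj : ∀ i < 2 * m + 2, ∀ j < 2 * m + 2, (π ^ i) 0 = (π ^ j) 0 → i = j := by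
    intro i hi j hj hij
    rw [hon.pow_apply_eq_pow_apply (Finset.mem_univ _), Finset.card_univ, Fintype.card_fin] at hij
    exact Nat.ModEq.eq_of_lt_of_lt hij hi hj
  have hN : (π ^ (2 * m + 2)) 0 = 0 := by
    rw [hon.pow_apply_eq (Finset.mem_univ _), Finset.card_univ, Fintype.card_fin]
  have hmem := pow_apply_mem_iff hπS h0S
  have hsucc : ∀ i, (π ^ (i + 1)) 0 = π ((π ^ i) 0) := fun i => by
    rw [pow_succ', Equiv.Perm.mul_apply]
  -- The predecessor of `0` is `τ 0`, which `twinRel` forces to be divisible by `n`. Being nonzero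
  -- and below `n + 1`, it is the copy `n`.
  have hodd : n % 2 = 1 → ((π ^ n) 0 : ℕ) = n := by
    intro h
    have h1 : (π ^ n) 0 ∉ S := by
      rw [hmem]
      omega
    have h2 : τ ((π ^ n) 0) = 0 := by
      rw [← hπτ _ h1, ← hsucc, show n + 1 = 2 * m + 2 by omega, hN]
    have h3 := (hτ ((π ^ n) 0)).1.symm
    rw [h2] at h3
    have h4 := (twinRel_ne_zero.1 (hρ₂ 0))
    have h5 : (τ 0 : ℕ) % n = 0 := by
      rcases h4 with h4 | h4
      · exact absurd (by simp) (h4.2 h).1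
      · exact h4.2.2
    have h6 : (τ 0 : ℕ) ≠ 0 := fun h => (hτ 0).2 (Fin.ext h)
    have h7 := (τ 0).2
    rw [h3]
    obtain ⟨q, hq⟩ := Nat.dvd_of_mod_eq_zero h5
    have : q = 1 := by
      rcases q with _ | _ | q
      · exact absurd hq h6
      · rfl
      · rw [hq] at h7
        nlinarith
    rw [hq, this, mul_one]
  have hlt : ∀ i < n, ((π ^ i) 0 : ℕ) < n := by
    intro i hi
    have h1 := ((π ^ i) 0).2
    rcases Nat.mod_two_eq_zero_or_one n with h | h
    · omega
    · by_contra h2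
      have h3 : (π ^ i) 0 = (π ^ n) 0 := Fin.ext (by rw [hodd h]; omega)
      have := hinj i (by omega) n (by omega) h3
      omega
  refine SimpleGraph.hasHamiltonianCycle_of_seq hn3
    (fun i => ⟨((π ^ i) 0 : ℕ) % n, Nat.mod_lt _ hn⟩) ?_ ?_ ?_
  · intro i hi j hj hij
    have hij' : ((π ^ i) 0 : ℕ) % n = ((π ^ j) 0 : ℕ) % n := congrArg Fin.val hij
    rw [Nat.mod_eq_of_lt (hlt i hi), Nat.mod_eq_of_lt (hlt j hj)] at hij'
    exact hinj i (by omega) j (by omega) (Fin.ext hij')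
  · apply Fin.ext
    change ((π ^ n) 0 : ℕ) % n = ((π ^ 0) 0 : ℕ) % n
    rcases Nat.mod_two_eq_zero_or_one n with h | h
    · rw [show n = 2 * m + 2 by omega, hN]
      rfl
    · rw [hodd h, Nat.mod_self]
      simp
  · intro i hi
    rw [← residueRel_ne_zero hn, hsucc]
    by_cases hiS : (π ^ i) 0 ∈ S
    · rw [hπσ _ hiS]
      exact hρ₁ _
    · rw [hπτ _ hiS]
      -- A twin step here would start at vertex `0`, hence at position `0`; but `τ` is followed from
      -- odd positions only.
      rcases twinRel_ne_zero.1 (hρ₂ ((π ^ i) 0)) with h | h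
      · exact h.1
      · rw [hmem] at hiS
        have h1 := h.2.1
        rw [Nat.mod_eq_of_lt (hlt i hi)] at h1
        have := hinj i (by omega) 0 (by omega) (Fin.ext h1)
        omega

end Undirected

/-! ### The program for undirected graphs -/

namespace RAM

/-- The program text for `residueRel`. -/
def residueExpr : Expr := .load (1 + .reg 10 % .reg 3 * .reg 3 + .reg 11 % .reg 3)

/-- The program text for `twinRel`. -/
def twinExpr : Expr :=
  residueExpr * (1 - .reg 3 % 2 * ((1 - .reg 10 % .reg 3) + (1 - .reg 11 % .reg 3)))
    + .reg 3 % 2 * ((1 - .reg 10 % .reg 3) * (1 - .reg 11 % .reg 3))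

theorem encode_adj {n B : ℕ} (hB : B = n * n + 1) (inp : ℕ → ℕ) (V : ℕ → ℕ → ℕ) {u v : ℕ}
    (hu : u < n) (hv : v < n) : encode B inp V (1 + u * n + v) = inp (1 + u * n + v) := by
  rw [encode, if_pos]
  have : (u + 1) * n ≤ n * n := Nat.mul_le_mul_right _ hu
  rw [add_mul, one_mul] at this
  omega

theorem exists_undirected : ∃ (c : Cmd) (p : Polynomial ℕ), ∀ (n : ℕ) (G : SimpleGraph (Fin n)),
    Decides c (adjInput G.Adj) ((p.eval n : ℕ) * (3 : ℝ) ^ ((n : ℝ) / 2))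
      G.HasHamiltonianCycle := by
  -- The guard is nonzero exactly for `n ≥ 3`. It is needed because a single edge on two vertices,
  -- taken as both `σ` and `τ`, is a connected pair but not a cycle. No preparation is required, so
  -- `pre` is a dummy.
  refine ⟨mainCmd (.reg 3 - 2) (.set 14 0 0) residueExpr twinExpr, _, fun n G =>
    decides_mainCmd (by simp [Prog.WF]) (by simp [Prog.writes]) rfl (by simp [residueExpr])
      (by simp [twinExpr, residueExpr]) (fun hg hG => ?_) (fun hg => ?_)⟩
  · have h2 : n - 2 = 0 := by simpa [testState] using hg
    have := hG
    obtain ⟨v, -, -⟩ := this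
    have := (hG.exists_seq v).1
    omega
  · have h2 : n - 2 ≠ 0 := by simpa [testState] using hg
    have hn : 0 < n := by omega
    obtain ⟨m, hm⟩ : ∃ m, n + n % 2 = 2 * m + 2 := ⟨(n + n % 2 - 2) / 2, by omega⟩
    refine ⟨m, hm, residueRel (adjInput G.Adj) n, twinRel (adjInput G.Adj) n,
      symmOn_residueRel hn _, symmOn_twinRel hn _, ⟨fun h => h.hasConnectedPair hm,
      hasHamiltonianCycle_of_hasConnectedPair hm (by omega)⟩,
      fun r env hp h1 h3 st V _ u hu v hv => ?_⟩
    have hres : residueExpr.eval (toState (adjInput G.Adj)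
        (Function.update (Function.update env 10 u) 11 v) V) = residueRel (adjInput G.Adj) n u v := by
      simp only [residueExpr, Expr.eval_load, Expr.eval_add, Expr.eval_mul, Expr.eval_mod,
        Expr.eval_ofNat, Expr.eval_reg, toState_reg, Function.update_apply, Nat.reduceEqDiff,
        if_true, if_false, h3]
      exact encode_adj (by simpa using h1) _ _ (Nat.mod_lt _ hn) (Nat.mod_lt _ hn)
    refine ⟨hres, ?_⟩
    simp only [twinExpr, Expr.eval_add, Expr.eval_mul, Expr.eval_mod, Expr.eval_sub, hres,
      Expr.eval_ofNat, Expr.eval_reg, toState_reg, Function.update_apply, Nat.reduceEqDiff,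
      if_true, if_false, h3]
    rfl

end RAM

/-! ## Bipartite directed graphs -/

section Directed

/-- The adjacency matrix of the input. -/
def arcRel (inp : ℕ → ℕ) (n u v : ℕ) : ℕ := inp (1 + u * n + v)

/-- The vertices that are reachable from `0` by walks of length `0, 2, …, 2 * k`. -/
def Marked (inp : ℕ → ℕ) (n : ℕ) : ℕ → ℕ → Prop
  | 0, v => v = 0
  | k + 1, v => Marked inp n k v ∨
      ∃ u < n, ∃ w < n, Marked inp n k u ∧ arcRel inp n u w ≠ 0 ∧ arcRel inp n w v ≠ 0

open Classical in
/-- The truth value of a proposition. -/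
noncomputable def truth (P : Prop) : ℕ := if P then 1 else 0

theorem truth_of {P : Prop} (h : P) : truth P = 1 := if_pos h

theorem truth_of_not {P : Prop} (h : ¬ P) : truth P = 0 := if_neg h

theorem truth_lt_two (P : Prop) : truth P < 2 := by
  unfold truth
  split_ifs <;> omega

/-- The indicator of `Marked`. -/
noncomputable def mark (inp : ℕ → ℕ) (n k v : ℕ) : ℕ := truth (Marked inp n k v)

/-- Pairs of which the first is marked and the second is not, or vice versa, with an arc from the
marked one to the other one. -/
def crossRel (a : ℕ → ℕ → ℕ) (c : ℕ → ℕ) (u v : ℕ) : ℕ :=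
  a u v * (c u * (1 - c v)) + a v u * (c v * (1 - c u))

theorem symmOn_crossRel (N : ℕ) (a : ℕ → ℕ → ℕ) (c : ℕ → ℕ) : SymmOn N (crossRel a c) := by
  intro u _ v _ h
  rwa [crossRel, add_comm]

theorem crossRel_mark_ne_zero {inp : ℕ → ℕ} {n k : ℕ} {a : ℕ → ℕ → ℕ} {u v : ℕ} :
    crossRel a (mark inp n k) u v ≠ 0 ↔ (a u v ≠ 0 ∧ Marked inp n k u ∧ ¬ Marked inp n k v) ∨
      (a v u ≠ 0 ∧ Marked inp n k v ∧ ¬ Marked inp n k u) := by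
  unfold crossRel mark
  by_cases hu : Marked inp n k u <;> by_cases hv : Marked inp n k v <;> simp [truth, hu, hv]

theorem Marked.mono {inp : ℕ → ℕ} {n k l v : ℕ} (h : Marked inp n k v) (hkl : k ≤ l) :
    Marked inp n l v := by
  induction hkl with
  | refl => exact h
  | step _ ih => exact Or.inl ih

variable {n : ℕ} {G : Digraph (Fin n)}

theorem arcRel_ne_zero (u v : Fin n) : arcRel (adjInput G.Adj) n u v ≠ 0 ↔ G.Adj u v := by
  rw [arcRel, RAM.adjInput_cell]
  simp

theorem Digraph.IsBipartite.exists_side (h : G.IsBipartite) (z : Fin n) :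
    ∃ S : Set (Fin n), z ∈ S ∧ ∀ u v, G.Adj u v → (v ∈ S ↔ u ∉ S) := by
  obtain ⟨S, hS⟩ := h
  refine ⟨{v | v ∈ S ↔ z ∈ S}, Iff.rfl, fun u v huv => ?_⟩
  have := hS u v huv
  simp only [Set.mem_ofPred_eq]
  tauto

theorem Digraph.HasHamiltonianCycle.exists_isCycleOn (h : G.HasHamiltonianCycle) :
    ∃ π : Equiv.Perm (Fin n), π.IsCycleOn (Finset.univ : Finset (Fin n)) ∧
      ∀ v, G.Adj v (π v) := by
  obtain ⟨π, hπ, hne, hadj⟩ := h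
  exact ⟨π, ⟨by simp [Set.bijOn_univ], fun u _ v _ => hπ.sameCycle (hne u) (hne v)⟩, hadj⟩

theorem Digraph.HasHamiltonianCycle.pos (h : G.HasHamiltonianCycle) : 0 < n := by
  obtain ⟨π, ⟨v, -⟩, -⟩ := h
  exact v.pos

/-- Each step along the cycle changes sides, and after `n` steps the walk is back at its start. -/
theorem Digraph.HasHamiltonianCycle.even (h : G.HasHamiltonianCycle) (hG : G.IsBipartite) :
    n % 2 = 0 := by
  obtain ⟨π, hon, hadj⟩ := h.exists_isCycleOn
  obtain ⟨S, h0, hS⟩ := hG.exists_side ⟨0, h.pos⟩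
  rw [← pow_apply_mem_iff (fun v => hS v (π v) (hadj v)) h0 n]
  have := hon.pow_card_apply (Finset.mem_univ (⟨0, h.pos⟩ : Fin n))
  rw [Finset.card_univ, Fintype.card_fin] at this
  rwa [this]

theorem Marked.mem_side {hn : 0 < n} {S : Set (Fin n)} (h0 : (⟨0, hn⟩ : Fin n) ∈ S)
    (hS : ∀ u v, G.Adj u v → (v ∈ S ↔ u ∉ S)) {k : ℕ} :
    ∀ {v : Fin n}, Marked (adjInput G.Adj) n k v → v ∈ S := by
  induction k with
  | zero =>
    intro v hv
    rwa [show v = ⟨0, hn⟩ from Fin.ext hv]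
  | succ k ih =>
    rintro v (hv | ⟨u, hu, w, hw, h1, h2, h3⟩)
    · exact ih hv
    · have h2' := hS _ _ ((arcRel_ne_zero ⟨u, hu⟩ ⟨w, hw⟩).1 h2)
      have h3' := hS _ _ ((arcRel_ne_zero ⟨w, hw⟩ v).1 h3)
      have := ih (v := ⟨u, hu⟩) h1
      tauto

theorem marked_pow {hn : 0 < n} {π : Equiv.Perm (Fin n)} (hadj : ∀ v, G.Adj v (π v)) (k : ℕ) :
    Marked (adjInput G.Adj) n k ((π ^ (2 * k)) ⟨0, hn⟩ : Fin n) := by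
  induction k with
  | zero => exact rfl
  | succ k ih =>
    refine Or.inr ⟨_, Fin.is_lt _, (π ((π ^ (2 * k)) ⟨0, hn⟩) : Fin n), Fin.is_lt _, ih,
      (arcRel_ne_zero _ _).2 (hadj _), (arcRel_ne_zero _ _).2 ?_⟩
    have : (π ^ (2 * (k + 1))) ⟨0, hn⟩ = π (π ((π ^ (2 * k)) ⟨0, hn⟩)) := by
      rw [show 2 * (k + 1) = 2 * k + 1 + 1 by ring, pow_succ', pow_succ', Equiv.Perm.mul_apply,
        Equiv.Perm.mul_apply]
    rw [this]
    exact hadj _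

/-- Walks of even length never leave the side of `0`. Conversely, even powers of the cycle reach
every vertex of that side within `n` steps, so `n` rounds of marking are enough. -/
theorem marked_iff_mem_side {hn : 0 < n} {S : Set (Fin n)} (h0 : (⟨0, hn⟩ : Fin n) ∈ S)
    (hS : ∀ u v, G.Adj u v → (v ∈ S ↔ u ∉ S)) {π : Equiv.Perm (Fin n)}
    (hon : π.IsCycleOn (Finset.univ : Finset (Fin n))) (hadj : ∀ v, G.Adj v (π v)) (v : Fin n) :
    Marked (adjInput G.Adj) n n v ↔ v ∈ S := by
  refine ⟨fun h => h.mem_side h0 hS, fun hv => ?_⟩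
  obtain ⟨i, hi, rfl⟩ := hon.exists_pow_eq (Finset.mem_univ (⟨0, hn⟩ : Fin n)) (Finset.mem_univ v)
  rw [Finset.card_univ, Fintype.card_fin] at hi
  rw [pow_apply_mem_iff (fun v => hS v (π v) (hadj v)) h0] at hv
  rw [show i = 2 * (i / 2) by omega]
  exact (marked_pow hadj _).mono (by omega)

variable {m : ℕ} {G : Digraph (Fin (2 * m + 2))}

theorem Digraph.HasHamiltonianCycle.hasConnectedPair (h : G.HasHamiltonianCycle)
    (hG : G.IsBipartite) : HasConnectedPair m
      (crossRel (arcRel (adjInput G.Adj) (2 * m + 2)) (mark (adjInput G.Adj) (2 * m + 2) (2 * m + 2)))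
      (crossRel (fun u v => arcRel (adjInput G.Adj) (2 * m + 2) v u)
        (mark (adjInput G.Adj) (2 * m + 2) (2 * m + 2))) := by
  obtain ⟨π, hon, hadj⟩ := h.exists_isCycleOn
  obtain ⟨S, h0, hS⟩ := hG.exists_side ⟨0, h.pos⟩
  have hmark := marked_iff_mem_side h0 hS hon hadj
  have hπ : ∀ v, π v ∈ S ↔ v ∉ S := fun v => hS v (π v) (hadj v)
  refine hasConnectedPair_of_perm (symmOn_crossRel _ _ _) (symmOn_crossRel _ _ _) π S hπ
    (fun x hx hx0 => ?_) (fun v hv => ?_) (fun v hv => ?_)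
  · have hpow : ∀ i : ℕ, x ((π ^ i) 0) = 0 := by
      intro i
      induction i with
      | zero => exact hx0
      | succ i ih => rw [pow_succ', Equiv.Perm.mul_apply, hx, ih]
    funext v
    obtain ⟨i, -, rfl⟩ := hon.exists_pow_eq (Finset.mem_univ 0) (Finset.mem_univ v)
    exact hpow i
  · rw [crossRel_mark_ne_zero, hmark, hmark, hπ]
    exact Or.inl ⟨(arcRel_ne_zero _ _).2 (hadj v), hv, not_not.2 hv⟩
  · rw [crossRel_mark_ne_zero, hmark, hmark, hπ]
    exact Or.inr ⟨(arcRel_ne_zero _ _).2 (hadj v), hv, hv⟩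

/-- Nothing is assumed about the marks. Both relations join marked to unmarked vertices only, so the
involutions exchange the two sets, and the arcs have the right direction whichever set is marked.
Hence wrong marks cannot cause a false positive answer. -/
theorem hasHamiltonianCycle_of_crossRel {k : ℕ} (h : HasConnectedPair m
      (crossRel (arcRel (adjInput G.Adj) (2 * m + 2)) (mark (adjInput G.Adj) (2 * m + 2) k))
      (crossRel (fun u v => arcRel (adjInput G.Adj) (2 * m + 2) v u)
        (mark (adjInput G.Adj) (2 * m + 2) k))) : G.HasHamiltonianCycle := by
  obtain ⟨σ, hσ, τ, hτ, hc, hρ₁, hρ₂⟩ := h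
  rw [mem_fpfInvolutions] at hσ hτ
  let S : Set (Fin (2 * m + 2)) := {v | Marked (adjInput G.Adj) (2 * m + 2) k v}
  have hmem : ∀ v : Fin (2 * m + 2), v ∈ S ↔ Marked (adjInput G.Adj) (2 * m + 2) k v :=
    fun _ => Iff.rfl
  simp only [crossRel_mark_ne_zero, ← hmem, arcRel_ne_zero] at hρ₁ hρ₂
  obtain ⟨π, hπσ, hπτ, hcyc⟩ := exists_perm_of_connectedPair (S := S) (fun v => (hσ v).1)
    (fun v => (hτ v).1) hc (fun v => by have := hρ₁ v; tauto) (fun v => by have := hρ₂ v; tauto)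
  have hne : ∀ v, π v ≠ v := fun v => by
    by_cases hv : v ∈ S
    · rw [hπσ v hv]
      exact (hσ v).2
    · rw [hπτ v hv]
      exact (hτ v).2
  refine ⟨π, ⟨0, hne 0, fun v _ => hcyc v⟩, hne, fun v => ?_⟩
  by_cases hv : v ∈ S
  · rw [hπσ v hv]
    have := hρ₁ v
    tauto
  · rw [hπτ v hv]
    have := hρ₂ v
    tauto

end Directed

/-! ### The program for bipartite directed graphs -/

namespace RAM

/-- The program text for `arcRel`, with the vertices in the given registers. -/
def arcExpr (x y : ℕ) : Expr := .load (1 + .reg x * .reg 3 + .reg y)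

/-- The program text for the final marks. -/
def markExpr (x : ℕ) : Expr := arr 14 (.reg 3 * .reg 3 + .reg x)

/-- The program text for `crossRel`. -/
def crossExpr (a b : Expr) : Expr :=
  a * (markExpr 10 * (1 - markExpr 11)) + b * (markExpr 11 * (1 - markExpr 10))

/-- One vertex on a walk of length two is tried. -/
def markStep : Prog :=
  .set 14 ((.reg 10 + 1) * .reg 3 + .reg 11)
    (1 - (1 - (arr 14 ((.reg 10 + 1) * .reg 3 + .reg 11)
      + arr 14 (.reg 10 * .reg 3 + .reg 12) * arcExpr 12 13 * arcExpr 13 11)))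

/-- Compute one mark from the preceding row of marks. -/
def markCell : Prog :=
  .seq (.set 14 ((.reg 10 + 1) * .reg 3 + .reg 11) (arr 14 (.reg 10 * .reg 3 + .reg 11)))
    (.loop 12 3 (.loop 13 3 markStep))

/-- Compute the marks, row by row. -/
def markProg : Prog :=
  .seq (.loop 11 3 (.set 14 (.reg 11) (1 - .reg 11))) (.loop 10 3 (.loop 11 3 markCell))

open Prog

/-- The first `c` marks have been computed. -/
def MarksTo (inp : ℕ → ℕ) (n c : ℕ) (st : Store) : Prop :=
  ∀ k, ∀ v < n, k * n + v < c → st.val 14 (k * n + v) = mark inp n k v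

variable {r : ℕ → Bool} {inp env : ℕ → ℕ} {st : Store} {n k v : ℕ}

theorem MarksTo.succ {c : ℕ} (h : MarksTo inp n c st) (hv : v < n) (hc : c = k * n + v)
    (hst : st.val 14 c = mark inp n k v) : MarksTo inp n (c + 1) st := by
  intro k' v' hv' hc'
  rcases (Nat.lt_succ_iff.1 hc').lt_or_eq with h1 | h1
  · exact h k' v' hv' h1
  · have hn : 0 < n := by omega
    have h2 : v' = v := by
      have := congrArg (· % n) (h1.trans hc)
      simpa [Nat.mul_add_mod', Nat.mod_eq_of_lt hv, Nat.mod_eq_of_lt hv'] using this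
    have h3 : k' = k := by
      rw [hc, h2] at h1
      exact Nat.eq_of_mul_eq_mul_right hn (Nat.add_right_cancel h1)
    rw [h1, hst, h2, h3]

theorem MarksTo.congr {c : ℕ} (h : MarksTo inp n c st) {st' : Store}
    (hst : ∀ i < c, st'.val 14 i = st.val 14 i) : MarksTo inp n c st' :=
  fun k v hv hc => by rw [hst _ hc, h k v hv hc]

theorem eval_arcExpr {V : ℕ → ℕ → ℕ} (h1 : env 1 = n * n + 1) (h3 : env 3 = n) {x y : ℕ}
    (hx : env x < n) (hy : env y < n) :
    (arcExpr x y).eval (toState inp env V) = arcRel inp n (env x) (env y) := by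
  simp only [arcExpr, Expr.eval_load, Expr.eval_add, Expr.eval_mul, Expr.eval_ofNat,
    Expr.eval_reg, toState_reg, h3]
  exact encode_adj h1 _ _ hx hy

/-- Sums and products of truth values act as disjunction and conjunction once `1 - (1 - x)` has
reduced every positive number to `1`. -/
theorem run_markStep (h2 : 1 < env 2) (h1 : env 1 = n * n + 1) (h3 : env 3 = n)
    (h10 : env 10 = k) (h11 : env 11 = v) {u w : ℕ} (h12 : env 12 = u) (h13 : env 13 = w)
    (hv : v < n) (hu : u < n) (hw : w < n) {P : Prop}
    (hst : MarksTo inp n ((k + 1) * n + v) st)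
    (hP : st.val 14 ((k + 1) * n + v) = truth P) :
    MarksTo inp n ((k + 1) * n + v) (markStep.run r inp env st) ∧
      (markStep.run r inp env st).val 14 ((k + 1) * n + v)
        = truth (P ∨ (Marked inp n k u ∧ arcRel inp n u w ≠ 0 ∧ arcRel inp n w v ≠ 0)) := by
  have harc : ∀ x y, env x < n → env y < n →
      (arcExpr x y).eval (toState inp env st.val) = arcRel inp n (env x) (env y) :=
    fun x y => eval_arcExpr h1 h3
  have hmark : st.val 14 (k * n + u) = mark inp n k u := hst k u hu (by rw [add_mul]; omega)
  refine ⟨hst.congr fun i hi => ?_, ?_⟩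
  · rw [markStep, run_set_val, if_neg]
    simp only [Expr.eval_add, Expr.eval_mul, Expr.eval_ofNat, Expr.eval_reg, toState_reg, h3, h10,
      h11]
    omega
  · rw [markStep, run_set_val, if_pos (by simp [h3, h10, h11])]
    simp only [Expr.eval_sub, Expr.eval_add, Expr.eval_mul, Expr.eval_ofNat,
      eval_arr _ _ _ (show 14 < 16 by norm_num), Expr.eval_reg, toState_reg]
    rw [harc 12 13 (by omega) (by omega), harc 13 11 (by omega) (by omega), h3, h10, h11, h12, h13,
      hP, hmark, Nat.mod_eq_of_lt (by omega), mark]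
    unfold truth
    by_cases hP : P
    · simp [hP]
    · by_cases hM : Marked inp n k u
      · by_cases ha : arcRel inp n u w = 0
        · simp [hP, ha]
        · by_cases hb : arcRel inp n w v = 0
          · simp [hP, hb]
          · have := Nat.mul_pos (Nat.pos_of_ne_zero ha) (Nat.pos_of_ne_zero hb)
            simp only [hP, hM, ha, hb, if_true, if_false, ne_eq, not_false_eq_true, and_self,
              false_or]
            rw [one_mul, zero_add, Nat.sub_eq_zero_of_le this]
      · simp [hP, hM]

theorem run_markCell (h2 : 1 < env 2) (h1 : env 1 = n * n + 1) (h3 : env 3 = n)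
    (h10 : env 10 = k) (h11 : env 11 = v) (hv : v < n)
    (hst : MarksTo inp n ((k + 1) * n + v) st) :
    MarksTo inp n ((k + 1) * n + v + 1) (markCell.run r inp env st) := by
  have hmark : st.val 14 (k * n + v) = mark inp n k v := hst k v hv (by rw [add_mul]; omega)
  have key := run_loop_induction (r := r) (inp := inp) (env := env) (x := 12) (b := 3)
    (st := (Prog.set 14 ((.reg 10 + 1) * .reg 3 + .reg 11)
      (arr 14 (.reg 10 * .reg 3 + .reg 11))).run r inp env st)
    (p := .loop 13 3 markStep)
    (fun i s => MarksTo inp n ((k + 1) * n + v) s ∧ s.val 14 ((k + 1) * n + v)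
      = truth (Marked inp n k v ∨ ∃ u < i, ∃ w < n, Marked inp n k u ∧ arcRel inp n u w ≠ 0 ∧
          arcRel inp n w v ≠ 0)) ⟨hst.congr fun i hi => ?_, ?_⟩ ?_
  · rw [h3] at key
    exact key.1.succ (k := k + 1) hv rfl key.2
  · rw [run_set_val, if_neg]
    simp only [Expr.eval_add, Expr.eval_mul, Expr.eval_ofNat, Expr.eval_reg, toState_reg, h3, h10,
      h11]
    omega
  · rw [run_set_val, if_pos (by simp [h3, h10, h11])]
    simp only [Expr.eval_add, Expr.eval_mul, eval_arr _ _ _ (show 14 < 16 by norm_num),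
      Expr.eval_reg, toState_reg, h3, h10, h11, hmark, mark]
    rw [Nat.mod_eq_of_lt ((truth_lt_two _).trans_le h2)]
    simp
  · intro u hu s _ ⟨hs, hsv⟩
    rw [h3] at hu
    have key := run_loop_induction (r := r) (inp := inp) (env := Function.update env 12 u) (x := 13)
      (b := 3) (st := s) (p := markStep)
      (fun i s => MarksTo inp n ((k + 1) * n + v) s ∧ s.val 14 ((k + 1) * n + v)
        = truth ((Marked inp n k v ∨ ∃ u' < u, ∃ w < n, Marked inp n k u' ∧
            arcRel inp n u' w ≠ 0 ∧ arcRel inp n w v ≠ 0) ∨ ∃ w < i, Marked inp n k u ∧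
            arcRel inp n u w ≠ 0 ∧ arcRel inp n w v ≠ 0)) ⟨hs, ?_⟩ ?_
    · rw [Function.update_of_ne (by norm_num), h3] at key
      refine ⟨key.1, key.2.trans (congrArg truth (propext (or_assoc.trans (or_congr_right ?_))))⟩
      simp only [Nat.lt_succ_iff_lt_or_eq, or_and_right, exists_or, exists_eq_left]
    · rw [hsv]
      simp
    · intro w hw s _ ⟨hs, hsv⟩
      rw [Function.update_of_ne (by norm_num), h3] at hw
      have := run_markStep (r := r) (env := Function.update (Function.update env 12 u) 13 w)
        (by simpa) (by simpa) (by simpa) (by simpa) (by simpa) (by simp) (by simp) hv hu hw hs hsv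
      refine ⟨this.1, this.2.trans (congrArg truth (propext (or_assoc.trans (or_congr_right ?_))))⟩
      simp only [Nat.lt_succ_iff_lt_or_eq, or_and_right, exists_or, exists_eq_left]

theorem run_markProg (h2 : 1 < env 2) (h1 : env 1 = n * n + 1) (h3 : env 3 = n) :
    MarksTo inp n ((n + 1) * n) (markProg.run r inp env st) := by
  have key₀ := run_loop_induction (r := r) (inp := inp) (env := env) (x := 11) (b := 3)
    (st := st) (p := .set 14 (.reg 11) (1 - .reg 11)) (fun i s => MarksTo inp n i s)
    (fun _ _ _ h => absurd h (Nat.not_lt_zero _)) ?_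
  · rw [h3] at key₀
    have key := run_loop_induction (r := r) (inp := inp) (env := env) (x := 10) (b := 3)
      (st := (Prog.loop 11 3 (.set 14 (.reg 11) (1 - .reg 11))).run r inp env st)
      (p := .loop 11 3 markCell) (fun i s => MarksTo inp n ((i + 1) * n) s) (by simpa using key₀) ?_
    · rw [h3] at key
      exact key
    · intro k hk s _ hs
      have key := run_loop_induction (r := r) (inp := inp) (env := Function.update env 10 k)
        (x := 11) (b := 3) (st := s) (p := markCell)
        (fun i s => MarksTo inp n ((k + 1) * n + i) s) hs ?_
      · rw [Function.update_of_ne (by norm_num), h3] at key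
        rwa [add_mul, one_mul]
      · intro v hv s _ hs
        rw [Function.update_of_ne (by norm_num), h3] at hv
        exact run_markCell (by simpa) (by simpa) (by simpa) (by simp) (by simp) hv hs
  · intro v hv s _ hs
    rw [h3] at hv
    refine MarksTo.succ (k := 0) (hs.congr fun i hi => ?_) hv (by simp) ?_
    · rw [run_set_val, if_neg]
      simp
      omega
    · rw [run_set_val, if_pos (by simp)]
      simp only [Expr.eval_sub, Expr.eval_ofNat, Expr.eval_reg, toState_reg, Function.update_self]
      rw [Function.update_of_ne (by norm_num), Nat.mod_eq_of_lt (by omega), mark]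
      by_cases h0 : v = 0
      · rw [truth_of (show Marked inp n 0 v from h0), h0]
      · rw [truth_of_not (show ¬ Marked inp n 0 v from h0)]
        omega

theorem exists_directed : ∃ (c : Cmd) (p : Polynomial ℕ), ∀ (n : ℕ) (G : Digraph (Fin n)),
    G.IsBipartite → Decides c (adjInput G.Adj) ((p.eval n : ℕ) * (3 : ℝ) ^ ((n : ℝ) / 2))
      G.HasHamiltonianCycle := by
  -- The guard is nonzero exactly when `n` is even and positive; for any other `n` a bipartite graph
  -- has no Hamiltonian cycle.
  refine ⟨mainCmd ((1 - .reg 3 % 2) * .reg 3) markProg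
    (crossExpr (arcExpr 10 11) (arcExpr 11 10)) (crossExpr (arcExpr 11 10) (arcExpr 10 11)), _,
    fun n G hG => decides_mainCmd (by simp [markProg, markCell, markStep, arcExpr, Prog.WF])
    (by simp [markProg, markCell, markStep, Prog.writes]) rfl
    (by simp [crossExpr, arcExpr, markExpr]) (by simp [crossExpr, arcExpr, markExpr])
    (fun hg h => ?_) (fun hg => ?_)⟩
  · have h0 := h.pos
    have h1 := h.even hG
    simp [testState, h1] at hg
    omega
  · replace hg : (1 - n % 2) * n ≠ 0 := hg
    obtain ⟨m, rfl⟩ : ∃ m, n = 2 * m + 2 := by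
      have := right_ne_zero_of_mul hg
      have := left_ne_zero_of_mul hg
      exact ⟨(n - 2) / 2, by omega⟩
    refine ⟨m, by omega, _, _, symmOn_crossRel _ _ _, symmOn_crossRel _ _ _,
      ⟨fun h => h.hasConnectedPair hG, hasHamiltonianCycle_of_crossRel⟩,
      fun r env hp h1 h3 st V hV u hu v hv => ?_⟩
    have h2 : 1 < env 2 := by
      rw [hp.reg2]
      exact Nat.one_lt_two_pow (by omega)
    have hm := run_markProg (r := r) (inp := adjInput G.Adj) (st := st) h2 h1 h3
    have hmark : ∀ x < 2 * m + 2, V 14 ((2 * m + 2) * (2 * m + 2) + x)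
        = mark (adjInput G.Adj) (2 * m + 2) (2 * m + 2) x := fun x hx => by
      rw [hV, hm _ x hx (by rw [add_mul _ 1, one_mul]; omega)]
    set env' := Function.update (Function.update env 10 u) 11 v with henv
    have e1 : env' 1 = (2 * m + 2) * (2 * m + 2) + 1 := by simpa [henv] using h1
    have e3 : env' 3 = 2 * m + 2 := by simpa [henv] using h3
    have e10 : env' 10 = u := by simp [henv]
    have e11 : env' 11 = v := by simp [henv]
    have harc : ∀ x y, env' x < 2 * m + 2 → env' y < 2 * m + 2 →
        (arcExpr x y).eval (toState (adjInput G.Adj) env' V)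
          = arcRel (adjInput G.Adj) (2 * m + 2) (env' x) (env' y) :=
      fun x y => eval_arcExpr e1 e3
    simp only [crossExpr, markExpr, Expr.eval_add, Expr.eval_mul, Expr.eval_sub,
      Expr.eval_ofNat, eval_arr _ _ _ (show 14 < 16 by norm_num), Expr.eval_reg, toState_reg,
      harc 10 11 (by omega) (by omega), harc 11 10 (by omega) (by omega), e3, e10, e11,
      hmark u hu, hmark v hv]
    exact ⟨rfl, rfl⟩

end RAM

theorem mainTheorem5 :
    (∃ (c : RAM.Cmd) (p : Polynomial ℕ), ∀ (n : ℕ) (G : SimpleGraph (Fin n)),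
      RAM.Decides c (adjInput G.Adj) ((p.eval n : ℕ) * (3 : ℝ) ^ ((n : ℝ) / 2))
        G.HasHamiltonianCycle) ∧
    (∃ (c : RAM.Cmd) (p : Polynomial ℕ), ∀ (n : ℕ) (G : Digraph (Fin n)), G.IsBipartite →
      RAM.Decides c (adjInput G.Adj) ((p.eval n : ℕ) * (3 : ℝ) ^ ((n : ℝ) / 2))
        G.HasHamiltonianCycle) :=
  ⟨RAM.exists_undirected, RAM.exists_directed⟩
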